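/- Let $M$ be a hyperbolic Riemann surface, i.e. a connected Riemann surface with a holomorphic universal covering $\varpi:\mathbb D\to M$ by the unit disc, equipped with the hyperbolic metric $ds^2_{\rm hyp}$ of Gauss curvature $-1$ descending from the Poincaré metric of $\mathbb D$; let $dV$ be its area measure, $|\cdot|$ the associated pointwise lengths of tangent vectors and forms (in a local coordinate $z$ with area element $dV=\mu\,\frac i2dz\wedge d\bar z$: $|h\,dz|=|h|/\sqrt\mu$ and $|h\,dz\wedge d\bar z|=|h|/\mu$), and $$\lambda_1(M)=\inf\left\{\frac{\int_M|\nabla\phi|^2dV}{\int_M|\phi|^2dV}:\ \phi\in C_0^\infty(M)\setminus\{0\}\right\},$$ where $C_0^\infty(M)$ is the set of complex-valued smooth functions with compact support. For a continuous real-valued function $\varphi$ on $M$ and a measurable $(p,q)$-form $f$ put $\|f\|_\varphi=\left(\int_M|f|^2e^{-\varphi}dV\right)^{1/2}\in[0,\infty]$, and let $L^2_{(p,q)}(M)$ be the space of measurable $(p,q)$-forms with $\|f\|_0<\infty$. For $v\in L^2_{(1,1)}(M)$, an $L^2$-minimal solution of $\bar\partial u=v$ is a form $u_0\in L^2_{(1,0)}(M)$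 which solves $\bar\partial u_0=v$ in the sense of distributions and satisfies $\|u_0\|_0\le\|u\|_0$ for every solution $u\in L^2_{(1,0)}(M)$ of $\bar\partial u=v$. For every $\tau>0$ there is a constant ${\rm const}_\tau>0$, depending only on $\tau$, such that the following holds for every hyperbolic Riemann surface $M$ with $\tau<\lambda_1(M)/9$. Let $\varphi$ be a real-valued function on $M$ that is Lipschitz continuous with respect to the hyperbolic distance and satisfies $|\partial\varphi|^2\le\tau$ almost everywhere, and let $v\in L^2_{(1,1)}(M)$. Then the $L^2$-minimal solution $u_0$ of $\bar\partial u=v$ exists, is unique up to equality almost everywhere, and satisfies $$\|u_0\|_{-\varphi}\le{\rm const}_\tau\,\|v\|_{-\varphi}$$ (trivially true when the right-hand side is $+\infty$). -/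

import Mathlib

open Set MeasureTheory
open scoped Manifold ContDiff ENNReal NNReal

noncomputable section

namespace HypSurface

/-!
Conventions.  `M` is a Riemann surface: a manifold modelled on `ℂ`.  The tangent space of `M` at `x`
is, in Mathlib, the model space `ℂ`, read in the preferred chart at `x`; it is the same for the
complex model `𝓘(ℂ, ℂ)` and for the underlying real model `𝓘(ℝ, ℂ)`.  Multiplication by `I` is the
complex structure of the surface, and `(1, I)` is an oriented basis of the tangent plane.
-/

/-- `π` restricts to a holomorphic covering of `M` by the open unit disc, so that the unit disc is the
universal covering of `M`.  (The values of `π` outside the disc are irrelevant.) -/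
structure IsDiscCovering {M : Type*} [TopologicalSpace M] [ChartedSpace ℂ M] (π : ℂ → M) :
    Prop where
  covering : IsCoveringMap ((Metric.ball (0 : ℂ) 1).domRestrict π)
  surjective : SurjOn π (Metric.ball (0 : ℂ) 1) univ
  holomorphic : MDifferentiableOn 𝓘(ℂ, ℂ) 𝓘(ℂ, ℂ) π (Metric.ball (0 : ℂ) 1)

section Forms

variable {M : Type*} [TopologicalSpace M] [ChartedSpace ℂ M]

/-- The tangent vector at `x` with coordinate `c` in the preferred chart at `x`. -/
def vec (x : M) (c : ℂ) : TangentSpace 𝓘(ℝ, ℂ) x := c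

/-- The coordinate of a tangent vector at `x` in the preferred chart at `x`. -/
def coord {x : M} (ξ : TangentSpace 𝓘(ℝ, ℂ) x) : ℂ := ξ

/-- (Not necessarily continuous) `(1,0)`-forms: sections of the complex-linear cotangent bundle. -/
abbrev Form10 (M : Type*) [TopologicalSpace M] [ChartedSpace ℂ M] : Type _ :=
  ∀ x : M, TangentSpace 𝓘(ℂ, ℂ) x →L[ℂ] ℂ

/-- (Not necessarily continuous) `(1,1)`-forms.  On a Riemann surface these are all the
complex-valued alternating real `2`-forms. -/
abbrev Form11 (M : Type*) [TopologicalSpace M] [ChartedSpace ℂ M] : Type _ :=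
  ∀ x : M, TangentSpace 𝓘(ℝ, ℂ) x [⋀^Fin 2]→L[ℝ] ℂ

/-- The value of a `(1,0)`-form on a (real) tangent vector. -/
def Form10.eval (u : Form10 M) {x : M} (ξ : TangentSpace 𝓘(ℝ, ℂ) x) : ℂ := u x (coord ξ)

/-- The differential `df` of a complex-valued function, on a tangent vector. -/
def diff (f : M → ℂ) (x : M) (ξ : TangentSpace 𝓘(ℝ, ℂ) x) : ℂ :=
  mfderiv 𝓘(ℝ, ℂ) 𝓘(ℝ, ℂ) f x ξ

/-- `∂f (ξ) = (df(ξ) - i df(iξ)) / 2`, the complex-linear part of `df`. -/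
def del (f : M → ℂ) (x : M) (ξ : TangentSpace 𝓘(ℝ, ℂ) x) : ℂ :=
  (diff f x ξ - Complex.I * diff f x (vec x (Complex.I * coord ξ))) / 2

/-- `∂̄f (ξ) = (df(ξ) + i df(iξ)) / 2`, the complex-antilinear part of `df`. -/
def delbar (f : M → ℂ) (x : M) (ξ : TangentSpace 𝓘(ℝ, ℂ) x) : ℂ :=
  (diff f x ξ + Complex.I * diff f x (vec x (Complex.I * coord ξ))) / 2

/-- `(∂̄f ∧ u)(ξ, η) = ∂̄f(ξ) u(η) - ∂̄f(η) u(ξ)`. -/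
def delbarWedge (f : M → ℂ) (u : Form10 M) (x : M) (ξ η : TangentSpace 𝓘(ℝ, ℂ) x) : ℂ :=
  delbar f x ξ * u.eval η - delbar f x η * u.eval ξ

/-- Complex-valued smooth functions with compact support. -/
def IsTest (g : M → ℂ) : Prop :=
  ContMDiff 𝓘(ℝ, ℂ) 𝓘(ℝ, ℂ) ∞ g ∧ HasCompactSupport g

end Forms

section Metric

variable {M : Type*} [TopologicalSpace M] [ChartedSpace ℂ M]

/-- The image under `dπ_z` of the tangent vector `c` of the disc at `z`. -/
def push (π : ℂ → M) (z : ℂ) (c : ℂ) : TangentSpace 𝓘(ℝ, ℂ) (π z) :=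
  mfderiv 𝓘(ℝ, ℂ) 𝓘(ℝ, ℂ) π z c

/-- The Poincaré metric of curvature `-1` on the disc is `discScale z ^ 2 * |dz| ^ 2`. -/
def discScale (z : ℂ) : ℝ := 2 / (1 - ‖z‖ ^ 2)

/-- The hyperbolic metric on `M` is the conformal metric whose pull-back by `π` is the Poincaré
metric.  `hypScale π x` is the hyperbolic length of the coordinate vector `1` at `x`: it is the `r`
with `r * |dπ_z(1)| = discScale z` for `z` over `x`.  As deck transformations are isometries of the
disc, all `z` over `x` give the same `r`, and the infimum is over a single value. -/
def hypScale (π : ℂ → M) (x : M) : ℝ :=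
  sInf {r : ℝ | ∃ z ∈ Metric.ball (0 : ℂ) 1, π z = x ∧ r * ‖coord (push π z 1)‖ = discScale z}

/-- Hyperbolic length of a tangent vector. -/
def hypLength (π : ℂ → M) (x : M) (ξ : TangentSpace 𝓘(ℝ, ℂ) x) : ℝ :=
  hypScale π x * ‖coord ξ‖

/-- The distance of the hyperbolic metric: the infimum of the lengths of `C¹` paths. -/
def hypEDist (π : ℂ → M) (x y : M) : ℝ≥0∞ :=
  letI : ∀ p : M, ENorm (TangentSpace 𝓘(ℝ, ℂ) p) :=
    fun p => ⟨fun ξ => ENNReal.ofReal (hypLength π p ξ)⟩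
  Manifold.riemannianEDist 𝓘(ℝ, ℂ) x y

/-- Lipschitz continuity with respect to the hyperbolic distance. -/
def HypLipschitz (π : ℂ → M) (φ : M → ℝ) : Prop :=
  ∃ K : ℝ≥0, ∀ x y : M, edist (φ x) (φ y) ≤ K * hypEDist π x y

/-- Pointwise length of a `(1,0)`-form: its modulus on a unit vector. -/
def Form10.len (π : ℂ → M) (u : Form10 M) (x : M) : ℝ :=
  ‖u.eval (vec x 1)‖ / hypScale π x

/-- Pointwise length of a `(1,1)`-form.  In a local coordinate `z` with metric `μ |dz|^2` the form
`h dz ∧ dz̄` has length `|h| / μ`; its value on `(1, i)` is `-2 i h`. -/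
def Form11.len (π : ℂ → M) (v : Form11 M) (x : M) : ℝ :=
  ‖v x ![vec x 1, vec x Complex.I]‖ / (2 * hypScale π x ^ 2)

/-- Pointwise length of the `(1,0)`-form `∂f`. -/
def delLen (π : ℂ → M) (f : M → ℂ) (x : M) : ℝ :=
  ‖del f x (vec x 1)‖ / hypScale π x

/-- `|∇f|^2 = |df(e)|^2 + |df(ie)|^2` for a unit vector `e`. -/
def gradSq (π : ℂ → M) (f : M → ℂ) (x : M) : ℝ :=
  (‖diff f x (vec x 1)‖ ^ 2 + ‖diff f x (vec x Complex.I)‖ ^ 2) / hypScale π x ^ 2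

/-- Hyperbolic area on the disc (used on subsets of the disc only). -/
def discArea : Measure ℂ :=
  volume.withDensity fun z => ENNReal.ofReal (discScale z ^ 2)

variable [MeasurableSpace M]

/-- The area measure `dV` of the hyperbolic metric of `M`: the measure glued from the images of the
hyperbolic area of open sheets, i.e. of open subsets of the disc on which `π` is injective (hence
an isometry onto its image).  These images agree on overlaps, so that gluing is the supremum. -/
def hypArea (π : ℂ → M) : Measure M :=
  ⨆ (U : Set ℂ) (_ : IsOpen U) (_ : U ⊆ Metric.ball (0 : ℂ) 1) (_ : InjOn π U),
    (discArea.restrict U).map π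

/-- The bottom of the spectrum of `-Δ`, as the infimum of the Rayleigh quotients. -/
def lambda1 (π : ℂ → M) : ℝ :=
  sInf {r : ℝ | ∃ g : M → ℂ, IsTest g ∧ g ≠ 0 ∧
    r = (∫ x, gradSq π g x ∂hypArea π) / ∫ x, ‖g x‖ ^ 2 ∂hypArea π}

/-- `∫_M α` for a `2`-form with values `α x ξ η`: as `dV(e, ie) = 1` for a unit vector `e`,
one has `α = α(e, ie) dV`. -/
def integral2 (π : ℂ → M) (α : ∀ x : M, TangentSpace 𝓘(ℝ, ℂ) x → TangentSpace 𝓘(ℝ, ℂ) x → ℂ) :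
    ℂ :=
  ∫ x, α x (vec x 1) (vec x Complex.I) / ((hypScale π x ^ 2 : ℝ) : ℂ) ∂hypArea π

/-- The weighted norm `‖u‖_φ = (∫ |u|^2 e^{-φ} dV)^{1/2}` of a `(1,0)`-form, possibly `∞`. -/
def Form10.wnorm (π : ℂ → M) (φ : M → ℝ) (u : Form10 M) : ℝ≥0∞ :=
  (∫⁻ x, ENNReal.ofReal (u.len π x ^ 2 * Real.exp (-φ x)) ∂hypArea π) ^ (1 / 2 : ℝ)

/-- The weighted norm `‖v‖_φ = (∫ |v|^2 e^{-φ} dV)^{1/2}` of a `(1,1)`-form, possibly `∞`. -/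
def Form11.wnorm (π : ℂ → M) (φ : M → ℝ) (v : Form11 M) : ℝ≥0∞ :=
  (∫⁻ x, ENNReal.ofReal (v.len π x ^ 2 * Real.exp (-φ x)) ∂hypArea π) ^ (1 / 2 : ℝ)

/-- Square-integrable `(1,0)`-forms: measurable (i.e. the coefficient of the pull-back to the disc
is Lebesgue measurable) and of finite norm. -/
def Form10.MemL2 (π : ℂ → M) (u : Form10 M) : Prop :=
  AEMeasurable (fun z : ℂ => u.eval (push π z 1)) (volume.restrict (Metric.ball (0 : ℂ) 1)) ∧
    u.wnorm π (fun _ => 0) < ⊤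

/-- Square-integrable `(1,1)`-forms. -/
def Form11.MemL2 (π : ℂ → M) (v : Form11 M) : Prop :=
  AEMeasurable (fun z : ℂ => v (π z) ![push π z 1, push π z Complex.I])
      (volume.restrict (Metric.ball (0 : ℂ) 1)) ∧
    v.wnorm π (fun _ => 0) < ⊤

/-- `∂̄u = v` in the sense of distributions: `∫ g v = - ∫ ∂̄g ∧ u` for every test function `g`. -/
def DbarEq (π : ℂ → M) (u : Form10 M) (v : Form11 M) : Prop :=
  ∀ g : M → ℂ, IsTest g →
    integral2 π (fun x ξ η => g x * v x ![ξ, η]) = -integral2 π (delbarWedge g u)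

/-- `u` is an `L²`-minimal solution of `∂̄u = v`. -/
def IsMinimalSolution (π : ℂ → M) (u : Form10 M) (v : Form11 M) : Prop :=
  u.MemL2 π ∧ DbarEq π u v ∧
    ∀ w : Form10 M, w.MemL2 π → DbarEq π w v →
      u.wnorm π (fun _ => 0) ≤ w.wnorm π (fun _ => 0)

end Metric

end HypSurface

end

open HypSurface

/-!
The covering `π` is used to move the whole problem to a fundamental domain `F = range s` in the disc,
where `s` is a Borel section of `π`.  With `ρ |dz|` the Poincaré metric, a square-integrable
`(1,0)`-form becomes its coefficient `a ∈ L²(F)`, a `(1,1)`-form becomes a normalized coefficient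
`f ∈ L²(F)`, and a test function `g` becomes the pair `(ρ · g ∘ π, ∂(g ∘ π)/∂z)`.  Let `Γ` be the
closure of the space of these pairs in `L²(F) × L²(F)`: the graph of the closed operator `T = ∂`,
acting on functions.  By the definition of distributional solutions, `∂̄u = v` says that `a` solves
`T^* a = f`, that is, `⟪q.2, a⟫ = ⟪q.1, f⟫` for all `q ∈ Γ` (`dbarEq_iff_inner`).

Stokes' theorem gives `∫ |∂g|² = ∫ |∂̄g|²` for test functions, so the definition of `λ₁` becomes the
Poincaré inequality `λ₁ ‖q.1‖² ≤ 4 ‖q.2‖²` on `Γ` (`IsTest.poincare`,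
`poincare_topologicalClosure`).  By Riesz' theorem there is therefore a solution of the form `a = T w`
(`exists_weak_solution`); it is orthogonal to its difference with any other solution, so it is the
unique one of minimal norm (`norm_sq_of_weak_solution`).

For the weighted bound, let `ψ = exp (φ / 2)`, so that `|∂ψ| ≤ (√τ / 2) ψ`.  Testing
`T^* T w = f` against `ψ² w` gives `‖T (ψ w)‖² - ‖(∂ψ) w‖² = Re ⟪ψ w, ψ f⟫`.  As `λ₁ > 9 τ`, the
second term is absorbed into the first by the Poincaré inequality, which yields
`‖ψ T w‖ ≤ τ^(-1/2) ‖ψ f‖` (`weighted_estimate`).  This requires `Γ` to be stable under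
multiplication by `ψ`, which holds for bounded Lipschitz functions: test functions are cut into pieces
supported in sheets of the covering, and `ψ` is mollified there (`IsTest.exists_approx_mul`,
`mul_mem_topologicalClosure`).  Boundedness is achieved by replacing `φ` with `min φ N`, whose
gradient is no larger (`norm_dz_exp_min_le`); the bound does not depend on `N`, and `N → ∞` by monotone
convergence (`weighted_estimate_lintegral`).

The geometry behind the reduction is that deck transformations are isometries of the disc, by the
Schwarz–Pick lemma, so that `hypScale` and `hypArea` are what the covering makes them
(`hypScale_eq`, `hypArea_restrict_sheet`, `exists_isSection`).
-/

open Set MeasureTheory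
open scoped Manifold ContDiff ENNReal NNReal

noncomputable section

namespace HypSurface

/-! ### A weighted estimate in Hilbert space -/

section Hilbert

variable {E : Type*} [NormedAddCommGroup E] [InnerProductSpace ℂ E]

open scoped InnerProductSpace

/-- If a closed operator `T`, with graph `Γ`, is bounded below, then `T^* T w = f` has a weak solution
`w`.  Indeed, the range of `T` is closed, and `T w` represents the functional `q ↦ ⟪q, f⟫`, read on
the range of `T`, by Riesz' theorem. -/
theorem exists_weak_solution [CompleteSpace E] {lam : ℝ} (hlam : 0 < lam) (Γ : Submodule ℂ (E × E))
    (hΓ : IsClosed (Γ : Set (E × E))) (hP : ∀ p ∈ Γ, lam * ‖p.1‖ ^ 2 ≤ 4 * ‖p.2‖ ^ 2) (f : E) :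
    ∃ p ∈ Γ, ∀ q ∈ Γ, ⟪q.2, p.2⟫_ℂ = ⟪q.1, f⟫_ℂ := by
  obtain ⟨c, hc0, hc⟩ : ∃ c : ℝ≥0, 1 ≤ c ∧ ∀ p ∈ Γ, ‖p.1‖ ≤ c * ‖p.2‖ := by
    have hc : 0 ≤ 1 + 2 / √lam := by positivity
    refine ⟨(1 + 2 / √lam).toNNReal, ?_, fun p hp => ?_⟩
    · rw [Real.one_le_toNNReal]
      have : 0 ≤ 2 / √lam := by positivity
      linarith
    · have h1 : ‖p.1‖ ≤ 2 / √lam * ‖p.2‖ := by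
        apply le_of_sq_le_sq _ (by positivity)
        rw [mul_pow, div_pow, Real.sq_sqrt hlam.le]
        rw [div_mul_eq_mul_div, le_div_iff₀ hlam]
        linarith [hP p hp]
      rw [Real.coe_toNNReal _ hc]
      nlinarith [norm_nonneg p.2]
  have : CompleteSpace Γ := hΓ.completeSpace_coe
  let P : Γ →L[ℂ] E := (ContinuousLinearMap.snd ℂ E E).comp Γ.subtypeL
  have hPn : ∀ x : Γ, ‖x‖ ≤ c * ‖P x‖ := by
    intro x
    have := hc x x.2
    rw [Submodule.coe_norm, Prod.norm_def]
    refine max_le this ?_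
    have h1 : (1 : ℝ) ≤ c := by exact_mod_cast hc0
    change ‖(x : E × E).2‖ ≤ c * ‖(x : E × E).2‖
    nlinarith [norm_nonneg (x : E × E).2]
  have hanti : AntilipschitzWith c P := AddMonoidHomClass.antilipschitz_of_bound P hPn
  have hcl : IsClosed (P.range : Set E) := hanti.isClosed_range P.uniformContinuous
  have : CompleteSpace P.range := hcl.completeSpace_coe
  let e := LinearEquiv.ofInjective P.toLinearMap hanti.injective
  let l : P.range →L[ℂ] ℂ := LinearMap.mkContinuous
    (((innerSL ℂ f).toLinearMap.comp (LinearMap.fst ℂ E E)).comp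
      (Γ.subtype.comp e.symm.toLinearMap)) (‖f‖ * c) (by
        intro y
        obtain ⟨x, rfl⟩ := e.surjective y
        simp only [LinearMap.comp_apply, LinearEquiv.coe_coe, LinearEquiv.symm_apply_apply]
        refine (norm_inner_le_norm (𝕜 := ℂ) f _).trans ?_
        rw [mul_assoc]
        gcongr
        exact hc x x.2)
  let y := (InnerProductSpace.toDual ℂ P.range).symm l
  obtain ⟨⟨p, hp⟩, hpy⟩ := e.surjective y
  refine ⟨p, hp, fun q hq => ?_⟩
  have h1 : ⟪y, e ⟨q, hq⟩⟫_ℂ = l (e ⟨q, hq⟩) := InnerProductSpace.toDual_symm_apply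
  have h2 : l (e ⟨q, hq⟩) = ⟪f, q.1⟫_ℂ := by
    simp [l]
  rw [h2, ← hpy] at h1
  have h3 : ⟪p.2, q.2⟫_ℂ = ⟪f, q.1⟫_ℂ := h1
  rw [← inner_conj_symm, h3, inner_conj_symm]

/-- The weighted estimate for a weak solution of `T^* T w = f`, where `Γ` is the graph of `T`.  Here `A`
plays the role of multiplication by a real function `ψ`, and `B` of multiplication by the derivative
of `ψ`; thus `hmul` is the product rule for `T (ψ w)`, and `hB` bounds the derivative of `log ψ`. -/
theorem weighted_estimate {lam τ : ℝ} (hτ : 0 < τ) (hlam : 9 * τ < lam) (Γ : Submodule ℂ (E × E))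
    (hP : ∀ p ∈ Γ, lam * ‖p.1‖ ^ 2 ≤ 4 * ‖p.2‖ ^ 2) (A B : E →L[ℂ] E)
    (hA : ∀ x y, ⟪A x, y⟫_ℂ = ⟪x, A y⟫_ℂ) (hAB : ∀ x, A (B x) = B (A x))
    (hB : ∀ x, 4 * ‖B x‖ ^ 2 ≤ τ * ‖A x‖ ^ 2)
    (hmul : ∀ p ∈ Γ, (A p.1, A p.2 + B p.1) ∈ Γ) {f : E} {p : E × E} (hp : p ∈ Γ)
    (hsol : ∀ q ∈ Γ, ⟪q.2, p.2⟫_ℂ = ⟪q.1, f⟫_ℂ) :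
    ‖A p.2‖ ≤ (1 / √τ) * ‖A f‖ := by
  set w := p.1
  set g := A w
  set G := A p.2 + B w
  have hg := hmul p hp
  have hg2 := hmul _ hg
  have h1 := hsol _ hg2
  have hAp : A p.2 = G - B w := by simp [G]
  have e1 : ⟪A G + B g, p.2⟫_ℂ = ⟪G, G⟫_ℂ - ⟪G, B w⟫_ℂ + ⟪B w, G⟫_ℂ - ⟪B w, B w⟫_ℂ := by
    rw [inner_add_left, hA, ← hAB, hA, hAp]
    simp only [inner_sub_right]; ring
  have e2 : ⟪A g, f⟫_ℂ = ⟪g, A f⟫_ℂ := hA _ _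
  -- the equation tested against `A (A w)`
  have h2 : ‖G‖ ^ 2 - ‖B w‖ ^ 2 = (⟪g, A f⟫_ℂ).re := by
    have h1' : ⟪A G + B g, p.2⟫_ℂ = ⟪A g, f⟫_ℂ := h1
    rw [e1, e2] at h1'
    rw [← h1']
    have := inner_re_symm (𝕜 := ℂ) G (B w)
    simp only [Complex.sub_re, Complex.add_re]
    rw [← inner_self_eq_norm_sq (𝕜 := ℂ) G, ← inner_self_eq_norm_sq (𝕜 := ℂ) (B w)]
    simp only [RCLike.re_eq_complex_re] at *
    linarith
  have h3 : (⟪g, A f⟫_ℂ).re ≤ ‖g‖ * ‖A f‖ :=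
    (Complex.re_le_norm _).trans (norm_inner_le_norm _ _)
  have h4 : lam * ‖g‖ ^ 2 ≤ 4 * ‖G‖ ^ 2 := hP _ hg
  have h5 : 4 * ‖B w‖ ^ 2 ≤ τ * ‖g‖ ^ 2 := hB w
  have hb : ‖A p.2‖ ≤ ‖G‖ + ‖B w‖ := by rw [hAp]; exact norm_sub_le _ _
  set F := ‖A f‖
  have hF : 0 ≤ F := norm_nonneg _
  have hs : 0 < √τ := Real.sqrt_pos.2 hτ
  obtain ⟨s, hs0, hsτ⟩ : ∃ s : ℝ, 0 < s ∧ s ^ 2 = τ := ⟨√τ, hs, Real.sq_sqrt hτ.le⟩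
  have : √τ = s := by rw [← hsτ]; exact Real.sqrt_sq hs0.le
  rw [this, one_div, inv_mul_eq_div, le_div_iff₀ hs0]
  -- `lam ‖g‖² ≤ 4 ‖G‖² ≤ τ ‖g‖² + 4 ‖g‖ F`, and `lam > 9 τ`
  have h6 : 2 * τ * ‖g‖ ≤ F := by
    rcases (norm_nonneg g).eq_or_lt with h0 | h0
    · rw [← h0]; simpa using hF
    · by_contra! hcon
      nlinarith [mul_lt_mul_of_pos_right hcon h0, sq_nonneg ‖g‖, mul_pos h0 h0]
  have h7 : s * ‖B w‖ ≤ F / 4 := by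
    apply le_of_sq_le_sq _ (by positivity)
    nlinarith [mul_nonneg hτ.le (norm_nonneg g)]
  have h8 : s * ‖G‖ ≤ 3 / 4 * F := by
    apply le_of_sq_le_sq _ (by positivity)
    have : (s * ‖G‖) ^ 2 ≤ (s * ‖B w‖) ^ 2 + τ * ‖g‖ * F := by
      rw [mul_pow, mul_pow, hsτ]; nlinarith
    have h9 : (s * ‖B w‖) ^ 2 ≤ (F / 4) ^ 2 := by gcongr
    nlinarith
  nlinarith

/-- A solution in the range of `T` is orthogonal to its difference with any other solution. -/
theorem norm_sq_of_weak_solution (Γ : Submodule ℂ (E × E))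
    {p : E × E} (hp : p ∈ Γ) {a : E}
    (ha : ∀ q ∈ Γ, ⟪q.2, a⟫_ℂ = ⟪q.2, p.2⟫_ℂ) :
    ‖a‖ ^ 2 = ‖p.2‖ ^ 2 + ‖a - p.2‖ ^ 2 := by
  have h0 : ⟪p.2, a - p.2⟫_ℂ = 0 := by rw [inner_sub_right, ha p hp, sub_self]
  have := norm_add_sq_eq_norm_sq_add_norm_sq_of_inner_eq_zero (𝕜 := ℂ) p.2 (a - p.2) h0
  simp only [add_sub_cancel] at this
  simpa [sq] using this

end Hilbert

/-! ### Complex analysis of one variable -/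

section OneVariable

open Filter Topology Metric

/-- An injective holomorphic function has non-vanishing derivative. -/
theorem deriv_ne_zero_of_openPartialHomeomorph (e : OpenPartialHomeomorph ℂ ℂ)
    (he : DifferentiableOn ℂ e e.source) {z : ℂ} (hz : z ∈ e.source) : deriv e z ≠ 0 := by
  have han : AnalyticAt ℂ e z := he.analyticAt (e.open_source.mem_nhds hz)
  rcases han.deriv.eventually_eq_zero_or_eventually_ne_zero with h | h
  · exfalso
    obtain ⟨r, hr, hball⟩ := Metric.eventually_nhds_iff_ball.1
      (h.and (e.open_source.eventually_mem hz))
    have hz' : z + (r / 2 : ℝ) ∈ ball z r := by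
      simp [abs_of_pos hr, hr]
    have := isOpen_ball.is_const_of_deriv_eq_zero (convex_ball z r).isPreconnected
      (he.mono fun y hy => (hball y hy).2) (fun y hy => (hball y hy).1) hz' (mem_ball_self hr)
    have := e.injOn (hball _ hz').2 hz this
    simp at this
    exact hr.ne' this
  · -- zeros of the derivative are isolated, so the inverse is holomorphic near `e z`, at first off
    -- `e z`, but then also there, because it is continuous
    have hw : e z ∈ e.target := e.map_source hz
    have hcont : ContinuousAt e.symm (e z) := e.continuousAt_symm hw
    have hsz : e.symm (e z) = z := e.left_inv hz
    have h1 : Tendsto e.symm (𝓝[≠] (e z)) (𝓝[≠] z) := by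
      refine tendsto_nhdsWithin_iff.2 ⟨?_, ?_⟩
      · have := hcont.tendsto
        rw [hsz] at this
        exact this.mono_left nhdsWithin_le_nhds
      · filter_upwards [self_mem_nhdsWithin,
          mem_nhdsWithin_of_mem_nhds (e.open_target.mem_nhds hw)] with w hw1 hw2 h3
        exact hw1 (by rw [← e.right_inv hw2, h3]; rfl)
    have h2 : ∀ᶠ w in 𝓝[≠] (e z), DifferentiableAt ℂ e.symm w := by
      filter_upwards [h1.eventually h,
        mem_nhdsWithin_of_mem_nhds (e.open_target.mem_nhds hw)] with w hw1 hw2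
      have hd : DifferentiableAt ℂ e (e.symm w) :=
        he.differentiableAt (e.open_source.mem_nhds (e.map_target hw2))
      exact (e.hasDerivAt_symm hw2 hw1 hd.hasDerivAt).differentiableAt
    have h3 : DifferentiableAt ℂ e.symm (e z) :=
      (Complex.analyticAt_of_differentiable_on_punctured_nhds_of_continuousAt h2
        hcont).differentiableAt
    have h4 : HasDerivAt (e.symm ∘ e) (deriv e.symm (e z) * deriv e z) z :=
      h3.hasDerivAt.comp z han.differentiableAt.hasDerivAt
    have h5 : HasDerivAt (e.symm ∘ e) 1 z :=
      (hasDerivAt_id z).congr_of_eventuallyEq (e.eventually_left_inverse hz)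
    intro h0
    have := h4.unique h5
    simp [h0] at this

theorem one_add_conj_mul_ne_zero {a z : ℂ} (ha : ‖a‖ < 1) (hz : ‖z‖ < 1) :
    1 + (starRingEnd ℂ) a * z ≠ 0 := by
  intro h
  have : (starRingEnd ℂ) a * z = -1 := by linear_combination h
  have h1 : ‖a‖ * ‖z‖ = 1 := by rw [← RCLike.norm_conj a, ← norm_mul, this]; simp
  nlinarith [norm_nonneg a, norm_nonneg z]

theorem norm_moebius_lt_one {a z : ℂ} (ha : ‖a‖ < 1) (hz : ‖z‖ < 1) :
    ‖(z + a) / (1 + (starRingEnd ℂ) a * z)‖ < 1 := by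
  have h0 := one_add_conj_mul_ne_zero ha hz
  rw [norm_div, div_lt_one (norm_pos_iff.2 h0)]
  apply lt_of_pow_lt_pow_left₀ 2 (norm_nonneg _)
  rw [Complex.sq_norm, Complex.sq_norm]
  have ha' : Complex.normSq a < 1 := by
    rw [← Complex.sq_norm]; nlinarith [norm_nonneg a]
  have hz' : Complex.normSq z < 1 := by
    rw [← Complex.sq_norm]; nlinarith [norm_nonneg z]
  have : 0 < (1 - Complex.normSq a) * (1 - Complex.normSq z) :=
    mul_pos (by linarith) (by linarith)
  rw [Complex.normSq_apply] at *
  simp only [Complex.normSq_apply, Complex.add_re, Complex.add_im, Complex.one_re, Complex.one_im,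
    Complex.mul_re, Complex.mul_im, Complex.conj_re, Complex.conj_im] at *
  nlinarith

theorem hasDerivAt_moebius {a z : ℂ} (h : 1 + (starRingEnd ℂ) a * z ≠ 0) :
    HasDerivAt (fun z => (z + a) / (1 + (starRingEnd ℂ) a * z))
      ((1 - (starRingEnd ℂ) a * a) / (1 + (starRingEnd ℂ) a * z) ^ 2) z := by
  have h1 : HasDerivAt (fun z => z + a) 1 z := (hasDerivAt_id z).add_const a
  have h2 : HasDerivAt (fun z => 1 + (starRingEnd ℂ) a * z) ((starRingEnd ℂ) a) z := by
    simpa using ((hasDerivAt_id z).const_mul ((starRingEnd ℂ) a)).const_add 1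
  refine (h1.div h2 h).congr_deriv ?_
  congr 1
  ring

/-- The Schwarz–Pick lemma. -/
theorem schwarz_pick {f : ℂ → ℂ} (hd : DifferentiableOn ℂ f (ball 0 1))
    (hm : MapsTo f (ball 0 1) (ball 0 1)) {a : ℂ} (ha : a ∈ ball (0 : ℂ) 1) :
    ‖deriv f a‖ * (1 - ‖a‖ ^ 2) ≤ 1 - ‖f a‖ ^ 2 := by
  have ha1 : ‖a‖ < 1 := by simpa using ha
  set b := f a with hb
  have hb1 : ‖b‖ < 1 := by simpa using hm ha
  have hb1' : ‖-b‖ < 1 := by simpa using hb1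
  let m : ℂ → ℂ → ℂ := fun a z => (z + a) / (1 + (starRingEnd ℂ) a * z)
  have hmaps : ∀ c : ℂ, ‖c‖ < 1 → MapsTo (m c) (ball 0 1) (ball 0 1) := by
    intro c hc z hz
    simpa [m] using norm_moebius_lt_one hc (by simpa using hz : ‖z‖ < 1)
  have hmd : ∀ c : ℂ, ‖c‖ < 1 → DifferentiableOn ℂ (m c) (ball 0 1) := by
    intro c hc z hz
    exact (hasDerivAt_moebius (one_add_conj_mul_ne_zero hc
      (by simpa using hz : ‖z‖ < 1))).differentiableAt.differentiableWithinAt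
  -- normalize so that `0 ↦ 0` and use the Schwarz lemma at the origin
  let h : ℂ → ℂ := m (-b) ∘ f ∘ m a
  have hma0 : m a 0 = a := by simp [m]
  have h0 : h 0 = 0 := by simp [h, ← hb, m]
  have hhm : MapsTo h (ball 0 1) (ball (h 0) 1) := by
    rw [h0]; exact (hmaps _ hb1').comp (hm.comp (hmaps _ ha1))
  have hhd : DifferentiableOn ℂ h (ball 0 1) :=
    (hmd _ hb1').comp (hd.comp (hmd _ ha1) (hmaps _ ha1)) (hm.comp (hmaps _ ha1))
  have hle := Complex.norm_deriv_le_div_of_mapsTo_ball hhd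
    (hhm.mono_right ball_subset_closedBall) one_pos
  have e1 : HasDerivAt (m a) (1 - (starRingEnd ℂ) a * a) 0 := by
    simpa using hasDerivAt_moebius (a := a) (z := 0) (by simp)
  have e2 : HasDerivAt f (deriv f a) (m a 0) := by
    rw [hma0]; exact (hd.differentiableAt (isOpen_ball.mem_nhds ha)).hasDerivAt
  have e3 := hasDerivAt_moebius (a := -b) (z := b) (one_add_conj_mul_ne_zero hb1' hb1)
  have e3' : HasDerivAt (m (-b)) ((1 - (starRingEnd ℂ) (-b) * (-b)) /
      (1 + (starRingEnd ℂ) (-b) * b) ^ 2) ((f ∘ m a) 0) := by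
    simpa only [Function.comp, hma0, ← hb] using e3
  have e4 := e3'.comp 0 (e2.comp 0 e1)
  rw [show h = m (-b) ∘ f ∘ m a from rfl, e4.deriv] at hle
  have ea : (1 - (starRingEnd ℂ) a * a) = ((1 - ‖a‖ ^ 2 : ℝ) : ℂ) := by
    rw [mul_comm, Complex.mul_conj, Complex.normSq_eq_norm_sq]; push_cast; rfl
  have eb : (1 - (starRingEnd ℂ) (-b) * (-b)) = ((1 - ‖b‖ ^ 2 : ℝ) : ℂ) := by
    rw [mul_comm, Complex.mul_conj, Complex.normSq_eq_norm_sq]; simp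
  have eb' : (1 + (starRingEnd ℂ) (-b) * b) = ((1 - ‖b‖ ^ 2 : ℝ) : ℂ) := by
    rw [← eb, map_neg]; ring
  have pa : 0 < 1 - ‖a‖ ^ 2 := by nlinarith [norm_nonneg a]
  have pb : 0 < 1 - ‖b‖ ^ 2 := by nlinarith [norm_nonneg b]
  rw [ea, eb, eb', norm_mul, norm_mul, norm_div, norm_pow, Complex.norm_of_nonneg pa.le,
    Complex.norm_of_nonneg pb.le, div_one] at hle
  have : (1 - ‖b‖ ^ 2) / (1 - ‖b‖ ^ 2) ^ 2 = (1 - ‖b‖ ^ 2)⁻¹ := by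
    field_simp
  rw [this, inv_mul_eq_div, div_le_one pb] at hle
  exact hle

end OneVariable

/-! ### Local geometry of the covering -/

section Local

open Filter Topology Metric

/-- The open unit disc. -/
abbrev disc : Set ℂ := ball (0 : ℂ) 1

variable {M : Type*} [TopologicalSpace M] [ChartedSpace ℂ M] {π : ℂ → M}

theorem IsDiscCovering.continuousOn (hπ : IsDiscCovering π) : ContinuousOn π disc := by
  rw [continuousOn_iff_continuous_domRestrict]
  exact hπ.covering.continuous

theorem IsDiscCovering.continuousAt (hπ : IsDiscCovering π) {z : ℂ} (hz : z ∈ disc) :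
    ContinuousAt π z :=
  hπ.continuousOn.continuousAt (isOpen_ball.mem_nhds hz)

theorem IsDiscCovering.isOpen_image (hπ : IsDiscCovering π) {O : Set ℂ} (hO : IsOpen O)
    (hOd : O ⊆ disc) : IsOpen (π '' O) := by
  have h := hπ.covering.isOpenMap _ (hO.preimage (continuous_subtype_val (p := (· ∈ disc))))
  convert h using 1
  ext x
  constructor
  · rintro ⟨z, hz, rfl⟩
    exact ⟨⟨z, hOd hz⟩, hz, rfl⟩
  · rintro ⟨z, hz, rfl⟩
    exact ⟨z, hz, rfl⟩

/-- An open subset of the disc on which `π` is injective. -/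
structure IsSheet (π : ℂ → M) (U : Set ℂ) : Prop where
  isOpen : IsOpen U
  subset : U ⊆ disc
  injOn : InjOn π U

theorem IsDiscCovering.exists_isSheet (hπ : IsDiscCovering π) {z : ℂ} (hz : z ∈ disc) :
    ∃ U, IsSheet π U ∧ z ∈ U := by
  obtain ⟨e, he, heq⟩ := hπ.covering.isLocalHomeomorph ⟨z, hz⟩
  refine ⟨Subtype.val '' e.source, ⟨?_, ?_, ?_⟩, ⟨⟨z, hz⟩, he, rfl⟩⟩
  · exact isOpen_ball.isOpenMap_subtype_val _ e.open_source
  · rintro _ ⟨w, -, rfl⟩; exact w.2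
  · rintro _ ⟨w, hw, rfl⟩ _ ⟨w', hw', rfl⟩ h
    have : e w = e w' := by rw [← heq]; exact h
    rw [e.injOn hw hw' this]

/-- The homeomorphism `π` of a sheet onto its image; the inverse is a local section of `π`. -/
def sheetHomeo (hπ : IsDiscCovering π) {U : Set ℂ} (hU : IsSheet π U) :
    OpenPartialHomeomorph ℂ M where
  toPartialEquiv := hU.injOn.toPartialEquiv
  open_source := hU.isOpen
  open_target := hπ.isOpen_image hU.isOpen hU.subset
  continuousOn_toFun := hπ.continuousOn.mono hU.subset
  continuousOn_invFun := by
    refine (continuousOn_open_iff (hπ.isOpen_image hU.isOpen hU.subset)).2 fun t ht => ?_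
    have : π '' U ∩ (hU.injOn.toPartialEquiv).symm ⁻¹' t = π '' (U ∩ t) := by
      ext x; constructor
      · rintro ⟨⟨z, hz, rfl⟩, hx⟩
        have h1 : hU.injOn.toPartialEquiv.symm (π z) = z := hU.injOn.toPartialEquiv.left_inv hz
        rw [mem_preimage, h1] at hx
        exact ⟨z, ⟨hz, hx⟩, rfl⟩
      · rintro ⟨z, ⟨hz, hx⟩, rfl⟩
        have h1 : hU.injOn.toPartialEquiv.symm (π z) = z := hU.injOn.toPartialEquiv.left_inv hz
        exact ⟨⟨z, hz, rfl⟩, by rwa [mem_preimage, h1]⟩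
    exact this ▸ hπ.isOpen_image (hU.isOpen.inter ht) (inter_subset_left.trans hU.subset)

variable (hπ : IsDiscCovering π) {U : Set ℂ} (hU : IsSheet π U)

theorem sheetHomeo_symm_apply {z : ℂ} (hz : z ∈ U) : (sheetHomeo hπ hU).symm (π z) = z :=
  (sheetHomeo hπ hU).left_inv hz

include hπ in
theorem IsDiscCovering.mdifferentiableAt {z : ℂ} (hz : z ∈ disc) :
    MDifferentiableAt 𝓘(ℂ, ℂ) 𝓘(ℂ, ℂ) π z :=
  hπ.holomorphic.mdifferentiableAt (isOpen_ball.mem_nhds hz)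

/-- Complex differentiable maps are real differentiable. -/
theorem _root_.MDifferentiableAt.real {N N' : Type*} [TopologicalSpace N] [ChartedSpace ℂ N]
    [TopologicalSpace N'] [ChartedSpace ℂ N'] {f : N → N'} {x : N}
    (h : MDifferentiableAt 𝓘(ℂ, ℂ) 𝓘(ℂ, ℂ) f x) : MDifferentiableAt 𝓘(ℝ, ℂ) 𝓘(ℝ, ℂ) f x := by
  rw [mdifferentiableAt_iff] at h ⊢
  exact ⟨h.1, h.2.restrictScalars ℝ⟩

theorem _root_.ContMDiffAt.real {N N' : Type*} [TopologicalSpace N] [ChartedSpace ℂ N]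
    [TopologicalSpace N'] [ChartedSpace ℂ N'] {f : N → N'} {x : N} {n : WithTop ℕ∞}
    (h : ContMDiffAt 𝓘(ℂ, ℂ) 𝓘(ℂ, ℂ) n f x) : ContMDiffAt 𝓘(ℝ, ℂ) 𝓘(ℝ, ℂ) n f x := by
  rw [contMDiffAt_iff] at h ⊢
  exact ⟨h.1, h.2.restrict_scalars ℝ⟩

/-- The surface as a real manifold. -/
theorem isManifold_real [IsManifold 𝓘(ℂ, ℂ) ω M] : IsManifold 𝓘(ℝ, ℂ) ∞ M := by
  have : IsManifold 𝓘(ℂ, ℂ) ∞ M := IsManifold.of_le (n := ω) le_top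
  apply isManifold_of_contDiffOn
  intro e e' he he'
  have := (contDiffGroupoid ∞ 𝓘(ℂ, ℂ)).compatible he he'
  rw [contDiffGroupoid, mem_groupoid_of_pregroupoid] at this
  exact ContDiffOn.restrict_scalars ℝ this.1

include hπ in
theorem differentiableAt_chart_comp [IsManifold 𝓘(ℂ, ℂ) ω M] (x₀ : M) {z : ℂ} (hz : z ∈ disc)
    (hx : π z ∈ (chartAt ℂ x₀).source) : DifferentiableAt ℂ (chartAt ℂ x₀ ∘ π) z := by
  have : IsManifold 𝓘(ℂ, ℂ) 1 M := IsManifold.of_le (n := ω) le_top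
  have h1 : MDifferentiableAt 𝓘(ℂ, ℂ) 𝓘(ℂ, ℂ) (chartAt ℂ x₀) (π z) :=
    mdifferentiableAt_atlas (chart_mem_atlas _ _) hx
  exact (h1.comp z (hπ.mdifferentiableAt hz)).differentiableAt

theorem sheet_chart_deriv_ne_zero [IsManifold 𝓘(ℂ, ℂ) ω M] (x₀ : M) {z : ℂ} (hz : z ∈ disc)
    (hx : π z ∈ (chartAt ℂ x₀).source) (hπ : IsDiscCovering π) :
    deriv (chartAt ℂ x₀ ∘ π) z ≠ 0 := by
  obtain ⟨U, hU, hzU⟩ := hπ.exists_isSheet hz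
  refine deriv_ne_zero_of_openPartialHomeomorph ((sheetHomeo hπ hU).trans (chartAt ℂ x₀)) ?_ ?_
  · rintro w ⟨hw1, hw2⟩
    exact (differentiableAt_chart_comp hπ x₀ (hU.subset hw1) hw2).differentiableWithinAt
  · exact ⟨hzU, hx⟩

theorem contMDiffAt_sheetHomeo_symm [IsManifold 𝓘(ℂ, ℂ) ω M] {x : M} (hx : x ∈ π '' U)
    {n : WithTop ℕ∞} :
    ContMDiffAt 𝓘(ℂ, ℂ) 𝓘(ℂ, ℂ) n (sheetHomeo hπ hU).symm x := by
  obtain ⟨z, hz, rfl⟩ := hx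
  set e := sheetHomeo hπ hU
  set E : OpenPartialHomeomorph ℂ ℂ := e.trans (chartAt ℂ (π z))
  have hzE : z ∈ E.source := ⟨hz, mem_chart_source _ _⟩
  have hd : DifferentiableOn ℂ E E.source := by
    rintro w ⟨hw1, hw2⟩
    exact (differentiableAt_chart_comp hπ _ (hU.subset hw1) hw2).differentiableWithinAt
  have hE : E z ∈ E.target := E.map_source hzE
  have hs : E.symm (E z) = z := E.left_inv hzE
  have han : AnalyticAt ℂ E z := hd.analyticAt (E.open_source.mem_nhds hzE)
  have h1 : ContDiffAt ℂ n E.symm (E z) := by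
    apply E.contDiffAt_symm_deriv (deriv_ne_zero_of_openPartialHomeomorph E hd hzE) hE
    · rw [hs]; exact han.differentiableAt.hasDerivAt
    · rw [hs]; exact han.contDiffAt
  rw [contMDiffAt_iff]
  refine ⟨e.continuousAt_symm (e.map_source hz), ?_⟩
  rw [ModelWithCorners.range_eq_univ]
  exact h1.contDiffWithinAt

theorem contMDiffAt_covering [IsManifold 𝓘(ℂ, ℂ) ω M] (hπ : IsDiscCovering π)
    {z : ℂ} (hz : z ∈ disc) {n : WithTop ℕ∞} :
    ContMDiffAt 𝓘(ℝ, ℂ) 𝓘(ℝ, ℂ) n π z := by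
  apply ContMDiffAt.real
  rw [contMDiffAt_iff]
  refine ⟨hπ.continuousAt hz, ?_⟩
  have : DifferentiableOn ℂ (chartAt ℂ (π z) ∘ π) (disc ∩ π ⁻¹' (chartAt ℂ (π z)).source) := by
    rintro w ⟨hw1, hw2⟩
    exact (differentiableAt_chart_comp hπ _ hw1 hw2).differentiableWithinAt
  have h2 := (this.analyticAt (z := z) (inter_mem (isOpen_ball.mem_nhds hz)
    ((hπ.continuousAt hz).preimage_mem_nhds (chart_source_mem_nhds _ _)))).contDiffAt (n := n)
  rw [ModelWithCorners.range_eq_univ]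
  exact h2.contDiffWithinAt

theorem coord_push [IsManifold 𝓘(ℂ, ℂ) ω M] (hπ : IsDiscCovering π) {z : ℂ} (hz : z ∈ disc)
    (c : ℂ) : coord (push π z c) = c * deriv (chartAt ℂ (π z) ∘ π) z := by
  have h := (hπ.mdifferentiableAt hz).real
  have hd : DifferentiableAt ℂ (chartAt ℂ (π z) ∘ π) z :=
    differentiableAt_chart_comp hπ _ hz (mem_chart_source _ _)
  have : mfderiv 𝓘(ℝ, ℂ) 𝓘(ℝ, ℂ) π z = fderiv ℝ (chartAt ℂ (π z) ∘ π) z := by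
    rw [h.mfderiv]; simp [fderivWithin_univ]; rfl
  unfold push coord
  rw [this, hd.fderiv_restrictScalars ℝ]
  exact (congrArg (fun L : ℂ →L[ℂ] ℂ => L c) hd.hasDerivAt.hasFDerivAt.fderiv).trans (by simp)

theorem coord_push_one_ne_zero [IsManifold 𝓘(ℂ, ℂ) ω M] (hπ : IsDiscCovering π) {z : ℂ}
    (hz : z ∈ disc) : coord (push π z 1) ≠ 0 := by
  rw [coord_push hπ hz, one_mul]
  exact sheet_chart_deriv_ne_zero _ hz (mem_chart_source _ _) hπ

theorem coord_push_eq [IsManifold 𝓘(ℂ, ℂ) ω M] (hπ : IsDiscCovering π) {z : ℂ} (hz : z ∈ disc)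
    (c : ℂ) : coord (push π z c) = c * coord (push π z 1) := by
  rw [coord_push hπ hz, coord_push hπ hz 1, one_mul]

/-- A function near `π z` is read off from its pull-back. -/
theorem eventuallyEq_comp_symm {N : Type*} (f : M → N) {z : ℂ} (hz : z ∈ U) :
    f =ᶠ[𝓝 (π z)] (f ∘ π) ∘ (sheetHomeo hπ hU).symm := by
  filter_upwards [(sheetHomeo hπ hU).open_target.mem_nhds ((sheetHomeo hπ hU).map_source hz)]
    with x hx
  exact congrArg f ((sheetHomeo hπ hU).right_inv hx).symm

theorem contMDiffAt_iff_comp [IsManifold 𝓘(ℂ, ℂ) ω M] (hπ : IsDiscCovering π) {f : M → ℂ}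
    {z : ℂ} (hz : z ∈ disc) :
    ContMDiffAt 𝓘(ℝ, ℂ) 𝓘(ℝ, ℂ) ∞ f (π z) ↔ ContDiffAt ℝ ∞ (f ∘ π) z := by
  constructor
  · intro h
    exact (h.comp z (contMDiffAt_covering hπ hz)).contDiffAt
  · intro h
    obtain ⟨U, hU, hzU⟩ := hπ.exists_isSheet hz
    refine ContMDiffAt.congr_of_eventuallyEq ?_ (eventuallyEq_comp_symm hπ hU f hzU)
    refine ContMDiffAt.comp (I' := 𝓘(ℝ, ℂ)) (π z) ?_ (contMDiffAt_sheetHomeo_symm hπ hU ⟨z, hzU, rfl⟩).real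
    rw [sheetHomeo_symm_apply hπ hU hzU]
    exact h.contMDiffAt

theorem mdifferentiableAt_iff_comp [IsManifold 𝓘(ℂ, ℂ) ω M] (hπ : IsDiscCovering π) {f : M → ℂ}
    {z : ℂ} (hz : z ∈ disc) :
    MDifferentiableAt 𝓘(ℝ, ℂ) 𝓘(ℝ, ℂ) f (π z) ↔ DifferentiableAt ℝ (f ∘ π) z := by
  constructor
  · intro h
    exact (h.comp z (hπ.mdifferentiableAt hz).real).differentiableAt
  · intro h
    obtain ⟨U, hU, hzU⟩ := hπ.exists_isSheet hz
    refine MDifferentiableAt.congr_of_eventuallyEq ?_ (eventuallyEq_comp_symm hπ hU f hzU)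
    refine MDifferentiableAt.comp (I' := 𝓘(ℝ, ℂ)) (π z) ?_
      ((contMDiffAt_sheetHomeo_symm hπ hU ⟨z, hzU, rfl⟩ (n := 1)).real.mdifferentiableAt one_ne_zero)
    rw [sheetHomeo_symm_apply hπ hU hzU]
    exact h.mdifferentiableAt

/-- The chain rule; both sides vanish where `f` is not differentiable. -/
theorem diff_push [IsManifold 𝓘(ℂ, ℂ) ω M] (hπ : IsDiscCovering π) (f : M → ℂ)
    {z : ℂ} (hz : z ∈ disc) (c : ℂ) :
    diff f (π z) (push π z c) = fderiv ℝ (f ∘ π) z c := by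
  by_cases h : MDifferentiableAt 𝓘(ℝ, ℂ) 𝓘(ℝ, ℂ) f (π z)
  · have := mfderiv_comp z h (hπ.mdifferentiableAt hz).real
    rw [mfderiv_eq_fderiv] at this
    rw [this]; rfl
  · have h2 : ¬ DifferentiableAt ℝ (f ∘ π) z := by rwa [← mdifferentiableAt_iff_comp hπ hz]
    unfold diff
    rw [mfderiv_zero_of_not_mdifferentiableAt h, fderiv_zero_of_not_differentiableAt h2]
    rfl

include hπ in
/-- Radó's theorem, for surfaces covered by the disc. -/
theorem secondCountable_of_covering : SecondCountableTopology M := by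
  have hs : Function.Surjective (disc.domRestrict π) := fun x => by
    obtain ⟨z, hz, rfl⟩ := hπ.surjective (mem_univ x)
    exact ⟨⟨z, hz⟩, rfl⟩
  exact (hπ.covering.isQuotientMap hs).secondCountableTopology hπ.covering.isOpenMap

end Local

/-! ### The hyperbolic metric -/

section Metric

open Filter Topology Metric

variable {M : Type*} [TopologicalSpace M] [ChartedSpace ℂ M] [IsManifold 𝓘(ℂ, ℂ) ω M] {π : ℂ → M}

theorem differentiableAt_symm_comp (hπ : IsDiscCovering π) {U : Set ℂ} (hU : IsSheet π U) {z : ℂ}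
    (hz : z ∈ disc) (hzU : π z ∈ π '' U) :
    DifferentiableAt ℂ ((sheetHomeo hπ hU).symm ∘ π) z :=
  (((contMDiffAt_sheetHomeo_symm hπ hU hzU (n := 1)).mdifferentiableAt one_ne_zero).comp z
    (hπ.mdifferentiableAt hz)).differentiableAt

/-- Deck transformations: the lift of `π` through itself carrying `z` to `w`. -/
theorem exists_deck (hπ : IsDiscCovering π) {z w : ℂ} (hz : z ∈ disc) (hw : w ∈ disc)
    (h : π z = π w) : ∃ σ : ℂ → ℂ, DifferentiableOn ℂ σ disc ∧ MapsTo σ disc disc ∧ σ z = w ∧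
      ∀ ζ ∈ disc, π (σ ζ) = π ζ := by
  have : ContractibleSpace disc := (convex_ball (0 : ℂ) 1).contractibleSpace ⟨z, hz⟩
  have : LocallyPathConnectedSpace disc := isOpen_ball.locallyPathConnectedSpace
  obtain ⟨F, ⟨hF1, hF2⟩, -⟩ := hπ.covering.existsUnique_continuousMap_lifts
    ⟨disc.domRestrict π, hπ.covering.continuous⟩ ⟨z, hz⟩ ⟨w, hw⟩ h.symm
  classical
  let σ : ℂ → ℂ := fun ζ => if h : ζ ∈ disc then F ⟨ζ, h⟩ else 0
  have hσ : ∀ ζ (hζ : ζ ∈ disc), σ ζ = F ⟨ζ, hζ⟩ := fun ζ hζ => dif_pos hζ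
  have hmap : MapsTo σ disc disc := fun ζ hζ => by rw [hσ ζ hζ]; exact (F ⟨ζ, hζ⟩).2
  have hlift : ∀ ζ ∈ disc, π (σ ζ) = π ζ := fun ζ hζ => by
    rw [hσ ζ hζ]; exact congrFun hF2 ⟨ζ, hζ⟩
  have hcont : ContinuousOn σ disc := by
    rw [continuousOn_iff_continuous_domRestrict]
    have : disc.domRestrict σ = Subtype.val ∘ F := by
      ext ζ; exact hσ ζ ζ.2
    rw [this]; exact continuous_subtype_val.comp F.continuous
  refine ⟨σ, fun ζ hζ => ?_, hmap, by rw [hσ z hz, hF1], hlift⟩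
  obtain ⟨V, hV, hζV⟩ := hπ.exists_isSheet (hmap hζ)
  apply DifferentiableAt.differentiableWithinAt
  have h1 := differentiableAt_symm_comp hπ hV hζ (hlift ζ hζ ▸ mem_image_of_mem π hζV)
  refine h1.congr_of_eventuallyEq ?_
  filter_upwards [isOpen_ball.mem_nhds hζ, (hcont.continuousAt (isOpen_ball.mem_nhds hζ)).eventually
    (hV.isOpen.mem_nhds hζV)] with ζ' h2 h3
  rw [Function.comp_apply, ← hlift ζ' h2, sheetHomeo_symm_apply hπ hV h3]

theorem coord_push_transition (hπ : IsDiscCovering π) {z : ℂ} (hz : z ∈ disc) {σ : ℂ → ℂ}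
    (hσ : DifferentiableAt ℂ σ z) (hw : σ z ∈ disc) (h : ∀ᶠ ζ in 𝓝 z, π (σ ζ) = π ζ) :
    coord (push π z 1) = coord (push π (σ z) 1) * deriv σ z := by
  rw [coord_push hπ hz, coord_push hπ hw, one_mul, one_mul, h.self_of_nhds]
  have h1 : DifferentiableAt ℂ (chartAt ℂ (π z) ∘ π) (σ z) :=
    differentiableAt_chart_comp hπ _ hw (by rw [h.self_of_nhds]; exact mem_chart_source _ _)
  rw [← deriv_comp z h1 hσ]
  apply Filter.EventuallyEq.deriv_eq
  filter_upwards [h] with ζ hζ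
  simp [hζ]

theorem one_sub_sq_pos {z : ℂ} (hz : z ∈ disc) : 0 < 1 - ‖z‖ ^ 2 := by
  have : ‖z‖ < 1 := by simpa using hz
  nlinarith [norm_nonneg z]

theorem discScale_pos {z : ℂ} (hz : z ∈ disc) : 0 < discScale z :=
  div_pos two_pos (one_sub_sq_pos hz)

/-- The Schwarz–Pick lemma for the deck transformation carrying `z` to `w`.  Exchanging `z` and `w`
gives equality. -/
theorem norm_push_mul_le (hπ : IsDiscCovering π) {z w : ℂ} (hz : z ∈ disc) (hw : w ∈ disc)
    (h : π z = π w) : ‖coord (push π z 1)‖ * (1 - ‖z‖ ^ 2) ≤ ‖coord (push π w 1)‖ * (1 - ‖w‖ ^ 2) := by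
  obtain ⟨σ, hσ, hm, rfl, hl⟩ := exists_deck hπ hz hw h
  rw [coord_push_transition hπ hz (hσ.differentiableAt (isOpen_ball.mem_nhds hz)) hw
    (by filter_upwards [isOpen_ball.mem_nhds hz] with ζ hζ using hl ζ hζ), norm_mul, mul_assoc]
  exact mul_le_mul_of_nonneg_left (schwarz_pick hσ hm hz) (norm_nonneg _)

/-- The covering is a local isometry. -/
theorem hypScale_eq (hπ : IsDiscCovering π) {z : ℂ} (hz : z ∈ disc) :
    hypScale π (π z) = discScale z / ‖coord (push π z 1)‖ := by
  have hp : ∀ w ∈ disc, 0 < ‖coord (push π w 1)‖ := fun w hw =>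
    norm_pos_iff.2 (coord_push_one_ne_zero hπ hw)
  have : {r : ℝ | ∃ w ∈ Metric.ball (0 : ℂ) 1, π w = π z ∧ r * ‖coord (push π w 1)‖ = discScale w}
      = {discScale z / ‖coord (push π z 1)‖} := by
    ext r
    simp only [mem_ofPred_eq, mem_singleton_iff]
    constructor
    · rintro ⟨w, hw, hwz, hr⟩
      have h1 := le_antisymm (norm_push_mul_le hπ hz hw hwz.symm) (norm_push_mul_le hπ hw hz hwz)
      rw [eq_div_iff (hp z hz).ne']
      have h2 : r = discScale w / ‖coord (push π w 1)‖ := by rw [← hr, mul_div_cancel_right₀ _ (hp w hw).ne']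
      rw [h2, discScale, discScale]
      have := hp w hw
      have := one_sub_sq_pos hw
      have := one_sub_sq_pos hz
      rw [div_div, div_mul_eq_mul_div, div_eq_div_iff (by positivity) (by positivity)]
      linear_combination 2 * h1
    · rintro rfl
      exact ⟨z, hz, rfl, div_mul_cancel₀ _ (hp z hz).ne'⟩
  rw [hypScale, this, csInf_singleton]

theorem hypLength_push (hπ : IsDiscCovering π) {z : ℂ} (hz : z ∈ disc) (c : ℂ) :
    hypLength π (π z) (push π z c) = discScale z * ‖c‖ := by
  rw [hypLength, hypScale_eq hπ hz, coord_push_eq hπ hz c, norm_mul]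
  have := norm_pos_iff.2 (coord_push_one_ne_zero hπ hz)
  field_simp

/-- Transition maps between sheets are isometries. -/
theorem norm_deriv_transition (hπ : IsDiscCovering π) {z : ℂ} (hz : z ∈ disc) {σ : ℂ → ℂ}
    (hσ : DifferentiableAt ℂ σ z) (hw : σ z ∈ disc) (h : ∀ᶠ ζ in 𝓝 z, π (σ ζ) = π ζ) :
    discScale (σ z) * ‖deriv σ z‖ = discScale z := by
  have h1 := coord_push_transition hπ hz hσ hw h
  have h2 := hypScale_eq hπ hz
  have h3 := (congrArg (hypScale π) h.self_of_nhds).symm.trans (hypScale_eq hπ hw)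
  rw [h2, h1, norm_mul] at h3
  have := norm_pos_iff.2 (coord_push_one_ne_zero hπ hw)
  have h4 : coord (push π (σ z) 1) * deriv σ z ≠ 0 := h1 ▸ coord_push_one_ne_zero hπ hz
  have h5 := norm_pos_iff.2 (right_ne_zero_of_mul h4)
  rw [div_eq_div_iff (by positivity) (by positivity)] at h3
  exact mul_right_cancel₀ this.ne' (by linarith)

end Metric

/-! ### The hyperbolic area measure -/

section Area

open Filter Topology Metric

variable {M : Type*} [TopologicalSpace M] [ChartedSpace ℂ M] {π : ℂ → M}

/-- A countable family of sheets covering the surface. -/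
theorem exists_sheet_seq (hπ : IsDiscCovering π) :
    ∃ U : ℕ → Set ℂ, (∀ n, IsSheet π (U n)) ∧ ⋃ n, π '' U n = univ := by
  have hsc := secondCountable_of_covering hπ
  choose! U hU hzU using fun z (hz : z ∈ disc) => hπ.exists_isSheet hz
  obtain ⟨T, hTd, hTc, hT⟩ :=
    TopologicalSpace.isOpen_biUnion_countable disc U fun z hz => (hU z hz).isOpen
  have h0 : (0 : ℂ) ∈ disc := by simp
  have hTne : T.Nonempty := by
    have : (0 : ℂ) ∈ ⋃ z ∈ T, U z := by rw [hT]; exact mem_biUnion h0 (hzU 0 h0)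
    obtain ⟨t, ht, -⟩ := mem_iUnion₂.1 this
    exact ⟨t, ht⟩
  obtain ⟨f, hf⟩ := hTc.exists_eq_range hTne
  refine ⟨fun n => U (f n), fun n => hU _ (hTd (hf ▸ mem_range_self n)), ?_⟩
  refine eq_univ_of_forall fun x => ?_
  obtain ⟨z, hz, rfl⟩ := hπ.surjective (mem_univ x)
  have : z ∈ ⋃ w ∈ T, U w := by rw [hT]; exact mem_biUnion hz (hzU z hz)
  obtain ⟨t, ht, hzt⟩ := mem_iUnion₂.1 this
  rw [hf] at ht
  obtain ⟨n, rfl⟩ := ht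
  exact mem_iUnion.2 ⟨n, z, hzt, rfl⟩

variable [MeasurableSpace M] [BorelSpace M]

theorem IsDiscCovering.measurableSet_inter_preimage (hπ : IsDiscCovering π) {U : Set ℂ}
    (hU : IsOpen U) (hUd : U ⊆ disc) {A : Set M} (hA : MeasurableSet A) :
    MeasurableSet (U ∩ π ⁻¹' A) := by
  have h1 : Measurable (U.domRestrict π) :=
    (continuousOn_iff_continuous_domRestrict.1 (hπ.continuousOn.mono hUd)).measurable
  have h2 := hU.measurableSet.subtype_image (h1 hA)
  convert h2 using 1
  ext z
  simp [domRestrict]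
  tauto

theorem IsDiscCovering.aemeasurable (hπ : IsDiscCovering π) {U : Set ℂ}
    (hU : IsOpen U) (hUd : U ⊆ disc) (μ : Measure ℂ) : AEMeasurable π (μ.restrict U) :=
  (hπ.continuousOn.mono hUd).aemeasurable hU.measurableSet

theorem measurable_discScale : Measurable discScale := by
  unfold discScale; fun_prop

theorem sheet_map_apply (hπ : IsDiscCovering π) {U : Set ℂ} (hU : IsSheet π U) {A : Set M}
    (hA : MeasurableSet A) :
    (discArea.restrict U).map π A = discArea (U ∩ π ⁻¹' A) := by
  rw [Measure.map_apply_of_aemeasurable (hπ.aemeasurable hU.isOpen hU.subset _) hA,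
    Measure.restrict_apply' hU.isOpen.measurableSet, inter_comm]

variable [IsManifold 𝓘(ℂ, ℂ) ω M]

/-- Isometries preserve area: the areas transported by two sheets agree on the overlap. -/
theorem discArea_sheet_eq (hπ : IsDiscCovering π) {U V : Set ℂ} (hU : IsSheet π U)
    (hV : IsSheet π V) {A : Set M} (hA : MeasurableSet A) (hAV : A ⊆ π '' V) (hAU : A ⊆ π '' U) :
    discArea (V ∩ π ⁻¹' A) = discArea (U ∩ π ⁻¹' A) := by
  set σ : ℂ → ℂ := (sheetHomeo hπ hV).symm ∘ π with hσ
  set S := U ∩ π ⁻¹' A with hS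
  have hSm : MeasurableSet S := hπ.measurableSet_inter_preimage hU.isOpen hU.subset hA
  have hSd : S ⊆ disc := inter_subset_left.trans hU.subset
  have hσd : ∀ z ∈ S, DifferentiableAt ℂ σ z := fun z hz =>
    differentiableAt_symm_comp hπ hV (hSd hz) (hAV hz.2)
  have hσV : ∀ z ∈ S, σ z ∈ V := fun z hz => (sheetHomeo hπ hV).map_target (hAV hz.2)
  have hσπ : ∀ z, π z ∈ π '' V → π (σ z) = π z := fun z hz => (sheetHomeo hπ hV).right_inv hz
  have hinj : InjOn σ S := by
    intro z hz w hw h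
    have := congrArg π h
    rw [hσπ z (hAV hz.2), hσπ w (hAV hw.2)] at this
    exact hU.injOn hz.1 hw.1 this
  have him : σ '' S = V ∩ π ⁻¹' A := by
    ext w; constructor
    · rintro ⟨z, hz, rfl⟩
      refine ⟨hσV z hz, ?_⟩
      rw [mem_preimage, hσπ z (hAV hz.2)]; exact hz.2
    · rintro ⟨hwV, hwA⟩
      obtain ⟨z, hz, hzw⟩ := hAU hwA
      refine ⟨z, ⟨hz, ?_⟩, ?_⟩
      · rw [mem_preimage, hzw]; exact hwA
      · rw [hσ, Function.comp_apply, hzw, sheetHomeo_symm_apply hπ hV hwV]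
  have hVm : MeasurableSet (V ∩ π ⁻¹' A) := hπ.measurableSet_inter_preimage hV.isOpen hV.subset hA
  rw [discArea, withDensity_apply _ hVm, withDensity_apply _ hSm, ← him,
    lintegral_image_eq_lintegral_abs_det_fderiv_mul volume hSm
      (f' := fun z => (ContinuousLinearMap.restrictScalars ℝ (fderiv ℂ σ z)))
      (fun z hz => ((hσd z hz).hasFDerivAt.restrictScalars ℝ).hasFDerivWithinAt) hinj]
  refine setLIntegral_congr_fun hSm fun z hz => ?_
  have hev : ∀ᶠ ζ in 𝓝 z, π (σ ζ) = π ζ := by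
    filter_upwards [(hπ.continuousAt (hSd hz)).preimage_mem_nhds
      ((hπ.isOpen_image hV.isOpen hV.subset).mem_nhds (hAV hz.2))] with ζ hζ using hσπ ζ hζ
  have h1 := norm_deriv_transition hπ (hSd hz) (hσd z hz) (hV.subset (hσV z hz)) hev
  have hdet : (ContinuousLinearMap.restrictScalars ℝ (fderiv ℂ σ z)).det = ‖deriv σ z‖ ^ 2 := by
    simp [ContinuousLinearMap.det, LinearMap.det_restrictScalars, Algebra.norm_complex_eq,
      Complex.normSq_eq_norm_sq]
  rw [hdet, ← ENNReal.ofReal_mul (abs_nonneg _), abs_of_nonneg (by positivity), ← h1, mul_pow,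
    mul_comm]

/-- On the image of a sheet the area measure is the transported area of the disc. -/
theorem hypArea_apply_sheet (hπ : IsDiscCovering π) {U : Set ℂ} (hU : IsSheet π U) {A : Set M}
    (hA : MeasurableSet A) (hAU : A ⊆ π '' U) : hypArea π A = discArea (U ∩ π ⁻¹' A) := by
  have hUm : MeasurableSet (π '' U) := (hπ.isOpen_image hU.isOpen hU.subset).measurableSet
  apply le_antisymm
  · -- a measure above all the transported areas, with the right value on `A`
    set ν : Measure M := (discArea.restrict U).map π + (hypArea π).restrict (π '' U)ᶜ
    have hle : hypArea π ≤ ν := by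
      refine iSup_le fun V => iSup_le fun hV => iSup_le fun hVd => iSup_le fun hVi => ?_
      have hVs : IsSheet π V := ⟨hV, hVd, hVi⟩
      refine Measure.le_iff.2 fun B hB => ?_
      have h1 : (discArea.restrict V).map π (B \ π '' U) ≤ hypArea π (B \ π '' U) := by
        have : (discArea.restrict V).map π ≤ hypArea π :=
          le_iSup_of_le V (le_iSup_of_le hV (le_iSup_of_le hVd (le_iSup_of_le hVi le_rfl)))
        exact this _
      rw [← measure_inter_add_sdiff B hUm, Measure.add_apply]
      refine add_le_add ?_ ?_
      · have hBm := hB.inter hUm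
        have hVm : MeasurableSet (π '' V) := (hπ.isOpen_image hV hVd).measurableSet
        rw [sheet_map_apply hπ hVs hBm]
        have e1 : V ∩ π ⁻¹' (B ∩ π '' U) = V ∩ π ⁻¹' (B ∩ π '' U ∩ π '' V) := by
          ext z; constructor
          · rintro ⟨h1, h2⟩; exact ⟨h1, h2, mem_image_of_mem π h1⟩
          · rintro ⟨h1, h2, -⟩; exact ⟨h1, h2⟩
        rw [e1, discArea_sheet_eq hπ hU hVs (hBm.inter hVm) inter_subset_right
          (inter_subset_left.trans inter_subset_right), sheet_map_apply hπ hU hB]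
        exact measure_mono fun z hz => ⟨hz.1, hz.2.1.1⟩
      · rw [Measure.restrict_apply hB, ← sdiff_eq]; exact h1
    refine (hle A).trans ?_
    have : A ∩ (π '' U)ᶜ = ∅ := by rw [← sdiff_eq]; exact sdiff_eq_empty.2 hAU
    rw [Measure.add_apply, sheet_map_apply hπ hU hA, Measure.restrict_apply hA, this,
      measure_empty, add_zero]
  · rw [← sheet_map_apply hπ hU hA]
    have : (discArea.restrict U).map π ≤ hypArea π :=
      le_iSup_of_le U (le_iSup_of_le hU.isOpen (le_iSup_of_le hU.subset
        (le_iSup_of_le hU.injOn le_rfl)))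
    exact this _

theorem hypArea_restrict_sheet (hπ : IsDiscCovering π) {U : Set ℂ} (hU : IsSheet π U) :
    (hypArea π).restrict (π '' U) = (discArea.restrict U).map π := by
  have hUm : MeasurableSet (π '' U) := (hπ.isOpen_image hU.isOpen hU.subset).measurableSet
  ext A hA
  rw [Measure.restrict_apply hA, hypArea_apply_sheet hπ hU (hA.inter hUm) inter_subset_right,
    sheet_map_apply hπ hU hA]
  congr 1
  ext z; constructor
  · rintro ⟨h1, h2, -⟩; exact ⟨h1, h2⟩
  · rintro ⟨h1, h2⟩; exact ⟨h1, h2, mem_image_of_mem π h1⟩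

/-- A Borel section of the covering; its range is a fundamental domain of the deck transformations, and
it carries the area of the surface to the area of the disc. -/
structure IsSection (π : ℂ → M) (s : M → ℂ) : Prop where
  embedding : MeasurableEmbedding s
  mem_disc : ∀ x, s x ∈ disc
  right_inv : ∀ x, π (s x) = x
  map_eq : (hypArea π).map s = discArea.restrict (range s)

/-- Sections over the images of countably many sheets are put together along a disjoint refinement. -/
theorem exists_isSection (hπ : IsDiscCovering π) : ∃ s : M → ℂ, IsSection π s := by
  obtain ⟨U, hU, hcov⟩ := exists_sheet_seq hπ
  have hop : ∀ n, MeasurableSet (π '' U n) := fun n =>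
    (hπ.isOpen_image (hU n).isOpen (hU n).subset).measurableSet
  let A : ℕ → Set M := disjointed fun n => π '' U n
  have hAm : ∀ n, MeasurableSet (A n) := fun n => MeasurableSet.disjointed hop n
  have hAU : ∀ n, A n ⊆ π '' U n := fun n => disjointed_subset _ n
  have hAd : Pairwise (Function.onFun Disjoint A) := disjoint_disjointed _
  have hAc : ∀ x, ∃ n, x ∈ A n := fun x => by
    have : x ∈ ⋃ n, A n := by rw [iUnion_disjointed, hcov]; trivial
    exact mem_iUnion.1 this
  choose N hN using hAc
  have hNe : ∀ n x, x ∈ A n → N x = n := fun n x hx => by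
    by_contra h
    exact (hAd h).le_bot ⟨hN x, hx⟩
  let s : M → ℂ := fun x => (sheetHomeo hπ (hU (N x))).symm x
  have hsU : ∀ x, s x ∈ U (N x) := fun x => (sheetHomeo hπ (hU (N x))).map_target (hAU _ (hN x))
  have hsπ : ∀ x, π (s x) = x := fun x => (sheetHomeo hπ (hU (N x))).right_inv (hAU _ (hN x))
  have hsd : ∀ x, s x ∈ disc := fun x => (hU _).subset (hsU x)
  have hsz : ∀ n z, z ∈ U n → π z ∈ A n → s (π z) = z := fun n z hz hzA => by
    have : N (π z) = n := hNe n _ hzA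
    apply (hU n).injOn (this ▸ hsU (π z)) hz (hsπ _)
  have himage : ∀ B : Set M, s '' B = ⋃ n, (U n ∩ π ⁻¹' (A n ∩ B)) := by
    intro B; ext z; constructor
    · rintro ⟨x, hx, rfl⟩
      refine mem_iUnion.2 ⟨N x, hsU x, ?_⟩
      rw [mem_preimage, hsπ]; exact ⟨hN x, hx⟩
    · intro hz
      obtain ⟨n, hz, hzA, hzB⟩ := mem_iUnion.1 hz
      exact ⟨π z, hzB, hsz n z hz hzA⟩
  have hpre : ∀ O : Set ℂ, s ⁻¹' O = ⋃ n, (A n ∩ π '' (U n ∩ O)) := by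
    intro O; ext x; constructor
    · intro hx
      exact mem_iUnion.2 ⟨N x, hN x, s x, ⟨hsU x, hx⟩, hsπ x⟩
    · intro hx
      obtain ⟨n, hxA, z, ⟨hz, hzO⟩, rfl⟩ := mem_iUnion.1 hx
      rw [mem_preimage, hsz n z hz hxA]; exact hzO
  have hsm : Measurable s := by
    refine measurable_of_isOpen fun O hO => ?_
    rw [hpre]
    exact MeasurableSet.iUnion fun n => (hAm n).inter
      (hπ.isOpen_image ((hU n).isOpen.inter hO) (inter_subset_left.trans (hU n).subset)).measurableSet
  have hemb : MeasurableEmbedding s := by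
    refine ⟨fun x y h => by rw [← hsπ x, ← hsπ y, h], hsm, fun B hB => ?_⟩
    rw [himage]
    exact MeasurableSet.iUnion fun n =>
      hπ.measurableSet_inter_preimage (hU n).isOpen (hU n).subset ((hAm n).inter hB)
  refine ⟨s, hemb, hsd, hsπ, ?_⟩
  ext O hO
  have hB := hsm hO
  have e1 : s ⁻¹' O = ⋃ n, (A n ∩ s ⁻¹' O) := by
    rw [← iUnion_inter, iUnion_eq_univ_iff.2 fun x => ⟨N x, hN x⟩, univ_inter]
  have e2 : O ∩ range s = ⋃ n, (U n ∩ π ⁻¹' (A n ∩ s ⁻¹' O)) := by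
    rw [← himage, image_preimage_eq_inter_range]
  rw [Measure.map_apply hsm hO, Measure.restrict_apply hO, e1, e2, measure_iUnion, measure_iUnion]
  · congr 1
    ext n
    exact hypArea_apply_sheet hπ (hU n) ((hAm n).inter hB) (inter_subset_left.trans (hAU n))
  · intro m n hmn
    refine Set.disjoint_left.2 fun z hz hz' => ?_
    exact (hAd hmn).le_bot ⟨hz.2.1, hz'.2.1⟩
  · exact fun n => hπ.measurableSet_inter_preimage (hU n).isOpen (hU n).subset ((hAm n).inter hB)
  · intro m n hmn
    exact (hAd hmn).mono inter_subset_left inter_subset_left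
  · exact fun n => (hAm n).inter hB

end Area

/-! ### Integration over a fundamental domain -/

section Transport

open Filter Topology Metric

variable {M : Type*} {π : ℂ → M} [MeasurableSpace M] {s : M → ℂ}

theorem IsSection.range_subset (hs : IsSection π s) : range s ⊆ disc := by
  rintro _ ⟨x, rfl⟩; exact hs.mem_disc x

theorem IsSection.measurableSet_range (hs : IsSection π s) : MeasurableSet (range s) :=
  hs.embedding.measurableSet_range

theorem discArea_restrict {S : Set ℂ} (hS : MeasurableSet S) : discArea.restrict S =
    (volume.restrict S).withDensity fun z => ENNReal.ofReal (discScale z ^ 2) :=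
  restrict_withDensity hS _

theorem measurable_ofReal_discScale_sq :
    Measurable fun z => ENNReal.ofReal (discScale z ^ 2) :=
  (measurable_discScale.pow_const 2).ennreal_ofReal

theorem lintegral_discArea {S : Set ℂ} (hS : MeasurableSet S) (f : ℂ → ℝ≥0∞) :
    ∫⁻ z in S, f z ∂discArea = ∫⁻ z in S, ENNReal.ofReal (discScale z ^ 2) * f z := by
  rw [discArea_restrict hS, lintegral_withDensity_eq_lintegral_mul_non_measurable _
    measurable_ofReal_discScale_sq (ae_of_all _ fun _ => ENNReal.ofReal_lt_top)]
  rfl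

theorem integral_discArea {E : Type*} [NormedAddCommGroup E] [NormedSpace ℝ E] {S : Set ℂ}
    (hS : MeasurableSet S) (f : ℂ → E) :
    ∫ z in S, f z ∂discArea = ∫ z in S, discScale z ^ 2 • f z := by
  rw [discArea_restrict hS, integral_withDensity_eq_integral_toReal_smul
    measurable_ofReal_discScale_sq (ae_of_all _ fun _ => ENNReal.ofReal_lt_top)]
  simp_rw [ENNReal.toReal_ofReal (sq_nonneg _)]

theorem lintegral_hypArea (hs : IsSection π s) (Q : M → ℝ≥0∞) :
    ∫⁻ x, Q x ∂hypArea π = ∫⁻ z in range s, ENNReal.ofReal (discScale z ^ 2) * Q (π z) := by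
  rw [← lintegral_discArea hs.measurableSet_range fun z => Q (π z), ← hs.map_eq,
    hs.embedding.lintegral_map]
  simp_rw [hs.right_inv]

theorem integral_hypArea {E : Type*} [NormedAddCommGroup E] [NormedSpace ℝ E]
    (hs : IsSection π s) (Q : M → E) :
    ∫ x, Q x ∂hypArea π = ∫ z in range s, discScale z ^ 2 • Q (π z) := by
  rw [← integral_discArea hs.measurableSet_range fun z => Q (π z), ← hs.map_eq,
    hs.embedding.integral_map]
  simp_rw [hs.right_inv]

theorem ae_hypArea_iff (hs : IsSection π s) {P : M → Prop} :
    (∀ᵐ x ∂hypArea π, P x) ↔ ∀ᵐ z ∂volume.restrict (range s), P (π z) := by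
  have h1 : (∀ᵐ x ∂hypArea π, P x) ↔ ∀ᵐ z ∂(hypArea π).map s, P (π z) := by
    rw [hs.embedding.ae_map_iff]
    simp_rw [hs.right_inv]
  rw [h1, hs.map_eq, discArea_restrict hs.measurableSet_range,
    ae_withDensity_iff measurable_ofReal_discScale_sq]
  refine eventually_congr ?_
  filter_upwards [ae_restrict_mem hs.measurableSet_range] with z hz
  have : ENNReal.ofReal (discScale z ^ 2) ≠ 0 := by
    rw [Ne, ENNReal.ofReal_eq_zero, not_le]
    exact pow_pos (discScale_pos (hs.range_subset hz)) 2
  simp [this]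

variable [TopologicalSpace M] [ChartedSpace ℂ M] [BorelSpace M]

theorem sheet_measurableEmbedding (hπ : IsDiscCovering π) {U : Set ℂ} (hU : IsSheet π U) :
    MeasurableEmbedding (U.domRestrict π) := by
  have hm : IsOpenMap (U.domRestrict π) := by
    intro O hO
    have : U.domRestrict π '' O = π '' (Subtype.val '' O) := by
      rw [← image_comp]; rfl
    rw [this]
    refine hπ.isOpen_image (hU.isOpen.isOpenMap_subtype_val _ hO) ?_
    rintro _ ⟨z, -, rfl⟩
    exact hU.subset z.2
  exact (Topology.IsOpenEmbedding.of_continuous_injective_isOpenMap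
    (continuousOn_iff_continuous_domRestrict.1 (hπ.continuousOn.mono hU.subset))
    (injOn_iff_injective.1 hU.injOn) hm).measurableEmbedding

theorem sheet_map_eq (hπ : IsDiscCovering π) {U : Set ℂ} (hU : IsSheet π U) :
    (discArea.restrict U).map π = (discArea.comap Subtype.val).map (U.domRestrict π) := by
  have h1 : (discArea.comap Subtype.val).map (Subtype.val : U → ℂ) = discArea.restrict U :=
    map_comap_subtype_coe hU.isOpen.measurableSet _
  have h2 := hπ.aemeasurable hU.isOpen hU.subset discArea
  rw [← h1] at h2 ⊢
  rw [AEMeasurable.map_map_of_aemeasurable h2 measurable_subtype_coe.aemeasurable]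
  rfl

variable [IsManifold 𝓘(ℂ, ℂ) ω M]

/-- Integrals of functions supported in the image of a sheet may be computed on the sheet. -/
theorem lintegral_range_eq_sheet (hπ : IsDiscCovering π) (hs : IsSection π s) {U : Set ℂ}
    (hU : IsSheet π U) (Q : M → ℝ≥0∞) (hQ : ∀ x, x ∉ π '' U → Q x = 0) :
    ∫⁻ z in range s, ENNReal.ofReal (discScale z ^ 2) * Q (π z) =
      ∫⁻ z in U, ENNReal.ofReal (discScale z ^ 2) * Q (π z) := by
  have hUm : MeasurableSet (π '' U) := (hπ.isOpen_image hU.isOpen hU.subset).measurableSet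
  rw [← lintegral_hypArea hs Q, ← setLIntegral_eq_of_support_subset (s := π '' U),
    hypArea_restrict_sheet hπ hU, sheet_map_eq hπ hU,
    (sheet_measurableEmbedding hπ hU).lintegral_map,
    ← lintegral_discArea hU.isOpen.measurableSet fun z => Q (π z),
    ← map_comap_subtype_coe hU.isOpen.measurableSet, (MeasurableEmbedding.subtype_coe
      hU.isOpen.measurableSet).lintegral_map]
  · rfl
  · intro x hx
    by_contra h
    exact hx (hQ x h)

theorem integral_range_eq_sheet (hπ : IsDiscCovering π) (hs : IsSection π s) {U : Set ℂ}
    (hU : IsSheet π U) (Q : M → ℂ) (hQ : ∀ x, x ∉ π '' U → Q x = 0) :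
    ∫ z in range s, discScale z ^ 2 • Q (π z) = ∫ z in U, discScale z ^ 2 • Q (π z) := by
  rw [← integral_hypArea hs Q, ← setIntegral_eq_integral_of_forall_compl_eq_zero hQ,
    hypArea_restrict_sheet hπ hU, sheet_map_eq hπ hU,
    (sheet_measurableEmbedding hπ hU).integral_map,
    ← integral_discArea hU.isOpen.measurableSet fun z => Q (π z),
    ← map_comap_subtype_coe hU.isOpen.measurableSet, (MeasurableEmbedding.subtype_coe
      hU.isOpen.measurableSet).integral_map]
  rfl

/-- The `L²` norm over the fundamental domain of a function whose modulus, divided by the density `ρ` of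
the metric, descends to the surface and is supported there in the image of a sheet. -/
theorem eLpNorm_range_eq_sheet (hπ : IsDiscCovering π) (hs : IsSection π s) {U : Set ℂ}
    (hU : IsSheet π U) {k : ℂ → ℂ} (q : M → ℝ) (hk : ∀ z ∈ disc, ‖k z‖ = discScale z * q (π z))
    (hq : ∀ x, x ∉ π '' U → q x = 0) :
    eLpNorm k 2 (volume.restrict (range s)) = eLpNorm k 2 (volume.restrict U) := by
  have key : ∀ S : Set ℂ, MeasurableSet S → S ⊆ disc → ∫⁻ z in S, ‖k z‖ₑ ^ (2 : ℝ) =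
      ∫⁻ z in S, ENNReal.ofReal (discScale z ^ 2) * ENNReal.ofReal (q (π z) ^ 2) := by
    intro S hS hSd
    refine setLIntegral_congr_fun hS fun z hz => ?_
    rw [← ofReal_norm, hk z (hSd hz), ENNReal.rpow_two,
      ← ENNReal.ofReal_pow (by rw [← hk z (hSd hz)]; positivity), mul_pow,
      ENNReal.ofReal_mul (sq_nonneg _)]
  rw [eLpNorm_eq_lintegral_rpow_enorm_toReal two_ne_zero ENNReal.ofNat_ne_top,
    eLpNorm_eq_lintegral_rpow_enorm_toReal two_ne_zero ENNReal.ofNat_ne_top, ENNReal.toReal_ofNat,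
    key _ hs.measurableSet_range hs.range_subset, key _ hU.isOpen.measurableSet hU.subset,
    lintegral_range_eq_sheet hπ hs hU (fun x => ENNReal.ofReal (q x ^ 2))
      fun x hx => by simp [hq x hx]]

end Transport

/-! ### Wirtinger derivatives -/

section Wirtinger

open Filter Topology Metric

/-- The Wirtinger derivative `∂G/∂z`. -/
def dz (G : ℂ → ℂ) (z : ℂ) : ℂ := (fderiv ℝ G z 1 - Complex.I * fderiv ℝ G z Complex.I) / 2

/-- The Wirtinger derivative `∂G/∂z̄`. -/
def dzb (G : ℂ → ℂ) (z : ℂ) : ℂ := (fderiv ℝ G z 1 + Complex.I * fderiv ℝ G z Complex.I) / 2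

theorem fderiv_eq_dz_add_dzb (G : ℂ → ℂ) (z c : ℂ) :
    fderiv ℝ G z c = dz G z * c + dzb G z * (starRingEnd ℂ) c := by
  have h : c = c.re • (1 : ℂ) + c.im • Complex.I := by simp
  have h1 : fderiv ℝ G z c = c.re * fderiv ℝ G z 1 + c.im * fderiv ℝ G z Complex.I := by
    conv_lhs => rw [h]
    rw [map_add, map_smul, map_smul, Complex.real_smul, Complex.real_smul]
  have h2 : c = c.re + c.im * Complex.I := (Complex.re_add_im c).symm
  have h3 : (starRingEnd ℂ) c = c.re - c.im * Complex.I := by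
    apply Complex.ext <;> simp
  rw [h1, h3]
  conv_rhs => rw [h2]
  simp only [Complex.add_re, Complex.add_im, Complex.ofReal_re, Complex.ofReal_im, Complex.mul_re,
    Complex.mul_im, Complex.I_re, Complex.I_im, dz, dzb]
  ring_nf
  simp only [Complex.I_sq]
  ring

theorem dz_mul {G H : ℂ → ℂ} {z : ℂ} (hG : DifferentiableAt ℝ G z) (hH : DifferentiableAt ℝ H z) :
    dz (fun w => G w * H w) z = G z * dz H z + H z * dz G z := by
  simp only [dz, fderiv_fun_mul hG hH]
  simp; ring

theorem dz_conj (G : ℂ → ℂ) (z : ℂ) :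
    dz (fun w => (starRingEnd ℂ) (G w)) z = (starRingEnd ℂ) (dzb G z) := by
  have : fderiv ℝ (fun w => (starRingEnd ℂ) (G w)) z =
      (Complex.conjCLE : ℂ →L[ℝ] ℂ).comp (fderiv ℝ G z) :=
    Complex.conjCLE.comp_fderiv
  simp [dz, dzb, this, sub_eq_add_neg, map_ofNat (starRingEnd ℂ) 2]

theorem dzb_conj (G : ℂ → ℂ) (z : ℂ) :
    dzb (fun w => (starRingEnd ℂ) (G w)) z = (starRingEnd ℂ) (dz G z) := by
  have : fderiv ℝ (fun w => (starRingEnd ℂ) (G w)) z =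
      (Complex.conjCLE : ℂ →L[ℝ] ℂ).comp (fderiv ℝ G z) :=
    Complex.conjCLE.comp_fderiv
  simp [dz, dzb, this, sub_eq_add_neg, map_ofNat (starRingEnd ℂ) 2]

theorem dz_congr {G H : ℂ → ℂ} {z : ℂ} (h : G =ᶠ[𝓝 z] H) : dz G z = dz H z := by
  rw [dz, dz, h.fderiv_eq]

theorem dzb_congr {G H : ℂ → ℂ} {z : ℂ} (h : G =ᶠ[𝓝 z] H) : dzb G z = dzb H z := by
  rw [dzb, dzb, h.fderiv_eq]

theorem normSq_fderiv_add (G : ℂ → ℂ) (z c : ℂ) :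
    ‖fderiv ℝ G z c‖ ^ 2 + ‖fderiv ℝ G z (Complex.I * c)‖ ^ 2 =
      2 * (‖dz G z‖ ^ 2 + ‖dzb G z‖ ^ 2) * ‖c‖ ^ 2 := by
  rw [fderiv_eq_dz_add_dzb, fderiv_eq_dz_add_dzb]
  set a := dz G z
  set b := dzb G z
  simp only [Complex.sq_norm, Complex.normSq_apply, Complex.add_re, Complex.add_im, Complex.mul_re,
    Complex.mul_im, Complex.I_re, Complex.I_im, Complex.conj_re, Complex.conj_im]
  ring

variable {M : Type*} [TopologicalSpace M] [ChartedSpace ℂ M] [IsManifold 𝓘(ℂ, ℂ) ω M] {π : ℂ → M}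

theorem diff_vec (hπ : IsDiscCovering π) (f : M → ℂ) {z : ℂ} (hz : z ∈ disc) (c : ℂ) :
    diff f (π z) (vec (π z) c) = fderiv ℝ (f ∘ π) z (c / coord (push π z 1)) := by
  rw [← diff_push hπ f hz]
  congr 1
  have := coord_push_eq hπ hz (c / coord (push π z 1))
  rw [div_mul_cancel₀ _ (coord_push_one_ne_zero hπ hz)] at this
  exact this.symm

theorem del_vec (hπ : IsDiscCovering π) (f : M → ℂ) {z : ℂ} (hz : z ∈ disc) (c : ℂ) :
    del f (π z) (vec (π z) c) = dz (f ∘ π) z * (c / coord (push π z 1)) := by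
  have e : coord (vec (π z) c) = c := rfl
  rw [del, e, diff_vec hπ f hz, diff_vec hπ f hz, fderiv_eq_dz_add_dzb, fderiv_eq_dz_add_dzb,
    mul_div_assoc, map_mul, Complex.conj_I]
  ring_nf
  simp only [Complex.I_sq]
  ring

theorem delbar_vec (hπ : IsDiscCovering π) (f : M → ℂ) {z : ℂ} (hz : z ∈ disc) (c : ℂ) :
    delbar f (π z) (vec (π z) c) =
      dzb (f ∘ π) z * (starRingEnd ℂ) (c / coord (push π z 1)) := by
  have e : coord (vec (π z) c) = c := rfl
  rw [delbar, e, diff_vec hπ f hz, diff_vec hπ f hz, fderiv_eq_dz_add_dzb, fderiv_eq_dz_add_dzb,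
    mul_div_assoc, map_mul, Complex.conj_I]
  ring_nf
  simp only [Complex.I_sq]
  ring

theorem delLen_eq (hπ : IsDiscCovering π) (f : M → ℂ) {z : ℂ} (hz : z ∈ disc) :
    delLen π f (π z) = ‖dz (f ∘ π) z‖ / discScale z := by
  rw [delLen, del_vec hπ f hz, hypScale_eq hπ hz, norm_mul, norm_div, norm_one]
  have := norm_pos_iff.2 (coord_push_one_ne_zero hπ hz)
  field_simp

theorem gradSq_eq (hπ : IsDiscCovering π) (f : M → ℂ) {z : ℂ} (hz : z ∈ disc) :
    gradSq π f (π z) =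
      2 * (‖dz (f ∘ π) z‖ ^ 2 + ‖dzb (f ∘ π) z‖ ^ 2) / discScale z ^ 2 := by
  have h := normSq_fderiv_add (f ∘ π) z (1 / coord (push π z 1))
  rw [mul_one_div] at h
  rw [gradSq, diff_vec hπ f hz, diff_vec hπ f hz, h, hypScale_eq hπ hz, norm_div, norm_one]
  have := norm_pos_iff.2 (coord_push_one_ne_zero hπ hz)
  field_simp

end Wirtinger

/-! ### Stokes' theorem in the plane -/

section Planar

open Filter Topology Metric

theorem integrable_mul_of_continuousOn {f g : ℂ → ℂ} {O : Set ℂ} (hf : ContinuousOn f O)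
    (hg : Continuous g) (hgc : HasCompactSupport g) (hgO : tsupport g ⊆ O) :
    Integrable fun z => f z * g z := by
  have h1 : IntegrableOn (fun z => f z * g z) (tsupport g) :=
    ((hf.mono hgO).mul hg.continuousOn).integrableOn_compact hgc
  refine (integrableOn_iff_integrable_of_support_subset ?_).1 h1
  intro z hz
  exact subset_tsupport _ (right_ne_zero_of_mul hz)

/-- `∫ dG ∧ dH = 0` in the plane, where `H` needs to be smooth near the support of `G` only. -/
theorem integral_wirtinger_eq_zero {G H : ℂ → ℂ} {O : Set ℂ} (hO : IsOpen O) (hG : ContDiff ℝ ∞ G)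
    (hGc : HasCompactSupport G) (hGO : tsupport G ⊆ O) (hH : ContDiffOn ℝ ∞ H O) :
    ∫ z, (dz G z * dzb H z - dzb G z * dz H z) = 0 := by
  have hHat : ∀ z ∈ O, ContDiffAt ℝ ∞ H z := fun z hz => hH.contDiffAt (hO.mem_nhds hz)
  have hdH : ∀ z ∈ O, ContDiffAt ℝ ∞ (fderiv ℝ H) z := fun z hz =>
    (hHat z hz).fderiv_right (by simp)
  have hdHv : ∀ v : ℂ, ∀ z ∈ O, ContDiffAt ℝ ∞ (fun w => fderiv ℝ H w v) z := fun v z hz =>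
    (hdH z hz).clm_apply contDiffAt_const
  have hddH : ∀ v w : ℂ, ContinuousOn (fun z => fderiv ℝ (fun w => fderiv ℝ H w v) z w) O :=
    fun v w z hz => (((hdHv v z hz).fderiv_right (m := ∞) (by simp)).clm_apply
      contDiffAt_const).continuousAt.continuousWithinAt
  have hdHc : ∀ v, ContinuousOn (fun z => fderiv ℝ H z v) O := fun v z hz =>
    (hdHv v z hz).continuousAt.continuousWithinAt
  have hdGc : ∀ v, Continuous fun z => fderiv ℝ G z v := fun v =>
    (hG.continuous_fderiv (by simp)).clm_apply continuous_const
  have hdGs : ∀ v, tsupport (fun z => fderiv ℝ G z v) ⊆ O := fun v =>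
    (tsupport_fderiv_apply_subset ℝ v).trans hGO
  have hdGk : ∀ v, HasCompactSupport fun z => fderiv ℝ G z v := fun v => hGc.fderiv_apply ℝ v
  have hparts : ∀ v w : ℂ, ∫ z, fderiv ℝ H z v * fderiv ℝ G z w =
      -∫ z, fderiv ℝ (fun ζ => fderiv ℝ H ζ v) z w * G z := fun v w =>
    integral_mul_fderiv_eq_neg_fderiv_mul_of_integrable
      (integrable_mul_of_continuousOn (hddH v w) hG.continuous hGc hGO)
      (integrable_mul_of_continuousOn (hdHc v) (hdGc w) (hdGk w) (hdGs w))
      (integrable_mul_of_continuousOn (hdHc v) hG.continuous hGc hGO)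
      (fun z hz => (hdHv v z (hGO hz)).differentiableAt (by simp))
      (fun z _ => hG.differentiable (by simp) z)
  have hsymm : ∀ z ∈ O, fderiv ℝ (fun ζ => fderiv ℝ H ζ 1) z Complex.I =
      fderiv ℝ (fun ζ => fderiv ℝ H ζ Complex.I) z 1 := by
    intro z hz
    have h2 := (hHat z hz).isSymmSndFDerivAt (by
      rw [minSmoothness_of_isRCLikeNormedField]
      exact WithTop.coe_le_coe.2 (le_top (a := (2 : ℕ∞))))
    have hd := (hdH z hz).differentiableAt (by simp)
    rw [fderiv_clm_apply hd (differentiableAt_const _), fderiv_clm_apply hd (differentiableAt_const _)]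
    simpa using h2 Complex.I 1
  have e : ∀ z, dz G z * dzb H z - dzb G z * dz H z = Complex.I / 2 *
      (fderiv ℝ H z Complex.I * fderiv ℝ G z 1 - fderiv ℝ H z 1 * fderiv ℝ G z Complex.I) := by
    intro z; simp only [dz, dzb]; ring
  simp_rw [e]
  rw [integral_const_mul, integral_sub
    (integrable_mul_of_continuousOn (hdHc _) (hdGc _) (hdGk _) (hdGs _))
    (integrable_mul_of_continuousOn (hdHc _) (hdGc _) (hdGk _) (hdGs _)), hparts, hparts]
  have : ∫ z, fderiv ℝ (fun ζ => fderiv ℝ H ζ Complex.I) z 1 * G z =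
      ∫ z, fderiv ℝ (fun ζ => fderiv ℝ H ζ 1) z Complex.I * G z := by
    congr 1; ext z
    by_cases hz : z ∈ tsupport G
    · rw [hsymm z (hGO hz)]
    · rw [image_eq_zero_of_notMem_tsupport hz, mul_zero, mul_zero]
  rw [this]; simp

theorem continuous_dz {G : ℂ → ℂ} (hG : ContDiff ℝ ∞ G) : Continuous (dz G) := by
  have h : ∀ v, Continuous fun z => fderiv ℝ G z v := fun v =>
    (hG.continuous_fderiv (by simp)).clm_apply continuous_const
  exact ((h _).sub (continuous_const.mul (h _))).div_const _

theorem dz_eq_zero {G : ℂ → ℂ} {z : ℂ} (h : G =ᶠ[𝓝 z] 0) : dz G z = 0 := by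
  rw [dz_congr h]
  have : fderiv ℝ (0 : ℂ → ℂ) z = 0 := by simp
  simp [dz, this]

theorem dzb_eq_zero {G : ℂ → ℂ} {z : ℂ} (h : G =ᶠ[𝓝 z] 0) : dzb G z = 0 := by
  rw [dzb_congr h]
  have : fderiv ℝ (0 : ℂ → ℂ) z = 0 := by simp
  simp [dzb, this]

theorem hasCompactSupport_dz {G : ℂ → ℂ} (hG : HasCompactSupport G) : HasCompactSupport (dz G) :=
  hG.mono' fun z hz => by
    by_contra h
    exact hz (dz_eq_zero (notMem_tsupport_iff_eventuallyEq.1 h))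

theorem dz_add {G H : ℂ → ℂ} {z : ℂ} (hG : DifferentiableAt ℝ G z) (hH : DifferentiableAt ℝ H z) :
    dz (fun w => G w + H w) z = dz G z + dz H z := by
  simp only [dz, fderiv_fun_add hG hH]
  simp; ring

theorem dzb_add {G H : ℂ → ℂ} {z : ℂ} (hG : DifferentiableAt ℝ G z) (hH : DifferentiableAt ℝ H z) :
    dzb (fun w => G w + H w) z = dzb G z + dzb H z := by
  simp only [dzb, fderiv_fun_add hG hH]
  simp; ring

end Planar

/-! ### Test functions -/

section Test

open Filter Topology Metric

variable {M : Type*} [TopologicalSpace M] [ChartedSpace ℂ M] {π : ℂ → M}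

theorem IsTest.add {g h : M → ℂ} (hg : IsTest g) (hh : IsTest h) : IsTest (g + h) :=
  ⟨hg.1.add hh.1, hg.2.add hh.2⟩

theorem IsTest.zero : IsTest (0 : M → ℂ) := ⟨contMDiff_const, HasCompactSupport.zero⟩

theorem IsTest.conj {g : M → ℂ} (hg : IsTest g) : IsTest fun x => (starRingEnd ℂ) (g x) :=
  ⟨Complex.conjCLE.contDiff.contMDiff.comp hg.1, hg.2.comp_left (map_zero _)⟩

theorem IsTest.const_mul {g : M → ℂ} (hg : IsTest g) (c : ℂ) : IsTest fun x => c * g x :=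
  ⟨(contDiff_const.mul contDiff_id : ContDiff ℝ ∞ fun w : ℂ => c * w).contMDiff.comp hg.1,
    hg.2.comp_left (g := fun w => c * w) (mul_zero _)⟩

variable [IsManifold 𝓘(ℂ, ℂ) ω M]

theorem IsTest.contDiffOn (hπ : IsDiscCovering π) {g : M → ℂ} (hg : IsTest g) :
    ContDiffOn ℝ ∞ (g ∘ π) disc := fun z hz =>
  ((contMDiffAt_iff_comp hπ hz).1 (hg.1 (π z))).contDiffWithinAt

theorem IsTest.differentiableAt (hπ : IsDiscCovering π) {g : M → ℂ} (hg : IsTest g) {z : ℂ}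
    (hz : z ∈ disc) : DifferentiableAt ℝ (g ∘ π) z :=
  ((contMDiffAt_iff_comp hπ hz).1 (hg.1 (π z))).differentiableAt (by simp)

variable [T2Space M]

/-- Test functions are finite sums of test functions supported in the images of sheets, by a partition
of unity. -/
theorem IsTest.induction (hπ : IsDiscCovering π) {P : (M → ℂ) → Prop} (h0 : P 0)
    (hadd : ∀ g h, IsTest g → IsTest h → P g → P h → P (g + h))
    (hloc : ∀ g U, IsTest g → IsSheet π U → tsupport g ⊆ π '' U → P g) {g : M → ℂ}
    (hg : IsTest g) : P g := by
  have : SecondCountableTopology M := secondCountable_of_covering hπ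
  have : LocallyCompactSpace M := ChartedSpace.locallyCompactSpace ℂ M
  have : IsManifold 𝓘(ℝ, ℂ) ∞ M := isManifold_real
  let ι := {U : Set ℂ // IsSheet π U}
  obtain ⟨f, hf⟩ := SmoothPartitionOfUnity.exists_isSubordinate 𝓘(ℝ, ℂ) (isClosed_univ (X := M))
    (fun i : ι => π '' i.1) (fun i => hπ.isOpen_image i.2.isOpen i.2.subset) (by
      intro x _
      obtain ⟨z, hz, rfl⟩ := hπ.surjective (mem_univ x)
      obtain ⟨U, hU, hzU⟩ := hπ.exists_isSheet hz
      exact mem_iUnion.2 ⟨⟨U, hU⟩, z, hzU, rfl⟩)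
  have hfin := f.locallyFinite.finite_nonempty_inter_compact hg.2
  set T := hfin.toFinset
  have hT : ∀ i : ι, IsTest (fun x => (f i x : ℂ) * g x) := fun i =>
    ⟨((f i).contMDiff.smul hg.1).congr fun x => (Complex.real_smul).symm, hg.2.mul_left⟩
  have hsum : ∀ S : Finset ι, IsTest (∑ i ∈ S, fun x => (f i x : ℂ) * g x) ∧
      P (∑ i ∈ S, fun x => (f i x : ℂ) * g x) := by
    classical
    intro S
    induction S using Finset.induction_on with
    | empty => exact ⟨IsTest.zero, h0⟩
    | insert i S hi ih =>
      rw [Finset.sum_insert hi]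
      refine ⟨(hT i).add ih.1, hadd _ _ (hT i) ih.1 (hloc _ i.1 (hT i) i.2 ?_) ih.2⟩
      refine (closure_mono fun x hx => ?_).trans (hf i)
      have := left_ne_zero_of_mul hx
      simpa using this
  convert (hsum T).2 using 1
  ext x
  rw [Finset.sum_apply, ← Finset.sum_mul]
  by_cases hx : g x = 0
  · rw [hx, mul_zero]
  · have h1 : ∑ᶠ i, f i x = 1 := f.sum_eq_one (mem_univ x)
    rw [finsum_eq_sum_of_support_subset (s := T)] at h1
    · rw [← Complex.ofReal_sum, h1]; simp
    · intro i hi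
      rw [Finset.mem_coe, Set.Finite.mem_toFinset]
      exact ⟨x, hi, subset_tsupport _ hx⟩

omit [IsManifold 𝓘(ℂ, ℂ) ω M] [T2Space M] in
/-- The copy in a sheet of the support of a test function. -/
theorem exists_compact_of_tsupport_subset (hπ : IsDiscCovering π) {U : Set ℂ} (hU : IsSheet π U)
    {g : M → ℂ} (hg : HasCompactSupport g) (hgU : tsupport g ⊆ π '' U) :
    ∃ K ⊆ U, IsCompact K ∧ ∀ z ∈ U, π z ∈ tsupport g → z ∈ K := by
  refine ⟨(sheetHomeo hπ hU).symm '' tsupport g, ?_,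
    IsCompact.image_of_continuousOn hg ((sheetHomeo hπ hU).continuousOn_symm.mono hgU), ?_⟩
  · rintro _ ⟨x, hx, rfl⟩; exact (sheetHomeo hπ hU).map_target (hgU hx)
  · intro z hz hzg
    exact ⟨π z, hzg, sheetHomeo_symm_apply hπ hU hz⟩

theorem tsupport_indicator_subset {U K : Set ℂ} (hK : IsCompact K) {f : ℂ → ℂ}
    (hf0 : ∀ z ∈ U, z ∉ K → f z = 0) : tsupport (U.indicator f) ⊆ K :=
  closure_minimal (fun z hz => by
    by_contra h
    refine hz ?_
    by_cases hzU : z ∈ U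
    · rw [indicator_of_mem hzU, hf0 z hzU h]
    · exact indicator_of_notMem hzU f) hK.isClosed

theorem contDiff_indicator {U K : Set ℂ} (hU : IsOpen U) (hK : IsCompact K) (hKU : K ⊆ U)
    {f : ℂ → ℂ} (hf : ContDiffOn ℝ ∞ f U) (hf0 : ∀ z ∈ U, z ∉ K → f z = 0) :
    ContDiff ℝ ∞ (U.indicator f) := by
  rw [contDiff_iff_contDiffAt]
  intro z
  by_cases hz : z ∈ U
  · refine (hf.contDiffAt (hU.mem_nhds hz)).congr_of_eventuallyEq ?_
    filter_upwards [hU.mem_nhds hz] with w hw using indicator_of_mem hw f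
  · have h1 : z ∉ tsupport (U.indicator f) := fun h =>
      hz (hKU (tsupport_indicator_subset hK hf0 h))
    exact contDiffAt_const.congr_of_eventuallyEq (notMem_tsupport_iff_eventuallyEq.1 h1)

/-- Transplantation of a smooth function from a sheet to the surface. -/
theorem exists_isTest_of_sheet (hπ : IsDiscCovering π) {U : Set ℂ} (hU : IsSheet π U) {h : ℂ → ℂ}
    (hh : ContDiff ℝ ∞ h) (hc : HasCompactSupport h) (hhU : tsupport h ⊆ U) :
    ∃ g : M → ℂ, IsTest g ∧ tsupport g ⊆ π '' U ∧ ∀ z ∈ U, g (π z) = h z := by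
  classical
  let g : M → ℂ := (π '' U).indicator (h ∘ (sheetHomeo hπ hU).symm)
  have hgU : ∀ z ∈ U, g (π z) = h z := fun z hz => by
    rw [show g (π z) = _ from indicator_of_mem (mem_image_of_mem π hz) _, Function.comp_apply,
      sheetHomeo_symm_apply hπ hU hz]
  have hKc : IsCompact (π '' tsupport h) :=
    IsCompact.image_of_continuousOn hc (hπ.continuousOn.mono (hhU.trans hU.subset))
  have hsub : tsupport g ⊆ π '' tsupport h := by
    refine closure_minimal (fun x hx => ?_) hKc.isClosed
    have hxU : x ∈ π '' U := mem_of_indicator_ne_zero hx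
    obtain ⟨z, hz, rfl⟩ := hxU
    rw [Function.mem_support, hgU z hz] at hx
    exact mem_image_of_mem π (subset_tsupport _ hx)
  refine ⟨g, ⟨fun x => ?_, hKc.of_isClosed_subset isClosed_closure hsub⟩,
    hsub.trans (image_mono hhU), hgU⟩
  by_cases hx : x ∈ π '' U
  · obtain ⟨z, hz, rfl⟩ := hx
    rw [contMDiffAt_iff_comp hπ (hU.subset hz)]
    refine hh.contDiffAt.congr_of_eventuallyEq ?_
    filter_upwards [hU.isOpen.mem_nhds hz] with w hw using hgU w hw
  · have h1 : x ∉ tsupport g := fun h => hx (image_mono hhU (hsub h))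
    exact contMDiffAt_const.congr_of_eventuallyEq (notMem_tsupport_iff_eventuallyEq.1 h1)

end Test

/-! ### Stokes' theorem and the Poincaré inequality -/

section Poincare

open Filter Topology Metric

variable {M : Type*} [TopologicalSpace M] [ChartedSpace ℂ M] {π : ℂ → M}
  [MeasurableSpace M] [BorelSpace M] [IsManifold 𝓘(ℂ, ℂ) ω M] {s : M → ℂ}

theorem aestronglyMeasurable_of_continuousOn {S : Set ℂ} (hsd : S ⊆ disc)
    {k : ℂ → ℂ} (hk : ContinuousOn k disc) : AEStronglyMeasurable k (volume.restrict S) :=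
  (hk.aestronglyMeasurable isOpen_ball.measurableSet).mono_measure (Measure.restrict_mono hsd le_rfl)

theorem contDiffOn_discScale : ContDiffOn ℝ ∞ (fun z => (discScale z : ℂ)) disc := by
  have h : ContDiffOn ℝ ∞ discScale disc := by
    unfold discScale
    exact contDiffOn_const.div (contDiffOn_const.sub (contDiff_norm_sq ℝ).contDiffOn)
      fun z hz => (one_sub_sq_pos hz).ne'
  exact Complex.ofRealCLM.contDiff.comp_contDiffOn h

omit [MeasurableSpace M] [BorelSpace M] in
theorem IsTest.continuousOn_fderiv (hπ : IsDiscCovering π) {g : M → ℂ} (hg : IsTest g) (v : ℂ) :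
    ContinuousOn (fun z => fderiv ℝ (g ∘ π) z v) disc := fun _ hz =>
  (((((hg.contDiffOn hπ).contDiffAt (isOpen_ball.mem_nhds hz)).fderiv_right (m := ∞)
    (by simp)).clm_apply contDiffAt_const).continuousAt).continuousWithinAt

omit [MeasurableSpace M] [BorelSpace M] in
theorem IsTest.continuousOn_dz (hπ : IsDiscCovering π) {g : M → ℂ} (hg : IsTest g) :
    ContinuousOn (dz (g ∘ π)) disc :=
  ((hg.continuousOn_fderiv hπ 1).sub
    (continuousOn_const.mul (hg.continuousOn_fderiv hπ Complex.I))).div_const _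

omit [MeasurableSpace M] [BorelSpace M] [IsManifold 𝓘(ℂ, ℂ) ω M] in
theorem pullback_eventuallyEq_zero (hπ : IsDiscCovering π) {g : M → ℂ} {z : ℂ} (hz : z ∈ disc)
    (hg : π z ∉ tsupport g) : g ∘ π =ᶠ[𝓝 z] 0 := by
  filter_upwards [(hπ.continuousAt hz).preimage_mem_nhds
    ((isClosed_tsupport g).isOpen_compl.mem_nhds hg)] with w hw
  exact image_eq_zero_of_notMem_tsupport (f := g) hw

theorem eLpNorm_dz_eq_sheet (hπ : IsDiscCovering π) (hs : IsSection π s) {U : Set ℂ}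
    (hU : IsSheet π U) {g : M → ℂ} (hg : tsupport g ⊆ π '' U) :
    eLpNorm (dz (g ∘ π)) 2 (volume.restrict (range s)) =
      eLpNorm (dz (g ∘ π)) 2 (volume.restrict U) := by
  refine eLpNorm_range_eq_sheet hπ hs hU (delLen π g) (fun z hz => ?_) fun x hx => ?_
  · rw [delLen_eq hπ g hz, mul_div_cancel₀ _ (discScale_pos hz).ne']
  · obtain ⟨z, hz, rfl⟩ := hπ.surjective (mem_univ x)
    rw [delLen_eq hπ g hz, dz_eq_zero (pullback_eventuallyEq_zero hπ hz fun h => hx (hg h))]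
    simp

theorem eLpNorm_scale_eq_sheet (hπ : IsDiscCovering π) (hs : IsSection π s) {U : Set ℂ}
    (hU : IsSheet π U) {g : M → ℂ} (hg : tsupport g ⊆ π '' U) :
    eLpNorm (fun z => (discScale z : ℂ) * g (π z)) 2 (volume.restrict (range s)) =
      eLpNorm (fun z => (discScale z : ℂ) * g (π z)) 2 (volume.restrict U) := by
  refine eLpNorm_range_eq_sheet hπ hs hU (fun x => ‖g x‖) (fun z hz => ?_) fun x hx => ?_
  · rw [norm_mul, Complex.norm_of_nonneg (discScale_pos hz).le]
  · rw [image_eq_zero_of_notMem_tsupport fun h => hx (hg h), norm_zero]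

variable [T2Space M]

omit [MeasurableSpace M] [BorelSpace M] [T2Space M] in
theorem IsTest.contDiff_indicator_pullback (hπ : IsDiscCovering π) {U K : Set ℂ}
    (hU : IsSheet π U) {g : M → ℂ} (hg : IsTest g) (hKU : K ⊆ U) (hKc : IsCompact K)
    (hK : ∀ z ∈ U, π z ∈ tsupport g → z ∈ K) :
    ContDiff ℝ ∞ (U.indicator (g ∘ π)) ∧ tsupport (U.indicator (g ∘ π)) ⊆ K := by
  have h0 : ∀ z ∈ U, z ∉ K → (g ∘ π) z = 0 := fun z hz hzK =>
    image_eq_zero_of_notMem_tsupport (f := g) fun h => hzK (hK z hz h)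
  exact ⟨contDiff_indicator hU.isOpen hKc hKU ((hg.contDiffOn hπ).mono hU.subset) h0,
    tsupport_indicator_subset hKc h0⟩

theorem indicator_eventuallyEq {U : Set ℂ} (hU : IsOpen U) (f : ℂ → ℂ) {z : ℂ} (hz : z ∈ U) :
    U.indicator f =ᶠ[𝓝 z] f := by
  filter_upwards [hU.mem_nhds hz] with w hw using indicator_of_mem hw f

theorem memLp_of_sheet {U : Set ℂ} (hU : MeasurableSet U) {k k₀ : ℂ → ℂ} (hk : Continuous k₀)
    (hkc : HasCompactSupport k₀) (h : EqOn k k₀ U) : MemLp k 2 (volume.restrict U) :=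
  ((hk.memLp_of_hasCompactSupport hkc).restrict U).ae_eq
    ((ae_restrict_mem hU).mono fun _ hz => (h hz).symm)

theorem IsTest.memLp (hπ : IsDiscCovering π) (hs : IsSection π s) {g : M → ℂ} (hg : IsTest g) :
    MemLp (fun z => (discScale z : ℂ) * g (π z)) 2 (volume.restrict (range s)) ∧
      MemLp (dz (g ∘ π)) 2 (volume.restrict (range s)) := by
  refine IsTest.induction hπ (P := fun g =>
    MemLp (fun z => (discScale z : ℂ) * g (π z)) 2 (volume.restrict (range s)) ∧
      MemLp (dz (g ∘ π)) 2 (volume.restrict (range s))) ?_ ?_ ?_ hg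
  · constructor
    · simp
    · have : dz ((0 : M → ℂ) ∘ π) = 0 := by
        ext z; exact dz_eq_zero (Eventually.of_forall fun _ => rfl)
      rw [this]; exact MemLp.zero
  · rintro g h hg hh ⟨hg1, hg2⟩ ⟨hh1, hh2⟩
    refine ⟨(hg1.add hh1).ae_eq (ae_of_all _ fun z => ?_), (hg2.add hh2).ae_eq ?_⟩
    · simp [mul_add]
    · filter_upwards [ae_restrict_mem hs.measurableSet_range] with z hz
      exact (dz_add (hg.differentiableAt hπ (hs.range_subset hz))
        (hh.differentiableAt hπ (hs.range_subset hz))).symm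
  · intro g U hg hU hgU
    obtain ⟨K, hKU, hKc, hK⟩ := exists_compact_of_tsupport_subset hπ hU hg.2 hgU
    have h0 : ∀ z ∈ U, z ∉ K → g (π z) = 0 := fun z hz hzK =>
      image_eq_zero_of_notMem_tsupport (f := g) fun h => hzK (hK z hz h)
    have hsub := hs.range_subset
    constructor
    · refine ⟨aestronglyMeasurable_of_continuousOn hsub
        (contDiffOn_discScale.continuousOn.mul (hg.contDiffOn hπ).continuousOn), ?_⟩
      rw [eLpNorm_scale_eq_sheet hπ hs hU hgU]
      have h0' : ∀ z ∈ U, z ∉ K → (discScale z : ℂ) * g (π z) = 0 := fun z hz hzK => by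
        rw [h0 z hz hzK, mul_zero]
      have hc := contDiff_indicator hU.isOpen hKc hKU ((contDiffOn_discScale.mul
        (hg.contDiffOn hπ)).mono hU.subset) h0'
      exact (memLp_of_sheet hU.isOpen.measurableSet hc.continuous (hKc.of_isClosed_subset
        isClosed_closure (tsupport_indicator_subset hKc h0'))
        fun z hz => (indicator_of_mem hz _).symm).2
    · refine ⟨aestronglyMeasurable_of_continuousOn hsub
        (hg.continuousOn_dz hπ), ?_⟩
      rw [eLpNorm_dz_eq_sheet hπ hs hU hgU]
      obtain ⟨hc, hts⟩ := hg.contDiff_indicator_pullback hπ hU hKU hKc hK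
      exact (memLp_of_sheet hU.isOpen.measurableSet (continuous_dz hc) (hasCompactSupport_dz
        (hKc.of_isClosed_subset isClosed_closure hts))
        fun z hz => (dz_congr (indicator_eventuallyEq hU.isOpen _ hz)).symm).2

theorem dzb_eq_conj (G : ℂ → ℂ) (z : ℂ) :
    dzb G z = (starRingEnd ℂ) (dz (fun w => (starRingEnd ℂ) (G w)) z) := by
  rw [dz_conj, Complex.conj_conj]

theorem IsTest.memLp_dzb (hπ : IsDiscCovering π) (hs : IsSection π s) {g : M → ℂ} (hg : IsTest g) :
    MemLp (dzb (g ∘ π)) 2 (volume.restrict (range s)) := by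
  have h := (hg.conj.memLp hπ hs).2.star
  refine h.ae_eq (ae_of_all _ fun z => ?_)
  exact (dzb_eq_conj (g ∘ π) z).symm

/-- `∫_M dg ∧ dh = 0` for test functions. -/
theorem IsTest.stokes (hπ : IsDiscCovering π) (hs : IsSection π s) {g h : M → ℂ} (hg : IsTest g)
    (hh : IsTest h) : ∫ z in range s,
      (dz (g ∘ π) z * dzb (h ∘ π) z - dzb (g ∘ π) z * dz (h ∘ π) z) = 0 := by
  have hint : ∀ g, IsTest g → Integrable (fun z => dz (g ∘ π) z * dzb (h ∘ π) z -
      dzb (g ∘ π) z * dz (h ∘ π) z) (volume.restrict (range s)) := fun g hg =>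
    ((hg.memLp hπ hs).2.integrable_mul (hh.memLp_dzb hπ hs)).sub
      ((hg.memLp_dzb hπ hs).integrable_mul (hh.memLp hπ hs).2)
  refine IsTest.induction hπ (P := fun g => ∫ z in range s,
      (dz (g ∘ π) z * dzb (h ∘ π) z - dzb (g ∘ π) z * dz (h ∘ π) z) = 0) ?_ ?_ ?_ hg
  · have h1 : ∀ z, dz ((0 : M → ℂ) ∘ π) z = 0 := fun z =>
      dz_eq_zero (Eventually.of_forall fun _ => rfl)
    have h2 : ∀ z, dzb ((0 : M → ℂ) ∘ π) z = 0 := fun z =>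
      dzb_eq_zero (Eventually.of_forall fun _ => rfl)
    simp only [h1, h2]
    simp
  · intro g₁ g₂ hg₁ hg₂ h1 h2
    rw [← add_zero (0 : ℂ)]
    nth_rewrite 1 [← h1]
    rw [← h2, ← integral_add (hint _ hg₁) (hint _ hg₂)]
    refine setIntegral_congr_fun hs.measurableSet_range fun z hz => ?_
    have hd1 := hg₁.differentiableAt hπ (hs.range_subset hz)
    have hd2 := hg₂.differentiableAt hπ (hs.range_subset hz)
    have e1 : dz ((g₁ + g₂) ∘ π) z = dz (g₁ ∘ π) z + dz (g₂ ∘ π) z := dz_add hd1 hd2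
    have e2 : dzb ((g₁ + g₂) ∘ π) z = dzb (g₁ ∘ π) z + dzb (g₂ ∘ π) z := dzb_add hd1 hd2
    rw [e1, e2]; ring
  · intro g U hg hU hgU
    obtain ⟨K, hKU, hKc, hK⟩ := exists_compact_of_tsupport_subset hπ hU hg.2 hgU
    obtain ⟨hc, hts⟩ := hg.contDiff_indicator_pullback hπ hU hKU hKc hK
    -- the quotient of `dg ∧ dh` by the area form, up to a constant
    let Q : M → ℂ := fun x => (del g x (vec x 1) * delbar h x (vec x 1) -
      delbar g x (vec x 1) * del h x (vec x 1)) / ((hypScale π x ^ 2 : ℝ) : ℂ)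
    have hQ : ∀ z ∈ disc, dz (g ∘ π) z * dzb (h ∘ π) z - dzb (g ∘ π) z * dz (h ∘ π) z =
        discScale z ^ 2 • Q (π z) := by
      intro z hz
      have hp := coord_push_one_ne_zero hπ hz
      have hρ : (discScale z : ℂ) ≠ 0 := Complex.ofReal_ne_zero.2 (discScale_pos hz).ne'
      have hn : ((‖coord (push π z 1)‖ : ℝ) : ℂ) ^ 2 =
          coord (push π z 1) * (starRingEnd ℂ) (coord (push π z 1)) := by
        rw [Complex.mul_conj, Complex.normSq_eq_norm_sq]; push_cast; rfl
      have hp' : (starRingEnd ℂ) (coord (push π z 1)) ≠ 0 := by simpa using hp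
      simp only [Q, del_vec hπ _ hz, delbar_vec hπ _ hz, hypScale_eq hπ hz, Complex.real_smul]
      push_cast
      rw [div_pow, hn]
      simp only [map_div₀, map_one]
      field_simp
    have hQ0 : ∀ x, x ∉ π '' U → Q x = 0 := by
      intro x hx
      obtain ⟨z, hz, rfl⟩ := hπ.surjective (mem_univ x)
      have h1 := pullback_eventuallyEq_zero hπ hz fun h => hx (hgU h)
      have h2 : dz (g ∘ π) z = 0 := dz_eq_zero h1
      have h3 : dzb (g ∘ π) z = 0 := dzb_eq_zero h1
      simp only [Q, del_vec hπ _ hz, delbar_vec hπ _ hz, h2, h3]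
      simp
    rw [setIntegral_congr_fun hs.measurableSet_range fun z hz => hQ z (hs.range_subset hz),
      integral_range_eq_sheet hπ hs hU Q hQ0]
    refine Eq.trans ?_ (integral_wirtinger_eq_zero hU.isOpen hc (hKc.of_isClosed_subset
      isClosed_closure hts) (hts.trans hKU) ((hh.contDiffOn hπ).mono hU.subset))
    refine Eq.trans (setIntegral_congr_fun hU.isOpen.measurableSet fun z hz => ?_)
      (setIntegral_eq_integral_of_forall_compl_eq_zero (s := U) fun z hz => ?_)
    · have he := indicator_eventuallyEq hU.isOpen (g ∘ π) hz
      rw [← hQ z (hU.subset hz), dz_congr he, dzb_congr he]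
    · have h1 : U.indicator (g ∘ π) =ᶠ[𝓝 z] 0 :=
        notMem_tsupport_iff_eventuallyEq.1 fun h => hz (hKU (hts h))
      rw [dz_eq_zero h1, dzb_eq_zero h1]; simp

theorem IsTest.integral_dzb_eq (hπ : IsDiscCovering π) (hs : IsSection π s) {g : M → ℂ}
    (hg : IsTest g) : ∫ z in range s, ‖dzb (g ∘ π) z‖ ^ 2 = ∫ z in range s, ‖dz (g ∘ π) z‖ ^ 2 := by
  have h := hg.stokes hπ hs hg.conj
  have e : ∀ z, dz (g ∘ π) z * dzb ((fun x => (starRingEnd ℂ) (g x)) ∘ π) z - dzb (g ∘ π) z *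
      dz ((fun x => (starRingEnd ℂ) (g x)) ∘ π) z =
      ((‖dz (g ∘ π) z‖ ^ 2 - ‖dzb (g ∘ π) z‖ ^ 2 : ℝ) : ℂ) := by
    intro z
    have e1 : dzb ((fun x => (starRingEnd ℂ) (g x)) ∘ π) z = (starRingEnd ℂ) (dz (g ∘ π) z) :=
      dzb_conj (g ∘ π) z
    have e2 : dz ((fun x => (starRingEnd ℂ) (g x)) ∘ π) z = (starRingEnd ℂ) (dzb (g ∘ π) z) :=
      dz_conj (g ∘ π) z
    rw [e1, e2, Complex.mul_conj, Complex.mul_conj, Complex.normSq_eq_norm_sq,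
      Complex.normSq_eq_norm_sq]
    push_cast; rfl
  simp_rw [e] at h
  rw [integral_complex_ofReal, Complex.ofReal_eq_zero, integral_sub
    (hg.memLp hπ hs).2.norm.integrable_sq (hg.memLp_dzb hπ hs).norm.integrable_sq] at h
  linarith

/-- The Poincaré inequality for `∂`.  The factor is `4` because `|∇g|² = 2 (|∂g|² + |∂̄g|²)` in terms of
Wirtinger derivatives, and the two terms have the same integral. -/
theorem IsTest.poincare (hπ : IsDiscCovering π) (hs : IsSection π s) (hpos : 0 < lambda1 π)
    {g : M → ℂ} (hg : IsTest g) :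
    lambda1 π * ∫ z in range s, ‖(discScale z : ℂ) * g (π z)‖ ^ 2 ≤
      4 * ∫ z in range s, ‖dz (g ∘ π) z‖ ^ 2 := by
  by_cases hg0 : g = 0
  · have : ∫ z in range s, ‖(discScale z : ℂ) * g (π z)‖ ^ 2 = 0 := by simp [hg0]
    rw [this, mul_zero]
    positivity
  have hA : ∫ x, gradSq π g x ∂hypArea π = 4 * ∫ z in range s, ‖dz (g ∘ π) z‖ ^ 2 := by
    have : ∫ z in range s, discScale z ^ 2 • gradSq π g (π z) =
        ∫ z in range s, 2 * (‖dz (g ∘ π) z‖ ^ 2 + ‖dzb (g ∘ π) z‖ ^ 2) := by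
      refine setIntegral_congr_fun hs.measurableSet_range fun z hz => ?_
      have hz' := hs.range_subset hz
      rw [gradSq_eq hπ g hz', smul_eq_mul, mul_div_cancel₀ _ (pow_pos (discScale_pos hz') 2).ne']
    rw [integral_hypArea hs, this, integral_const_mul, integral_add
      (hg.memLp hπ hs).2.norm.integrable_sq (hg.memLp_dzb hπ hs).norm.integrable_sq,
      hg.integral_dzb_eq hπ hs]
    ring
  have hB : ∫ x, ‖g x‖ ^ 2 ∂hypArea π = ∫ z in range s, ‖(discScale z : ℂ) * g (π z)‖ ^ 2 := by
    rw [integral_hypArea hs]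
    refine setIntegral_congr_fun hs.measurableSet_range fun z hz => ?_
    rw [norm_mul, mul_pow, Complex.norm_real, Real.norm_eq_abs, sq_abs, smul_eq_mul]
  have hle : lambda1 π ≤ (∫ x, gradSq π g x ∂hypArea π) / ∫ x, ‖g x‖ ^ 2 ∂hypArea π := by
    refine csInf_le ⟨0, ?_⟩ ⟨g, hg, hg0, rfl⟩
    rintro r ⟨f, -, -, rfl⟩
    refine div_nonneg (integral_nonneg fun x => ?_) (integral_nonneg fun x => sq_nonneg _)
    unfold gradSq; positivity
  rw [hA, hB] at hle
  set b := ∫ z in range s, ‖(discScale z : ℂ) * g (π z)‖ ^ 2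
  have hb : 0 ≤ b := integral_nonneg fun x => sq_nonneg _
  rcases hb.eq_or_lt with h0 | h0
  · -- the Rayleigh quotient is the junk value `0` if the denominator vanishes
    rw [← h0, div_zero] at hle
    exact absurd hle hpos.not_ge
  · rwa [le_div_iff₀ h0] at hle

end Poincare

/-! ### Mollification of Lipschitz functions -/

section Mollify

open Filter Topology Metric
open scoped Convolution

theorem tendsto_eLpNorm_two_zero {α : Type*} [MeasurableSpace α] {μ : Measure α} {X : ℕ → α → ℂ}
    {b : α → ℝ} (hX : ∀ n, AEStronglyMeasurable (X n) μ) (hb : MemLp b 2 μ)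
    (hXb : ∀ n, ∀ᵐ z ∂μ, ‖X n z‖ ≤ b z) (hlim : ∀ᵐ z ∂μ, Tendsto (fun n => X n z) atTop (𝓝 0)) :
    Tendsto (fun n => eLpNorm (X n) 2 μ) atTop (𝓝 0) := by
  have h1 : Tendsto (fun n => ∫⁻ z, ‖X n z‖ₑ ^ (2 : ℝ) ∂μ) atTop (𝓝 (∫⁻ _, 0 ∂μ)) := by
    refine tendsto_lintegral_of_dominated_convergence' (fun z => ‖b z‖ₑ ^ (2 : ℝ))
      (fun n => (hX n).enorm.pow_const _) (fun n => ?_) ?_ ?_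
    · filter_upwards [hXb n] with z hz
      gcongr
      rw [← ofReal_norm, ← ofReal_norm]
      exact ENNReal.ofReal_le_ofReal (hz.trans (le_abs_self _))
    · have := hb.2
      rw [eLpNorm_lt_top_iff_lintegral_rpow_enorm_lt_top two_ne_zero ENNReal.ofNat_ne_top] at this
      exact this.ne
    · filter_upwards [hlim] with z hz
      have := (hz.enorm).ennrpow_const 2
      simpa using this
  rw [lintegral_zero] at h1
  have h2 := h1.ennrpow_const (1 / 2)
  simp only [eLpNorm_eq_lintegral_rpow_enorm_toReal two_ne_zero ENNReal.ofNat_ne_top,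
    ENNReal.toReal_ofNat]
  simpa using h2

/-- The derivative of a mollified Lipschitz function is the mollified derivative, which exists almost
everywhere by Rademacher's theorem. -/
theorem fderiv_normed_convolution {Ψ : ℂ → ℝ} {L : ℝ≥0} (hΨ : LipschitzWith L Ψ)
    (φ : ContDiffBump (0 : ℂ)) (x v : ℂ) :
    fderiv ℝ (φ.normed volume ⋆[ContinuousLinearMap.lsmul ℝ ℝ, volume] Ψ) x v =
      (φ.normed volume ⋆[ContinuousLinearMap.lsmul ℝ ℝ, volume]
        fun y => lineDeriv ℝ Ψ y v) x := by
  set ρ := φ.normed (volume : Measure ℂ) with hρ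
  set c := ρ ⋆[ContinuousLinearMap.lsmul ℝ ℝ, volume] Ψ with hc
  have hρc : Continuous ρ := φ.continuous_normed
  have hρs : HasCompactSupport ρ := φ.hasCompactSupport_normed
  have hcd : ContDiff ℝ 1 c := hρs.contDiff_convolution_left _ φ.contDiff_normed
    hΨ.continuous.locallyIntegrable
  have hdiff : DifferentiableAt ℝ c x := hcd.differentiable one_ne_zero x
  have hρx : HasCompactSupport fun y => ρ (x - y) := hρs.comp_homeomorph (Homeomorph.subLeft x)
  have hρxc : Continuous fun y => ρ (x - y) := by fun_prop
  have T1 := hΨ.integral_inv_smul_sub_mul_tendsto_integral_lineDeriv_mul (μ := volume)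
    (hρxc.integrable_of_hasCompactSupport hρx) v
  have T2 := (hdiff.hasFDerivAt.hasLineDerivAt v).tendsto_slope_zero_right
  have hcx : ∀ t : ℝ, c (x + t • v) = ∫ y, Ψ (y + t • v) * ρ (x - y) := by
    intro t
    rw [hc, convolution_eq_swap, ← integral_add_right_eq_self _ (t • v)]
    refine integral_congr_ae (ae_of_all _ fun y => ?_)
    simp [mul_comm]
  have hint : ∀ t : ℝ, Integrable fun y => Ψ (y + t • v) * ρ (x - y) := fun t =>
    (((hΨ.continuous.comp (continuous_add_const _)).mul hρxc)).integrable_of_hasCompactSupport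
      hρx.mul_left
  have heq : ∀ t : ℝ, ∫ y, (t⁻¹ • (Ψ (y + t • v) - Ψ y)) * ρ (x - y) =
      t⁻¹ • (c (x + t • v) - c x) := by
    intro t
    have h0 := hcx 0
    have i0 := hint 0
    simp only [zero_smul, add_zero] at h0 i0
    rw [hcx t, h0, ← integral_sub (hint t) i0, ← integral_smul]
    congr 1; ext y
    simp only [smul_eq_mul]; ring
  simp_rw [heq] at T1
  rw [tendsto_nhds_unique T2 T1, convolution_eq_swap]
  refine integral_congr_ae (ae_of_all _ fun y => ?_)
  simp [mul_comm]

/-- Smooth approximations of a Lipschitz function. -/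
theorem exists_smooth_approx {Ψ : ℂ → ℝ} {L : ℝ≥0} (hΨ : LipschitzWith L Ψ) :
    ∃ Ψn : ℕ → ℂ → ℝ, (∀ n, ContDiff ℝ ∞ (Ψn n)) ∧
      (∀ n z, |Ψn n z - Ψ z| ≤ L * (2 / (n + 1))) ∧
      (∀ n z v, |fderiv ℝ (Ψn n) z v| ≤ L * ‖v‖) ∧
      ∀ v, ∀ᵐ z, Tendsto (fun n => fderiv ℝ (Ψn n) z v) atTop (𝓝 (fderiv ℝ Ψ z v)) := by
  let φ : ℕ → ContDiffBump (0 : ℂ) := fun n =>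
    ⟨1 / (n + 1), 2 / (n + 1), by positivity, by gcongr; norm_num⟩
  have hli : LocallyIntegrable Ψ := hΨ.continuous.locallyIntegrable
  refine ⟨fun n => (φ n).normed volume ⋆[ContinuousLinearMap.lsmul ℝ ℝ, volume] Ψ,
    fun n => (φ n).hasCompactSupport_normed.contDiff_convolution_left _ (φ n).contDiff_normed hli,
    fun n z => ?_, fun n z v => ?_, fun v => ?_⟩
  · rw [← Real.dist_eq]
    refine ContDiffBump.dist_normed_convolution_le hΨ.continuous.aestronglyMeasurable
      fun x hx => ?_
    refine (hΨ.dist_le_mul x z).trans ?_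
    gcongr
    exact (mem_ball.1 hx).le
  · rw [fderiv_normed_convolution hΨ, convolution_def]
    set ρ := (φ n).normed (volume : Measure ℂ)
    have hρi : Integrable ρ := (φ n).integrable_normed
    calc |∫ t, ContinuousLinearMap.lsmul ℝ ℝ (ρ t) (lineDeriv ℝ Ψ (z - t) v)|
        ≤ ∫ t, ρ t * (L * ‖v‖) := by
          rw [← Real.norm_eq_abs]
          refine norm_integral_le_of_norm_le (hρi.mul_const _) (ae_of_all _ fun t => ?_)
          simp only [ContinuousLinearMap.lsmul_apply, smul_eq_mul, norm_mul, Real.norm_eq_abs]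
          rw [abs_of_nonneg ((φ n).nonneg_normed t)]
          exact mul_le_mul_of_nonneg_left (norm_lineDeriv_le_of_lipschitz ℝ hΨ)
            ((φ n).nonneg_normed t)
      _ = L * ‖v‖ := by rw [integral_mul_const, (φ n).integral_normed, one_mul]
  · have hr : Tendsto (fun n => (φ n).rOut) atTop (𝓝 0) := by
      have := (tendsto_one_div_add_atTop_nhds_zero_nat (𝕜 := ℝ)).const_mul 2
      simpa [φ, div_eq_mul_inv] using this
    have h2 := ContDiffBump.ae_convolution_tendsto_right_of_locallyIntegrable (K := 2) hr
      (Eventually.of_forall fun n => by simp [φ]; rw [div_eq_mul_inv])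
      (hΨ.locallyIntegrable_lineDeriv (μ := volume) v)
    filter_upwards [h2, hΨ.ae_differentiableAt] with z hz hd
    simp_rw [fderiv_normed_convolution hΨ]
    rw [← hd.lineDeriv_eq_fderiv]
    exact hz

end Mollify

/-! ### Multiplication of test functions by Lipschitz functions -/

section Lipschitz

open Filter Topology Metric

variable {M : Type*} {π : ℂ → M}

/-- The pull-back to the disc is Lipschitz, for the Euclidean distance, on all smaller concentric discs.
This is all that is used of hyperbolic Lipschitz continuity. -/
def PullbackLipschitz (π : ℂ → M) (ψ : M → ℝ) : Prop :=
  ∀ R < 1, ∃ L : ℝ≥0, LipschitzOnWith L (ψ ∘ π) (ball (0 : ℂ) R)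

theorem PullbackLipschitz.differentiableAt_ae {ψ : M → ℝ} (hψ : PullbackLipschitz π ψ) :
    ∀ᵐ z, z ∈ disc → DifferentiableAt ℝ (ψ ∘ π) z := by
  have : ∀ n : ℕ, ∀ᵐ z, z ∈ ball (0 : ℂ) (1 - 1 / (n + 1)) → DifferentiableAt ℝ (ψ ∘ π) z := by
    intro n
    obtain ⟨L, hL⟩ := hψ (1 - 1 / (n + 1)) (by
      have : (0 : ℝ) < 1 / (n + 1) := by positivity
      linarith)
    filter_upwards [hL.ae_differentiableWithinAt_of_mem] with z hz hzb
    exact (hz hzb).differentiableAt (isOpen_ball.mem_nhds hzb)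
  filter_upwards [ae_all_iff.2 this] with z hz hzd
  have h1 : 0 < 1 - ‖z‖ := by
    have : ‖z‖ < 1 := by simpa using hzd
    linarith
  obtain ⟨n, hn⟩ := exists_nat_one_div_lt h1
  exact hz n (by simp only [mem_ball, dist_zero_right]; linarith)

variable [TopologicalSpace M] [ChartedSpace ℂ M] [IsManifold 𝓘(ℂ, ℂ) ω M]

/-- The hyperbolic distance is bounded by the length of the Euclidean segment. -/
theorem hypEDist_le (hπ : IsDiscCovering π) {R : ℝ} (hR : R < 1) {z w : ℂ} (hz : z ∈ ball (0 : ℂ) R)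
    (hw : w ∈ ball (0 : ℂ) R) :
    hypEDist π (π z) (π w) ≤ ENNReal.ofReal (2 / (1 - R ^ 2)) * edist z w := by
  let γ : ℝ → ℂ := fun t => z + t • (w - z)
  have hR0 : 0 < R := by
    have : ‖z‖ < R := by simpa using hz
    exact (norm_nonneg z).trans_lt this
  have hγR : ∀ t ∈ Icc (0 : ℝ) 1, γ t ∈ ball (0 : ℂ) R := fun t ht =>
    (convex_ball (0 : ℂ) R).add_smul_sub_mem hz hw ht
  have hγd : ∀ t ∈ Icc (0 : ℝ) 1, γ t ∈ disc := fun t ht => ball_subset_ball hR.le (hγR t ht)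
  have hder : ∀ t, HasFDerivAt γ (ContinuousLinearMap.toSpanSingleton ℝ (w - z)) t := fun t => by
    have : HasDerivAt γ ((1 : ℝ) • (w - z)) t :=
      ((hasDerivAt_id t).smul_const (w - z)).const_add z
    rw [one_smul] at this
    exact this.hasFDerivAt
  let _ : ∀ p : M, ENorm (TangentSpace 𝓘(ℝ, ℂ) p) :=
    fun p => ⟨fun ξ => ENNReal.ofReal (hypLength π p ξ)⟩
  have hsmul : ∀ p : M, ENormSMulClass ℝ (TangentSpace 𝓘(ℝ, ℂ) p) := fun p => ⟨fun r ξ => by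
    change ENNReal.ofReal (hypScale π p * ‖r • coord ξ‖) =
      ‖r‖ₑ * ENNReal.ofReal (hypScale π p * ‖coord ξ‖)
    rw [norm_smul, ← ofReal_norm, ← ENNReal.ofReal_mul (norm_nonneg r)]
    congr 1
    ring⟩
  have hC : ContMDiffOn 𝓘(ℝ, ℝ) 𝓘(ℝ, ℂ) 1 (π ∘ γ) (Icc 0 1) := by
    intro t ht
    have h1 : ContMDiffAt 𝓘(ℝ, ℝ) 𝓘(ℝ, ℂ) 1 γ t := by
      have : ContDiff ℝ 1 γ := by fun_prop
      exact this.contDiffAt.contMDiffAt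
    exact ((contMDiffAt_covering hπ (hγd t ht)).comp t h1).contMDiffWithinAt
  have hle := Manifold.riemannianEDist_le_pathELength (I := 𝓘(ℝ, ℂ)) (x := π z) (y := π w) hC
    (by simp [γ]) (by simp [γ]) zero_le_one
  have e : hypEDist π (π z) (π w) = Manifold.riemannianEDist 𝓘(ℝ, ℂ) (π z) (π w) := rfl
  rw [e]
  refine hle.trans ?_
  rw [Manifold.pathELength_eq_lintegral_mfderiv_Icc]
  have hbound : ∀ t ∈ Icc (0 : ℝ) 1, ‖mfderiv 𝓘(ℝ, ℝ) 𝓘(ℝ, ℂ) (π ∘ γ) t 1‖ₑ ≤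
      ENNReal.ofReal (2 / (1 - R ^ 2)) * edist z w := by
    intro t ht
    have hm : mfderiv 𝓘(ℝ, ℝ) 𝓘(ℝ, ℂ) (π ∘ γ) t 1 = push π (γ t) (w - z) := by
      rw [mfderiv_comp t (hπ.mdifferentiableAt (hγd t ht)).real
        (hder t).differentiableAt.mdifferentiableAt, mfderiv_eq_fderiv, (hder t).fderiv]
      exact congrArg (mfderiv 𝓘(ℝ, ℂ) 𝓘(ℝ, ℂ) π (γ t)) (one_smul ℝ (w - z))
    rw [hm]
    change ENNReal.ofReal (hypLength π (π (γ t)) (push π (γ t) (w - z))) ≤ _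
    rw [hypLength_push hπ (hγd t ht), ENNReal.ofReal_mul (discScale_pos (hγd t ht)).le,
      edist_dist, dist_comm, dist_eq_norm]
    gcongr
    have h1 : ‖γ t‖ < R := by simpa using hγR t ht
    have h2 : 0 < 1 - R ^ 2 := by nlinarith
    unfold discScale
    gcongr
  calc ∫⁻ t in Icc (0 : ℝ) 1, ‖mfderiv 𝓘(ℝ, ℝ) 𝓘(ℝ, ℂ) (π ∘ γ) t 1‖ₑ
      ≤ ∫⁻ t in Icc (0 : ℝ) 1, ENNReal.ofReal (2 / (1 - R ^ 2)) * edist z w :=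
        setLIntegral_mono' measurableSet_Icc hbound
    _ = _ := by simp

theorem HypLipschitz.pullbackLipschitz (hπ : IsDiscCovering π) {φ : M → ℝ}
    (hφ : HypLipschitz π φ) : PullbackLipschitz π φ := by
  obtain ⟨K, hK⟩ := hφ
  intro R hR
  refine ⟨K * (2 / (1 - R ^ 2)).toNNReal, fun z hz w hw => ?_⟩
  refine (hK _ _).trans ?_
  rw [ENNReal.coe_mul, mul_assoc]
  gcongr
  exact hypEDist_le hπ hR hz hw

theorem dz_ofReal {Ψ : ℂ → ℝ} {z : ℂ} (h : DifferentiableAt ℝ Ψ z) :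
    dz (fun w => (Ψ w : ℂ)) z = (fderiv ℝ Ψ z 1 - Complex.I * fderiv ℝ Ψ z Complex.I) / 2 := by
  have h1 : HasFDerivAt (fun w => (Ψ w : ℂ)) (Complex.ofRealCLM.comp (fderiv ℝ Ψ z)) z :=
    Complex.ofRealCLM.hasFDerivAt.comp z h.hasFDerivAt
  simp [dz, h1.fderiv]

theorem norm_dz_ofReal_le {Ψ : ℂ → ℝ} {L : ℝ≥0} {z : ℂ} (h : ∀ v, |fderiv ℝ Ψ z v| ≤ L * ‖v‖) :
    ‖dz (fun w => (Ψ w : ℂ)) z‖ ≤ L := by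
  by_cases hd : DifferentiableAt ℝ Ψ z
  · rw [dz_ofReal hd, norm_div, RCLike.norm_ofNat, div_le_iff₀ two_pos]
    refine (norm_sub_le _ _).trans ?_
    have h1 := h 1
    have h2 := h Complex.I
    simp only [norm_one, Complex.norm_I, mul_one] at h1 h2
    simp only [norm_mul, Complex.norm_I, one_mul, Complex.norm_real, Real.norm_eq_abs]
    linarith
  · have : ¬ DifferentiableAt ℝ (fun w => (Ψ w : ℂ)) z := fun h' =>
      hd (Complex.reCLM.differentiableAt.comp z h')
    simp [dz, fderiv_zero_of_not_differentiableAt this]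

variable [MeasurableSpace M] [BorelSpace M] [T2Space M] {s : M → ℂ}

theorem measurable_dz (G : ℂ → ℂ) : Measurable (dz G) := by
  unfold dz
  exact ((measurable_fderiv_apply_const ℝ G 1).sub
    ((measurable_fderiv_apply_const ℝ G Complex.I).const_mul _)).div_const _

/-- The product of a test function, supported in the image of a sheet, and a Lipschitz function is a limit
of test functions in the graph norm of `∂`.  On the sheet, the Lipschitz function is mollified. -/
theorem IsTest.exists_approx_mul (hπ : IsDiscCovering π) (hs : IsSection π s) {ψ : M → ℝ}
    (hψ : PullbackLipschitz π ψ) {U : Set ℂ} (hU : IsSheet π U) {g : M → ℂ} (hg : IsTest g)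
    (hgU : tsupport g ⊆ π '' U) :
    ∃ gn : ℕ → M → ℂ, (∀ n, IsTest (gn n)) ∧
      Tendsto (fun n => eLpNorm (fun z => (discScale z : ℂ) * gn n (π z) -
        ψ (π z) * ((discScale z : ℂ) * g (π z))) 2 (volume.restrict (range s))) atTop (𝓝 0) ∧
      Tendsto (fun n => eLpNorm (fun z => dz (gn n ∘ π) z - (ψ (π z) * dz (g ∘ π) z +
        dz (fun w => (ψ (π w) : ℂ)) z * g (π z))) 2 (volume.restrict (range s))) atTop (𝓝 0) := by
  obtain ⟨K, hKU, hKc, hK⟩ := exists_compact_of_tsupport_subset hπ hU hg.2 hgU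
  obtain ⟨hc, hts⟩ := hg.contDiff_indicator_pullback hπ hU hKU hKc hK
  set G₀ := U.indicator (g ∘ π) with hG₀
  have hG₀c : HasCompactSupport G₀ := hKc.of_isClosed_subset isClosed_closure hts
  -- a smaller disc containing the support
  obtain ⟨R, hR1, hKR⟩ : ∃ R < 1, K ⊆ ball (0 : ℂ) R := by
    rcases K.eq_empty_or_nonempty with rfl | hne
    · exact ⟨0, one_pos, empty_subset _⟩
    · obtain ⟨z₀, hz₀, hmax⟩ := hKc.exists_isMaxOn hne continuous_norm.continuousOn
      have h1 : ‖z₀‖ < 1 := by simpa using hU.subset (hKU hz₀)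
      refine ⟨(‖z₀‖ + 1) / 2, by linarith, fun z hz => ?_⟩
      have : ‖z‖ ≤ ‖z₀‖ := hmax hz
      simp only [mem_ball, dist_zero_right]; linarith
  obtain ⟨L, hL⟩ := hψ R hR1
  obtain ⟨Ψ, hΨ, hΨeq⟩ := hL.extend_real
  obtain ⟨Ψn, hΨn, hval, hbd, hae⟩ := exists_smooth_approx hΨ
  have hsm : ∀ n, ContDiff ℝ ∞ fun z => (Ψn n z : ℂ) := fun n =>
    Complex.ofRealCLM.contDiff.comp (hΨn n)
  have hsub : ∀ n, tsupport (fun z => G₀ z * (Ψn n z : ℂ)) ⊆ K := fun n =>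
    (tsupport_mul_subset_left).trans hts
  have hex := fun n => exists_isTest_of_sheet hπ hU (hc.mul (hsm n)) hG₀c.mul_right
    ((hsub n).trans hKU)
  choose gn hgn hgnU hgneq using hex
  have hvlim : ∀ z, Tendsto (fun n => (Ψn n z : ℂ) - Ψ z) atTop (𝓝 0) := by
    intro z
    have h0 : Tendsto (fun n : ℕ => (L : ℝ) * (2 / ((n : ℝ) + 1))) atTop (𝓝 0) := by
      have := (tendsto_one_div_add_atTop_nhds_zero_nat (𝕜 := ℝ)).const_mul (L * 2 : ℝ)
      simpa [div_eq_mul_inv, mul_assoc] using this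
    refine squeeze_zero_norm (fun n => ?_) h0
    rw [← Complex.ofReal_sub, Complex.norm_real]
    exact hval n z
  have hvbd : ∀ n z, ‖(Ψn n z : ℂ) - Ψ z‖ ≤ 2 * L := by
    intro n z
    rw [← Complex.ofReal_sub, Complex.norm_real, Real.norm_eq_abs]
    refine (hval n z).trans ?_
    rw [mul_comm]
    gcongr
    rw [div_le_iff₀ (by positivity)]
    have : (0 : ℝ) ≤ n := n.cast_nonneg
    linarith
  have hGU : ∀ z ∈ U, G₀ z = g (π z) := fun z hz => indicator_of_mem hz _
  have hdGU : ∀ z ∈ U, dz G₀ z = dz (g ∘ π) z := fun z hz =>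
    dz_congr (indicator_eventuallyEq hU.isOpen _ hz)
  refine ⟨gn, hgn, ?_, ?_⟩
  · let κ : ℂ → ℂ := U.indicator fun z => (discScale z : ℂ) * g (π z)
    have h0' : ∀ z ∈ U, z ∉ K → (discScale z : ℂ) * g (π z) = 0 := fun z hz hzK => by
      rw [image_eq_zero_of_notMem_tsupport fun h => hzK (hK z hz h), mul_zero]
    have hκ : ContDiff ℝ ∞ κ := contDiff_indicator hU.isOpen hKc hKU ((contDiffOn_discScale.mul
      (hg.contDiffOn hπ)).mono hU.subset) h0'
    have hκc : HasCompactSupport κ := hKc.of_isClosed_subset isClosed_closure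
      (tsupport_indicator_subset hKc h0')
    have hlim : Tendsto (fun n => eLpNorm (fun z => κ z * ((Ψn n z : ℂ) - Ψ z)) 2 volume)
        atTop (𝓝 0) := by
      refine tendsto_eLpNorm_two_zero (b := fun z => ‖κ z‖ * (2 * L)) (fun n => ?_) ?_
        (fun n => ae_of_all _ fun z => ?_) (ae_of_all _ fun z => ?_)
      · exact (hκ.continuous.mul ((hsm n).continuous.sub
          (Complex.continuous_ofReal.comp hΨ.continuous))).aestronglyMeasurable
      · exact ((hκ.continuous.norm.mul continuous_const).memLp_of_hasCompactSupport
          hκc.norm.mul_right)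
      · rw [norm_mul]
        exact mul_le_mul_of_nonneg_left (hvbd n z) (norm_nonneg _)
      · simpa using (hvlim z).const_mul (κ z)
    refine tendsto_of_tendsto_of_tendsto_of_le_of_le tendsto_const_nhds hlim
      (fun _ => zero_le) fun n => ?_
    beta_reduce
    rw [eLpNorm_range_eq_sheet hπ hs hU (fun x => ‖gn n x - ψ x * g x‖) (fun z hz => ?_)
      fun x hx => ?_]
    · refine le_trans (le_of_eq (eLpNorm_congr_ae ?_)) (eLpNorm_restrict_le _ _ _ U)
      filter_upwards [ae_restrict_mem hU.isOpen.measurableSet] with z hz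
      rw [hgneq n z hz, hGU z hz, show κ z = _ from indicator_of_mem hz _]
      by_cases hzK : z ∈ K
      · rw [← hΨeq (hKR hzK), Function.comp_apply]; ring
      · rw [image_eq_zero_of_notMem_tsupport fun h => hzK (hK z hz h)]; simp
    · have : (discScale z : ℂ) * gn n (π z) - ψ (π z) * ((discScale z : ℂ) * g (π z)) =
          discScale z * (gn n (π z) - ψ (π z) * g (π z)) := by ring
      rw [this, norm_mul, Complex.norm_of_nonneg (discScale_pos hz).le]
    · rw [image_eq_zero_of_notMem_tsupport fun h => hx (hgU h),
        image_eq_zero_of_notMem_tsupport fun h => hx (hgnU n h)]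
      simp
  · have hlim : Tendsto (fun n => eLpNorm (fun z => G₀ z * (dz (fun w => (Ψn n w : ℂ)) z -
        dz (fun w => (Ψ w : ℂ)) z) + dz G₀ z * ((Ψn n z : ℂ) - Ψ z)) 2 volume) atTop (𝓝 0) := by
      have hΨbd : ∀ z v, |fderiv ℝ Ψ z v| ≤ L * ‖v‖ := fun z v =>
        ((fderiv ℝ Ψ z).le_opNorm v).trans (mul_le_mul_of_nonneg_right
          (norm_fderiv_le_of_lipschitz ℝ hΨ) (norm_nonneg _))
      refine tendsto_eLpNorm_two_zero (b := fun z => ‖G₀ z‖ * (2 * L) + ‖dz G₀ z‖ * (2 * L))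
        (fun n => ?_) ?_ (fun n => ae_of_all _ fun z => ?_) ?_
      · exact ((hc.continuous.aestronglyMeasurable.mul
          ((measurable_dz _).sub (measurable_dz _)).aestronglyMeasurable)).add
          ((continuous_dz hc).mul ((hsm n).continuous.sub
          (Complex.continuous_ofReal.comp hΨ.continuous))).aestronglyMeasurable
      · exact ((hc.continuous.norm.mul continuous_const).memLp_of_hasCompactSupport
          hG₀c.norm.mul_right).add (((continuous_dz hc).norm.mul
          continuous_const).memLp_of_hasCompactSupport (hasCompactSupport_dz hG₀c).norm.mul_right)
      · refine (norm_add_le _ _).trans (add_le_add ?_ ?_)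
        · rw [norm_mul]
          refine mul_le_mul_of_nonneg_left ((norm_sub_le _ _).trans ?_) (norm_nonneg _)
          have h1 := norm_dz_ofReal_le (hbd n z)
          have h2 := norm_dz_ofReal_le (hΨbd z)
          linarith
        · rw [norm_mul]
          exact mul_le_mul_of_nonneg_left (hvbd n z) (norm_nonneg _)
      · filter_upwards [hae 1, hae Complex.I, hΨ.ae_differentiableAt] with z h1 hI hd
        have hdz : Tendsto (fun n => dz (fun w => (Ψn n w : ℂ)) z) atTop
            (𝓝 (dz (fun w => (Ψ w : ℂ)) z)) := by
          rw [dz_ofReal hd]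
          simp_rw [fun n => dz_ofReal ((hΨn n).differentiable (by simp) z)]
          exact (((Complex.continuous_ofReal.tendsto _).comp h1).sub
            (((Complex.continuous_ofReal.tendsto _).comp hI).const_mul _)).div_const _
        have h3 : Tendsto (fun n => dz (fun w => (Ψn n w : ℂ)) z - dz (fun w => (Ψ w : ℂ)) z) atTop
            (𝓝 0) := by simpa using hdz.sub_const (dz (fun w => (Ψ w : ℂ)) z)
        simpa using (h3.const_mul (G₀ z)).add ((hvlim z).const_mul (dz G₀ z))
    refine tendsto_of_tendsto_of_tendsto_of_le_of_le tendsto_const_nhds hlim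
      (fun _ => zero_le) fun n => ?_
    beta_reduce
    have hout : ∀ x, x ∉ π '' U → ∀ f : M → ℂ, tsupport f ⊆ π '' U → del f x (vec x 1) = 0 := by
      intro x hx f hf
      obtain ⟨z, hz, rfl⟩ := hπ.surjective (mem_univ x)
      rw [del_vec hπ _ hz, dz_eq_zero (pullback_eventuallyEq_zero hπ hz fun h => hx (hf h)),
        zero_mul]
    rw [eLpNorm_range_eq_sheet hπ hs hU (fun x => ‖del (gn n) x (vec x 1) -
      (ψ x * del g x (vec x 1) + del (fun y => (ψ y : ℂ)) x (vec x 1) * g x)‖ / hypScale π x)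
      (fun z hz => ?_) fun x hx => ?_]
    · refine le_trans (le_of_eq (eLpNorm_congr_ae ?_)) (eLpNorm_restrict_le _ _ _ U)
      filter_upwards [ae_restrict_mem hU.isOpen.measurableSet] with z hz
      have e1 : dz (gn n ∘ π) z = G₀ z * dz (fun w => (Ψn n w : ℂ)) z + Ψn n z * dz G₀ z := by
        rw [← dz_mul (hc.differentiable (by simp) z) ((hsm n).differentiable (by simp) z)]
        apply dz_congr
        filter_upwards [hU.isOpen.mem_nhds hz] with w hw using hgneq n w hw
      rw [e1, ← hdGU z hz, ← hGU z hz]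
      by_cases hzK : z ∈ K
      · have e2 : dz (fun w => (ψ (π w) : ℂ)) z = dz (fun w => (Ψ w : ℂ)) z := by
          apply dz_congr
          filter_upwards [isOpen_ball.mem_nhds (hKR hzK)] with w hw
          rw [← hΨeq hw, Function.comp_apply]
        have e3 : ψ (π z) = Ψ z := hΨeq (hKR hzK)
        rw [e2, e3]; ring
      · have h0 : G₀ =ᶠ[𝓝 z] 0 := notMem_tsupport_iff_eventuallyEq.1 fun h => hzK (hts h)
        rw [dz_eq_zero h0, h0.self_of_nhds]; simp
    · have hp := coord_push_one_ne_zero hπ hz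
      have hp' := norm_pos_iff.2 hp
      have hρ := discScale_pos hz
      have e1 : dz ((fun y => (ψ y : ℂ)) ∘ π) z = dz (fun w => (ψ (π w) : ℂ)) z := rfl
      have e : dz (gn n ∘ π) z * (1 / coord (push π z 1)) - (ψ (π z) * (dz (g ∘ π) z *
          (1 / coord (push π z 1))) + dz (fun w => (ψ (π w) : ℂ)) z * (1 / coord (push π z 1)) *
          g (π z)) = (dz (gn n ∘ π) z - (ψ (π z) * dz (g ∘ π) z +
          dz (fun w => (ψ (π w) : ℂ)) z * g (π z))) * (1 / coord (push π z 1)) := by ring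
      simp only [del_vec hπ _ hz, hypScale_eq hπ hz, e1]
      rw [e, norm_mul, norm_div, norm_one]
      field_simp
    · rw [hout x hx _ hgU, hout x hx _ (hgnU n),
        image_eq_zero_of_notMem_tsupport fun h => hx (hgU h)]
      simp

end Lipschitz

/-! ### The closure of `∂` on test functions, over a fundamental domain -/

section TestGraph

open Filter Topology Metric

variable {α : Type*} [MeasurableSpace α] {μ : Measure α}

theorem norm_sq_eq_integral (f : Lp ℂ 2 μ) : ‖f‖ ^ 2 = ∫ z, ‖f z‖ ^ 2 ∂μ := by
  have h := inner_self_eq_norm_sq_to_K (𝕜 := ℂ) f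
  rw [L2.inner_def] at h
  simp_rw [inner_self_eq_norm_sq_to_K (𝕜 := ℂ)] at h
  have h2 : ((∫ z, ‖f z‖ ^ 2 ∂μ : ℝ) : ℂ) = ((‖f‖ ^ 2 : ℝ) : ℂ) := by
    rw [← integral_complex_ofReal]
    push_cast
    exact h
  exact (Complex.ofReal_injective h2).symm

theorem ofReal_norm_sq_eq_lintegral (f : Lp ℂ 2 μ) :
    ENNReal.ofReal (‖f‖ ^ 2) = ∫⁻ z, ENNReal.ofReal (‖f z‖ ^ 2) ∂μ := by
  rw [norm_sq_eq_integral, ofReal_integral_eq_lintegral_ofReal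
    (Lp.memLp f).norm.integrable_sq (ae_of_all _ fun _ => sq_nonneg _)]

/-- Multiplication by an essentially bounded function. -/
theorem exists_mul_clm {m : α → ℂ} (hm : AEStronglyMeasurable m μ) {C : ℝ}
    (hC : ∀ᵐ z ∂μ, ‖m z‖ ≤ C) :
    ∃ T : Lp ℂ 2 μ →L[ℂ] Lp ℂ 2 μ, ∀ f, T f =ᵐ[μ] fun z => m z * f z := by
  have hm' : MemLp m ∞ μ := memLp_top_of_bound hm C hC
  refine ⟨(ContinuousLinearMap.mul ℂ ℂ).holderL μ ∞ 2 2 (hm'.toLp m), fun f => ?_⟩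
  filter_upwards [(ContinuousLinearMap.mul ℂ ℂ).coeFn_holder (r := 2) (hm'.toLp m) f,
    hm'.coeFn_toLp] with z h1 h2
  rw [ContinuousLinearMap.holderL_apply_apply, h1, h2]
  rfl

variable {M : Type*} [TopologicalSpace M] [ChartedSpace ℂ M] {π : ℂ → M}

/-- Square-integrable functions on the fundamental domain `range s`. -/
abbrev L2 (s : M → ℂ) : Type := Lp ℂ 2 (volume.restrict (range s))

variable [IsManifold 𝓘(ℂ, ℂ) ω M] [MeasurableSpace M] [BorelSpace M] {s : M → ℂ}

/-- The graph of `∂` on test functions, read on the fundamental domain `range s` in Euclidean terms: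
the pairs `(ρ · g ∘ π, ∂(g ∘ π)/∂z)`, where `ρ |dz|` is the Poincaré metric. -/
def testGraph (hπ : IsDiscCovering π) (hs : IsSection π s) : Submodule ℂ (L2 s × L2 s) where
  carrier := {p | ∃ g : M → ℂ, IsTest g ∧
    p.1 =ᵐ[volume.restrict (range s)] (fun z => (discScale z : ℂ) * g (π z)) ∧
    p.2 =ᵐ[volume.restrict (range s)] dz (g ∘ π)}
  zero_mem' := by
    refine ⟨0, IsTest.zero, ?_, ?_⟩
    · filter_upwards [Lp.coeFn_zero ℂ 2 (volume.restrict (range s))] with z hz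
      exact hz.trans (by simp)
    · filter_upwards [Lp.coeFn_zero ℂ 2 (volume.restrict (range s))] with z hz
      exact hz.trans (dz_eq_zero (Eventually.of_forall fun _ => rfl)).symm
  add_mem' := by
    rintro p q ⟨g, hg, h1, h2⟩ ⟨h, hh, h3, h4⟩
    refine ⟨g + h, hg.add hh, ?_, ?_⟩
    · filter_upwards [Lp.coeFn_add p.1 q.1, h1, h3] with z e e1 e3
      rw [Prod.fst_add, e, Pi.add_apply, e1, e3, Pi.add_apply]; ring
    · filter_upwards [Lp.coeFn_add p.2 q.2, h2, h4, ae_restrict_mem hs.measurableSet_range]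
        with z e e2 e4 hz
      rw [Prod.snd_add, e, Pi.add_apply, e2, e4]
      exact (dz_add (hg.differentiableAt hπ (hs.range_subset hz))
        (hh.differentiableAt hπ (hs.range_subset hz))).symm
  smul_mem' := by
    rintro c p ⟨g, hg, h1, h2⟩
    refine ⟨fun x => c * g x, hg.const_mul c, ?_, ?_⟩
    · filter_upwards [Lp.coeFn_smul c p.1, h1] with z e e1
      rw [Prod.smul_fst, e, Pi.smul_apply, e1, smul_eq_mul]; ring
    · filter_upwards [Lp.coeFn_smul c p.2, h2, ae_restrict_mem hs.measurableSet_range]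
        with z e e2 hz
      rw [Prod.smul_snd, e, Pi.smul_apply, e2, smul_eq_mul]
      have := dz_mul (differentiableAt_const (x := z) c)
        (hg.differentiableAt hπ (hs.range_subset hz))
      have h0 : dz (fun _ : ℂ => c) z = 0 := by simp [dz]
      rw [h0, mul_zero, add_zero] at this
      exact this.symm

theorem mem_topologicalClosure_induction {E : Type*} [NormedAddCommGroup E] [NormedSpace ℂ E]
    {D : Submodule ℂ E} {P : E → Prop} (hP : IsClosed {p | P p}) (h : ∀ p ∈ D, P p) :
    ∀ p ∈ D.topologicalClosure, P p := fun p hp =>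
  closure_minimal (t := {p | P p}) h hP (by rwa [← Submodule.topologicalClosure_coe])

variable [T2Space M]

theorem exists_mem_testGraph (hπ : IsDiscCovering π) (hs : IsSection π s) {g : M → ℂ}
    (hg : IsTest g) : ∃ p ∈ testGraph hπ hs,
      p.1 =ᵐ[volume.restrict (range s)] (fun z => (discScale z : ℂ) * g (π z)) ∧
      p.2 =ᵐ[volume.restrict (range s)] dz (g ∘ π) :=
  have h := hg.memLp hπ hs
  ⟨(h.1.toLp _, h.2.toLp _), ⟨g, hg, h.1.coeFn_toLp, h.2.coeFn_toLp⟩, h.1.coeFn_toLp,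
    h.2.coeFn_toLp⟩

theorem poincare_topologicalClosure (hπ : IsDiscCovering π) (hs : IsSection π s)
    (hpos : 0 < lambda1 π) :
    ∀ p ∈ (testGraph hπ hs).topologicalClosure, lambda1 π * ‖p.1‖ ^ 2 ≤ 4 * ‖p.2‖ ^ 2 := by
  refine mem_topologicalClosure_induction
    (isClosed_le (by fun_prop) (by fun_prop)) ?_
  rintro p ⟨g, hg, h1, h2⟩
  rw [norm_sq_eq_integral, norm_sq_eq_integral,
    integral_congr_ae (g := fun z => ‖(discScale z : ℂ) * g (π z)‖ ^ 2)
      (h1.mono fun z hz => by simp only [hz]),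
    integral_congr_ae (f := fun z => ‖p.2 z‖ ^ 2) (g := fun z => ‖dz (g ∘ π) z‖ ^ 2)
      (h2.mono fun z hz => by simp only [hz])]
  exact hg.poincare hπ hs hpos

/-- The closure of `∂` is stable under multiplication by bounded Lipschitz functions, and obeys the
product rule. -/
theorem mul_mem_topologicalClosure (hπ : IsDiscCovering π) (hs : IsSection π s) {ψ : M → ℝ}
    (hψ : PullbackLipschitz π ψ) {A B : L2 s →L[ℂ] L2 s}
    (hA : ∀ f, A f =ᵐ[volume.restrict (range s)] fun z => (ψ (π z) : ℂ) * f z)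
    (hB : ∀ f, B f =ᵐ[volume.restrict (range s)]
      fun z => dz (fun w => (ψ (π w) : ℂ)) z / discScale z * f z) :
    ∀ p ∈ (testGraph hπ hs).topologicalClosure,
      (A p.1, A p.2 + B p.1) ∈ (testGraph hπ hs).topologicalClosure := by
  refine mem_topologicalClosure_induction (IsClosed.preimage (by fun_prop)
    (Submodule.isClosed_topologicalClosure _)) ?_
  rintro p ⟨g, hg, h1, h2⟩
  revert p
  refine hg.induction hπ (P := fun g => ∀ p : L2 s × L2 s,
    p.1 =ᵐ[volume.restrict (range s)] (fun z => (discScale z : ℂ) * g (π z)) →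
    p.2 =ᵐ[volume.restrict (range s)] dz (g ∘ π) →
    (A p.1, A p.2 + B p.1) ∈ (testGraph hπ hs).topologicalClosure) ?_ ?_ ?_
  · intro p h1 h2
    have e1 : p.1 = 0 := Lp.ext (h1.trans (.trans (by simp; rfl) (Lp.coeFn_zero ℂ 2 _).symm))
    have e2 : p.2 = 0 := Lp.ext (h2.trans (.trans
      (ae_of_all _ fun z => dz_eq_zero (Eventually.of_forall fun _ => rfl))
      (Lp.coeFn_zero ℂ 2 _).symm))
    rw [e1, e2, map_zero, map_zero, add_zero]
    exact zero_mem _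
  · intro g h hg hh Hg Hh p h1 h2
    obtain ⟨q, -, hq1, hq2⟩ := exists_mem_testGraph hπ hs hg
    have hsum := add_mem (Hg q hq1 hq2) (Hh (p - q) ?_ ?_)
    · convert hsum using 1
      simp only [Prod.fst_sub, Prod.snd_sub, map_sub, Prod.mk_add_mk]
      congr 1 <;> abel
    · filter_upwards [h1, hq1, Lp.coeFn_sub p.1 q.1] with z e1 e2 e3
      rw [Prod.fst_sub, e3, Pi.sub_apply, e1, e2, Pi.add_apply]; ring
    · filter_upwards [h2, hq2, Lp.coeFn_sub p.2 q.2, ae_restrict_mem hs.measurableSet_range]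
        with z e1 e2 e3 hz
      rw [Prod.snd_sub, e3, Pi.sub_apply, e1, e2, sub_eq_iff_eq_add']
      exact dz_add (hg.differentiableAt hπ (hs.range_subset hz))
        (hh.differentiableAt hπ (hs.range_subset hz))
  · intro g U hg hU hgU p h1 h2
    obtain ⟨gn, hgn, hlim1, hlim2⟩ := IsTest.exists_approx_mul hπ hs hψ hU hg hgU
    choose q hq hq1 hq2 using fun n => exists_mem_testGraph hπ hs (hgn n)
    refine mem_closure_of_tendsto (f := q) (b := atTop) ?_ (Eventually.of_forall hq)
    refine Tendsto.prodMk_nhds (f := atTop) (mx := fun n => (q n).1) (my := fun n => (q n).2) ?_ ?_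
    · rw [Lp.tendsto_Lp_iff_tendsto_eLpNorm']
      refine hlim1.congr fun n => eLpNorm_congr_ae ?_
      filter_upwards [hA p.1, h1, hq1 n] with z e1 e2 e3
      rw [Pi.sub_apply, e1, e2, e3]
    · rw [Lp.tendsto_Lp_iff_tendsto_eLpNorm']
      refine hlim2.congr fun n => eLpNorm_congr_ae ?_
      filter_upwards [hA p.2, h1, h2, hB p.1, hq2 n, Lp.coeFn_add (A p.2) (B p.1),
        ae_restrict_mem hs.measurableSet_range] with z e1 e2 e3 e4 e5 e6 hz
      have hρ : (discScale z : ℂ) ≠ 0 :=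
        Complex.ofReal_ne_zero.2 (discScale_pos (hs.range_subset hz)).ne'
      rw [Pi.sub_apply, e6, Pi.add_apply, e1, e3, e4, e2, e5]
      field_simp

end TestGraph

/-! ### The weighted estimate on the fundamental domain -/

section Weight

open Filter Topology Metric

theorem lipschitzWith_exp_min (N : ℝ) :
    LipschitzWith (Real.exp (N / 2) / 2).toNNReal fun t => Real.exp (min t N / 2) := by
  refine LipschitzWith.of_le_add_mul _ fun x y => ?_
  rw [Real.coe_toNNReal _ (by positivity), Real.dist_eq]
  set a := min x N
  set b := min y N
  have h1 : Real.exp (a / 2) * (1 - (a - b) / 2) ≤ Real.exp (b / 2) := by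
    have h := Real.add_one_le_exp (-((a - b) / 2))
    calc Real.exp (a / 2) * (1 - (a - b) / 2) ≤ Real.exp (a / 2) * Real.exp (-((a - b) / 2)) := by
          gcongr; linarith
      _ = Real.exp (b / 2) := by rw [← Real.exp_add]; congr 1; ring
  have h2 : Real.exp (a / 2) ≤ Real.exp (N / 2) := by gcongr; exact min_le_right _ _
  have h3 : a - b ≤ |x - y| := (le_abs_self _).trans (by
    simpa using abs_min_sub_min_le_max x N y N)
  have h4 : Real.exp (a / 2) * (a - b) ≤ Real.exp (N / 2) * |x - y| :=
    (mul_le_mul_of_nonneg_left h3 (Real.exp_pos _).le).trans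
      (mul_le_mul_of_nonneg_right h2 (abs_nonneg _))
  nlinarith

/-- The gradient of the truncated weight: where the truncation is active, the weight is maximal. -/
theorem norm_dz_exp_min_le {Φ : ℂ → ℝ} {z : ℂ} (hΦ : DifferentiableAt ℝ Φ z) (N : ℝ) :
    ‖dz (fun w => (Real.exp (min (Φ w) N / 2) : ℂ)) z‖ ≤
      Real.exp (min (Φ z) N / 2) / 2 * ‖dz (fun w => (Φ w : ℂ)) z‖ := by
  rcases lt_or_ge (Φ z) N with h | h
  · have hev : (fun w => ((Real.exp (min (Φ w) N / 2) : ℝ) : ℂ)) =ᶠ[𝓝 z]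
        fun w => ((Real.exp (Φ w / 2) : ℝ) : ℂ) := by
      filter_upwards [hΦ.continuousAt.eventually_lt_const h] with w hw
      rw [min_eq_left hw.le]
    have hd : HasFDerivAt (fun w => Real.exp (Φ w / 2))
        (Real.exp (Φ z / 2) • (2⁻¹ : ℝ) • fderiv ℝ Φ z) z := by
      have := (hΦ.hasFDerivAt.const_smul (2⁻¹ : ℝ)).exp
      simpa [div_eq_inv_mul] using this
    rw [dz_congr hev, dz_ofReal hd.differentiableAt, dz_ofReal hΦ, hd.fderiv, min_eq_left h.le]
    apply le_of_eq
    have e : Real.exp (Φ z / 2) / 2 = ‖((Real.exp (Φ z / 2) / 2 : ℝ) : ℂ)‖ := by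
      rw [Complex.norm_of_nonneg (by positivity)]
    rw [e, ← norm_mul]
    congr 1
    simp only [smul_apply, smul_eq_mul]
    push_cast
    ring
  · have hmax : IsLocalMax (fun w => Real.exp (min (Φ w) N / 2)) z := by
      refine Eventually.of_forall fun w => ?_
      simp only [min_eq_right h]
      gcongr
      exact min_le_right _ _
    have h0 := norm_dz_ofReal_le (L := 0) (z := z)
      (Ψ := fun w => Real.exp (min (Φ w) N / 2)) (by simp [hmax.fderiv_eq_zero])
    exact h0.trans (by simp; positivity)

variable {M : Type*} {π : ℂ → M}

theorem PullbackLipschitz.continuousOn {ψ : M → ℝ} (hψ : PullbackLipschitz π ψ) :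
    ContinuousOn (ψ ∘ π) disc := by
  intro z hz
  have hz1 : ‖z‖ < 1 := by simpa using hz
  obtain ⟨R, h1, h2⟩ := exists_between hz1
  obtain ⟨L, hL⟩ := hψ R h2
  exact (hL.continuousOn.continuousAt (isOpen_ball.mem_nhds (by simpa using h1))).continuousWithinAt

theorem PullbackLipschitz.comp {ψ : M → ℝ} (hψ : PullbackLipschitz π ψ) {f : ℝ → ℝ} {K : ℝ≥0}
    (hf : LipschitzWith K f) : PullbackLipschitz π (fun x => f (ψ x)) := by
  intro R hR
  obtain ⟨L, hL⟩ := hψ R hR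
  exact ⟨K * L, hf.comp_lipschitzOnWith hL⟩

variable [TopologicalSpace M] [ChartedSpace ℂ M] [IsManifold 𝓘(ℂ, ℂ) ω M] [MeasurableSpace M]
  [BorelSpace M] {s : M → ℂ} [T2Space M]

/-- The weighted estimate for the weight `exp (min φ N)`, with a bound independent of `N`. -/
theorem weighted_estimate_truncated (hπ : IsDiscCovering π) (hs : IsSection π s) {τ : ℝ}
    (hτ : 0 < τ) (hlam : 9 * τ < lambda1 π) {φ : M → ℝ} (hφ : PullbackLipschitz π φ)
    (hdel : ∀ᵐ x ∂hypArea π, delLen π (fun y => (φ y : ℂ)) x ^ 2 ≤ τ) {p : L2 s × L2 s}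
    (hp : p ∈ (testGraph hπ hs).topologicalClosure) {f : L2 s}
    (hsol : ∀ q ∈ (testGraph hπ hs).topologicalClosure, inner ℂ q.2 p.2 = inner ℂ q.1 f) (N : ℝ) :
    ∫⁻ z in range s, ENNReal.ofReal (‖p.2 z‖ ^ 2 * Real.exp (min (φ (π z)) N)) ≤
      ENNReal.ofReal (1 / τ) *
        ∫⁻ z in range s, ENNReal.ofReal (‖f z‖ ^ 2 * Real.exp (min (φ (π z)) N)) := by
  set ψ : M → ℝ := fun x => Real.exp (min (φ x) N / 2) with hψdef
  have hψ : PullbackLipschitz π ψ := hφ.comp (lipschitzWith_exp_min N)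
  have hψpos : ∀ x, 0 < ψ x := fun x => Real.exp_pos _
  have hψN : ∀ x, ψ x ≤ Real.exp (N / 2) := fun x => by
    simp only [hψdef]; gcongr; exact min_le_right _ _
  have hηbd : ∀ᵐ z ∂volume.restrict (range s),
      ‖dz (fun w => (ψ (π w) : ℂ)) z / discScale z‖ ≤ √τ / 2 * ψ (π z) := by
    filter_upwards [(ae_hypArea_iff hs).1 hdel, ae_restrict_mem hs.measurableSet_range,
      ae_restrict_of_ae hφ.differentiableAt_ae] with z h1 hz h2
    have hzd := hs.range_subset hz
    have hρ := discScale_pos hzd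
    rw [delLen_eq hπ _ hzd] at h1
    have h3 : ‖dz ((fun y => (φ y : ℂ)) ∘ π) z‖ / discScale z ≤ √τ :=
      Real.le_sqrt_of_sq_le h1
    have h4 := norm_dz_exp_min_le (h2 hzd) N
    rw [norm_div, Complex.norm_of_nonneg hρ.le]
    calc ‖dz (fun w => (ψ (π w) : ℂ)) z‖ / discScale z
        ≤ ψ (π z) / 2 * ‖dz ((fun y => (φ y : ℂ)) ∘ π) z‖ / discScale z := by gcongr; exact h4
      _ = ψ (π z) / 2 * (‖dz ((fun y => (φ y : ℂ)) ∘ π) z‖ / discScale z) := by ring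
      _ ≤ ψ (π z) / 2 * √τ := by gcongr
      _ = _ := by ring
  obtain ⟨A, hA⟩ := exists_mul_clm (m := fun z => (ψ (π z) : ℂ)) (μ := volume.restrict (range s))
    (aestronglyMeasurable_of_continuousOn hs.range_subset
      (Complex.continuous_ofReal.comp_continuousOn hψ.continuousOn))
    (ae_of_all _ fun z => by
      rw [Complex.norm_of_nonneg (hψpos _).le]; exact hψN (π z))
  obtain ⟨B, hB⟩ := exists_mul_clm (m := fun z => dz (fun w => (ψ (π w) : ℂ)) z / discScale z)
    (μ := volume.restrict (range s))
    ((measurable_dz _).div (Complex.measurable_ofReal.comp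
      measurable_discScale)).aestronglyMeasurable
    (hηbd.mono fun z hz => hz.trans (mul_le_mul_of_nonneg_left (hψN _) (by positivity)))
  have key : ∀ g : L2 s, ENNReal.ofReal (‖A g‖ ^ 2) =
      ∫⁻ z in range s, ENNReal.ofReal (‖g z‖ ^ 2 * Real.exp (min (φ (π z)) N)) := by
    intro g
    rw [ofReal_norm_sq_eq_lintegral]
    refine lintegral_congr_ae ((hA g).mono fun z hz => ?_)
    simp only [hz, norm_mul, mul_pow, Complex.norm_of_nonneg (hψpos _).le]
    rw [mul_comm, ← Real.exp_nat_mul]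
    congr 3
    push_cast; ring
  rw [← key, ← key, ← ENNReal.ofReal_mul (by positivity)]
  apply ENNReal.ofReal_le_ofReal
  have hest := weighted_estimate hτ hlam _ (poincare_topologicalClosure hπ hs (by linarith)) A B
    ?_ ?_ ?_ (mul_mem_topologicalClosure hπ hs hψ hA hB) hp hsol
  · calc ‖A p.2‖ ^ 2 ≤ (1 / √τ * ‖A f‖) ^ 2 := by gcongr
      _ = _ := by rw [mul_pow, div_pow, Real.sq_sqrt hτ.le, one_pow]
  · intro x y
    rw [L2.inner_def, L2.inner_def]
    refine integral_congr_ae ?_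
    filter_upwards [hA x, hA y] with z h1 h2
    rw [h1, h2]
    simp only [RCLike.inner_apply, map_mul, Complex.conj_ofReal]
    ring
  · intro x
    apply Lp.ext
    filter_upwards [hA (B x), hB (A x), hA x, hB x] with z h1 h2 h3 h4
    rw [h1, h2, h3, h4]; ring
  · intro x
    rw [norm_sq_eq_integral, norm_sq_eq_integral, ← integral_const_mul, ← integral_const_mul]
    refine integral_mono_ae ((Lp.memLp (B x)).norm.integrable_sq.const_mul _)
      ((Lp.memLp (A x)).norm.integrable_sq.const_mul _) ?_
    filter_upwards [hA x, hB x, hηbd] with z h1 h2 h3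
    simp only [h1, h2, norm_mul, Complex.norm_of_nonneg (hψpos _).le]
    calc 4 * (‖dz (fun w => (ψ (π w) : ℂ)) z / discScale z‖ * ‖x z‖) ^ 2
        ≤ 4 * (√τ / 2 * ψ (π z) * ‖x z‖) ^ 2 := by gcongr
      _ = √τ ^ 2 * (ψ (π z) * ‖x z‖) ^ 2 := by ring
      _ = _ := by rw [Real.sq_sqrt hτ.le]

theorem weighted_estimate_lintegral (hπ : IsDiscCovering π) (hs : IsSection π s) {τ : ℝ}
    (hτ : 0 < τ) (hlam : 9 * τ < lambda1 π) {φ : M → ℝ} (hφ : PullbackLipschitz π φ)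
    (hdel : ∀ᵐ x ∂hypArea π, delLen π (fun y => (φ y : ℂ)) x ^ 2 ≤ τ) {p : L2 s × L2 s}
    (hp : p ∈ (testGraph hπ hs).topologicalClosure) {f : L2 s}
    (hsol : ∀ q ∈ (testGraph hπ hs).topologicalClosure, inner ℂ q.2 p.2 = inner ℂ q.1 f) :
    ∫⁻ z in range s, ENNReal.ofReal (‖p.2 z‖ ^ 2 * Real.exp (φ (π z))) ≤
      ENNReal.ofReal (1 / τ) *
        ∫⁻ z in range s, ENNReal.ofReal (‖f z‖ ^ 2 * Real.exp (φ (π z))) := by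
  have hlim := lintegral_tendsto_of_tendsto_of_monotone (μ := volume.restrict (range s))
    (f := fun (n : ℕ) z => ENNReal.ofReal (‖p.2 z‖ ^ 2 * Real.exp (min (φ (π z)) n)))
    (F := fun z => ENNReal.ofReal (‖p.2 z‖ ^ 2 * Real.exp (φ (π z)))) (fun n => ?_) ?_ ?_
  · refine le_of_tendsto' hlim fun n =>
      (weighted_estimate_truncated hπ hs hτ hlam hφ hdel hp hsol n).trans ?_
    gcongr
    exact min_le_left _ _
  · have hc : AEMeasurable (φ ∘ π) (volume.restrict (range s)) :=
      ((hφ.continuousOn.aemeasurable isOpen_ball.measurableSet).mono_measure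
        (Measure.restrict_mono hs.range_subset le_rfl))
    exact (((Lp.aestronglyMeasurable p.2).norm.aemeasurable.pow_const 2).mul
      (Real.measurable_exp.comp_aemeasurable (hc.min aemeasurable_const))).ennreal_ofReal
  · refine ae_of_all _ fun z m n hmn => ?_
    beta_reduce
    gcongr
  · refine ae_of_all _ fun z => tendsto_const_nhds.congr' ?_
    filter_upwards [eventually_ge_atTop ⌈φ (π z)⌉₊] with n hn
    rw [min_eq_left ((Nat.le_ceil _).trans (by exact_mod_cast hn))]

end Weight

/-! ### Forms on the surface and their pull-backs to the disc -/

section Pull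

open Filter Topology Metric

variable {M : Type*} [TopologicalSpace M] [ChartedSpace ℂ M] {π : ℂ → M}

/-- The coefficient of `dz` in the pull-back of a `(1,0)`-form to the disc. -/
def Form10.pull (π : ℂ → M) (u : Form10 M) (z : ℂ) : ℂ := u.eval (push π z 1)

/-- The value on `(1, i)` of the pull-back of a `(1,1)`-form to the disc. -/
def Form11.pull (π : ℂ → M) (v : Form11 M) (z : ℂ) : ℂ :=
  v (π z) ![push π z 1, push π z Complex.I]

/-- The normalized coefficient of the pull-back of a `(1,1)`-form `v`.  Its modulus is `|v| ρ`, where `ρ`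
is the density of the Poincaré metric, and the constant is chosen to fit `dbarEq_iff_inner`. -/
def Form11.coeff (π : ℂ → M) (v : Form11 M) (z : ℂ) : ℂ :=
  Complex.I / 2 * v.pull π z / discScale z

theorem Form10.eval_vec_mul (u : Form10 M) (z c : ℂ) :
    u.eval (vec (π z) c) * coord (push π z 1) = u.pull π z * c := by
  have h : ∀ w : ℂ, u (π z) w = w * u (π z) (1 : ℂ) := fun w =>
    (congrArg (u (π z)) (mul_one w).symm).trans ((u (π z)).map_smul w (1 : ℂ))
  have h1 : u.eval (vec (π z) c) = c * u (π z) (1 : ℂ) := h c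
  have h2 : u.pull π z = coord (push π z 1) * u (π z) (1 : ℂ) := h _
  rw [h1, h2]; ring

/-- The value of an alternating form on `(c, ic)`. -/
theorem alternating_apply_mul_I (α : ℂ [⋀^Fin 2]→L[ℝ] ℂ) (c : ℂ) :
    α ![c, Complex.I * c] = (‖c‖ ^ 2 : ℝ) * α ![1, Complex.I] := by
  have hn : ‖c‖ ^ 2 = c.re * c.re + c.im * c.im := by rw [Complex.sq_norm, Complex.normSq_apply]
  have hc : c = c.re • (1 : ℂ) + c.im • Complex.I := by simp
  have hIc : Complex.I * c = (-c.im) • (1 : ℂ) + c.re • Complex.I := by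
    apply Complex.ext <;> simp
  have e0 : ∀ x y z : ℂ, Function.update ![x, y] 0 z = ![z, y] := fun x y z => by
    ext i; fin_cases i <;> rfl
  have e1 : ∀ x y z : ℂ, Function.update ![x, y] 1 z = ![x, z] := fun x y z => by
    ext i; fin_cases i <;> rfl
  have hadd : ∀ a b a' : ℂ, α ![a + b, a'] = α ![a, a'] + α ![b, a'] := fun a b a' => by
    have := α.map_update_add ![a, a'] 0 a b
    rwa [e0, e0, e0] at this
  have hadd' : ∀ a b a' : ℂ, α ![a', a + b] = α ![a', a] + α ![a', b] := fun a b a' => by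
    have := α.map_update_add ![a', a] 1 a b
    rwa [e1, e1, e1] at this
  have hsm : ∀ (r : ℝ) (a a' : ℂ), α ![r • a, a'] = r * α ![a, a'] := fun r a a' => by
    have := α.map_update_smul ![a, a'] 0 r a
    rwa [e0, e0, Complex.real_smul] at this
  have hsm' : ∀ (r : ℝ) (a a' : ℂ), α ![a', r • a] = r * α ![a', a] := fun r a a' => by
    have := α.map_update_smul ![a', a] 1 r a
    rwa [e1, e1, Complex.real_smul] at this
  have hself : ∀ a : ℂ, α ![a, a] = 0 := fun a =>
    α.map_eq_zero_of_eq ![a, a] (i := 0) (j := 1) rfl (by decide)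
  have hswap : α ![Complex.I, 1] = - α ![1, Complex.I] := by
    have h := hself (1 + Complex.I)
    rw [hadd, hadd', hadd', hself, hself] at h
    linear_combination h
  rw [hIc, hn]
  generalize c.re = x at hc ⊢
  generalize c.im = y at hc ⊢
  rw [hc, hadd, hadd', hadd']
  simp only [hsm, hsm', hself, hswap]
  push_cast
  ring

variable [IsManifold 𝓘(ℂ, ℂ) ω M]

theorem Form10.eval_vec (hπ : IsDiscCovering π) (u : Form10 M) {z : ℂ} (hz : z ∈ disc) (c : ℂ) :
    u.eval (vec (π z) c) = u.pull π z * (c / coord (push π z 1)) := by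
  rw [mul_div_assoc', eq_div_iff (coord_push_one_ne_zero hπ hz), u.eval_vec_mul]

theorem Form11.apply_vec (hπ : IsDiscCovering π) (v : Form11 M) {z : ℂ} (hz : z ∈ disc) :
    v (π z) ![vec (π z) 1, vec (π z) Complex.I] =
      v.pull π z / ((‖coord (push π z 1)‖ ^ 2 : ℝ) : ℂ) := by
  have hp := coord_push_one_ne_zero hπ hz
  have h : v.pull π z = ((‖coord (push π z 1)‖ ^ 2 : ℝ) : ℂ) *
      v (π z) ![vec (π z) 1, vec (π z) Complex.I] := by
    have e : push π z Complex.I = (Complex.I * coord (push π z 1) : ℂ) := coord_push_eq hπ hz _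
    rw [Form11.pull, e]
    exact alternating_apply_mul_I (v (π z)) (coord (push π z 1))
  rw [h, mul_div_cancel_left₀]
  exact Complex.ofReal_ne_zero.2 (pow_ne_zero 2 (norm_ne_zero_iff.2 hp))

theorem Form10.len_eq (hπ : IsDiscCovering π) (u : Form10 M) {z : ℂ} (hz : z ∈ disc) :
    u.len π (π z) = ‖u.pull π z‖ / discScale z := by
  have hp := norm_pos_iff.2 (coord_push_one_ne_zero hπ hz)
  rw [Form10.len, u.eval_vec hπ hz, hypScale_eq hπ hz, norm_mul, norm_div, norm_one]
  field_simp

theorem Form11.len_eq (hπ : IsDiscCovering π) (v : Form11 M) {z : ℂ} (hz : z ∈ disc) :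
    v.len π (π z) = ‖v.coeff π z‖ / discScale z := by
  have hp := norm_pos_iff.2 (coord_push_one_ne_zero hπ hz)
  have hρ := discScale_pos hz
  rw [Form11.len, v.apply_vec hπ hz, hypScale_eq hπ hz, Form11.coeff, norm_div, norm_div, norm_mul,
    norm_div, Complex.norm_I, RCLike.norm_ofNat, Complex.norm_of_nonneg (sq_nonneg _),
    Complex.norm_of_nonneg hρ.le]
  field_simp

variable [MeasurableSpace M] {s : M → ℂ}

theorem Form10.wnorm_eq (hπ : IsDiscCovering π) (hs : IsSection π s) (φ : M → ℝ) (u : Form10 M) :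
    u.wnorm π φ = (∫⁻ z in range s,
      ENNReal.ofReal (‖u.pull π z‖ ^ 2 * Real.exp (-φ (π z)))) ^ (1 / 2 : ℝ) := by
  rw [Form10.wnorm, lintegral_hypArea hs]
  congr 1
  refine setLIntegral_congr_fun hs.measurableSet_range fun z hz => ?_
  have hρ := discScale_pos (hs.range_subset hz)
  rw [← ENNReal.ofReal_mul (sq_nonneg _), u.len_eq hπ (hs.range_subset hz)]
  congr 1
  field_simp

theorem Form11.wnorm_eq (hπ : IsDiscCovering π) (hs : IsSection π s) (φ : M → ℝ) (v : Form11 M) :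
    v.wnorm π φ = (∫⁻ z in range s,
      ENNReal.ofReal (‖v.coeff π z‖ ^ 2 * Real.exp (-φ (π z)))) ^ (1 / 2 : ℝ) := by
  rw [Form11.wnorm, lintegral_hypArea hs]
  congr 1
  refine setLIntegral_congr_fun hs.measurableSet_range fun z hz => ?_
  have hρ := discScale_pos (hs.range_subset hz)
  rw [← ENNReal.ofReal_mul (sq_nonneg _), v.len_eq hπ (hs.range_subset hz)]
  congr 1
  field_simp

theorem integral2_eq (hπ : IsDiscCovering π) (hs : IsSection π s)
    {α : ∀ x : M, TangentSpace 𝓘(ℝ, ℂ) x → TangentSpace 𝓘(ℝ, ℂ) x → ℂ} {F : ℂ → ℂ}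
    (h : ∀ z ∈ disc, α (π z) (vec (π z) 1) (vec (π z) Complex.I) =
      F z / ((‖coord (push π z 1)‖ ^ 2 : ℝ) : ℂ)) :
    integral2 π α = ∫ z in range s, F z := by
  rw [integral2, integral_hypArea hs]
  refine setIntegral_congr_fun hs.measurableSet_range fun z hz => ?_
  have hzd := hs.range_subset hz
  have hρ : (discScale z : ℂ) ≠ 0 := Complex.ofReal_ne_zero.2 (discScale_pos hzd).ne'
  have hp : (‖coord (push π z 1)‖ : ℂ) ≠ 0 :=
    Complex.ofReal_ne_zero.2 (norm_ne_zero_iff.2 (coord_push_one_ne_zero hπ hzd))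
  rw [h z hzd, hypScale_eq hπ hzd, Complex.real_smul]
  push_cast
  field_simp

theorem dbarEq_iff (hπ : IsDiscCovering π) (hs : IsSection π s) (u : Form10 M) (v : Form11 M) :
    DbarEq π u v ↔ ∀ g : M → ℂ, IsTest g → ∫ z in range s, g (π z) * v.pull π z =
      -∫ z in range s, 2 * Complex.I * (dzb (g ∘ π) z * u.pull π z) := by
  refine forall₂_congr fun g _ => ?_
  rw [integral2_eq hπ hs (F := fun z => g (π z) * v.pull π z) fun z hz => by
      rw [v.apply_vec hπ hz, mul_div_assoc],
    integral2_eq hπ hs (F := fun z => 2 * Complex.I * (dzb (g ∘ π) z * u.pull π z)) fun z hz => by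
      have hp := coord_push_one_ne_zero hπ hz
      rw [delbarWedge, delbar_vec hπ g hz, delbar_vec hπ g hz, u.eval_vec hπ hz, u.eval_vec hπ hz,
        Complex.ofReal_pow, ← Complex.conj_mul', map_div₀, map_div₀, map_one, Complex.conj_I]
      have hp' : (starRingEnd ℂ) (coord (push π z 1)) ≠ 0 := (map_ne_zero _).2 hp
      field_simp
      ring]

/-- `∂̄u = v` is the equation `T^* a = f` for the closed operator `T = ∂`, in `L²` of the fundamental
domain.  The test function `g` of `DbarEq` is the complex conjugate of the one in the graph of `T`. -/
theorem dbarEq_iff_inner [BorelSpace M] [T2Space M] (hπ : IsDiscCovering π) (hs : IsSection π s)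
    {u : Form10 M}
    {v : Form11 M} {a f : L2 s} (ha : a =ᵐ[volume.restrict (range s)] u.pull π)
    (hf : f =ᵐ[volume.restrict (range s)] v.coeff π) :
    DbarEq π u v ↔ ∀ q ∈ (testGraph hπ hs).topologicalClosure, inner ℂ q.2 a = inner ℂ q.1 f := by
  have key : ∀ q : L2 s × L2 s, ∀ h : M → ℂ,
      q.1 =ᵐ[volume.restrict (range s)] (fun z => (discScale z : ℂ) * h (π z)) →
      q.2 =ᵐ[volume.restrict (range s)] dz (h ∘ π) →
      (inner ℂ q.2 a = inner ℂ q.1 f ↔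
        ∫ z in range s, (starRingEnd ℂ) (h (π z)) * v.pull π z = -∫ z in range s,
          2 * Complex.I * (dzb ((fun x => (starRingEnd ℂ) (h x)) ∘ π) z * u.pull π z)) := by
    intro q h h1 h2
    have e1 : inner ℂ q.2 a = ∫ z in range s,
        dzb ((fun x => (starRingEnd ℂ) (h x)) ∘ π) z * u.pull π z := by
      rw [L2.inner_def]
      refine integral_congr_ae ?_
      filter_upwards [h2, ha] with z e2 e3
      rw [e2, e3, RCLike.inner_apply, mul_comm]
      exact congrArg (· * _) (dzb_conj _ _).symm
    have e2 : inner ℂ q.1 f = Complex.I / 2 * ∫ z in range s,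
        (starRingEnd ℂ) (h (π z)) * v.pull π z := by
      rw [L2.inner_def, ← integral_const_mul]
      refine integral_congr_ae ?_
      filter_upwards [h1, hf, ae_restrict_mem hs.measurableSet_range] with z e2 e3 hz
      have hρ : (discScale z : ℂ) ≠ 0 :=
        Complex.ofReal_ne_zero.2 (discScale_pos (hs.range_subset hz)).ne'
      rw [e2, e3, RCLike.inner_apply, map_mul, Form11.coeff, Complex.conj_ofReal]
      field_simp
    rw [e1, e2, integral_const_mul]
    constructor <;> intro H
    · linear_combination (2 * Complex.I) * H + (∫ z in range s,
        (starRingEnd ℂ) (h (π z)) * v.pull π z) * Complex.I_sq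
    · linear_combination (-Complex.I / 2) * H + (∫ z in range s,
        dzb ((fun x => (starRingEnd ℂ) (h x)) ∘ π) z * u.pull π z) * Complex.I_sq
  rw [dbarEq_iff hπ hs]
  constructor
  · intro H
    refine mem_topologicalClosure_induction (isClosed_eq (by fun_prop) (by fun_prop)) ?_
    rintro q ⟨h, hh, h1, h2⟩
    exact (key q h h1 h2).2 (H _ hh.conj)
  · intro H g hg
    obtain ⟨q, hq, h1, h2⟩ := exists_mem_testGraph hπ hs hg.conj
    have := (key q _ h1 h2).1 (H q (Submodule.le_topologicalClosure _ hq))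
    simpa only [Complex.conj_conj] using this

end Pull

/-! ### Square-integrable forms as elements of `L²` of the fundamental domain -/

section SquareIntegrable

open Filter Topology Metric

variable {M : Type*} [TopologicalSpace M] [ChartedSpace ℂ M] [IsManifold 𝓘(ℂ, ℂ) ω M]
  [MeasurableSpace M] {π : ℂ → M} {s : M → ℂ}

theorem exists_toL2 {S : Set ℂ} (hSd : S ⊆ disc) {k : ℂ → ℂ}
    (hk : AEMeasurable k (volume.restrict disc))
    (h : (∫⁻ z in S, ENNReal.ofReal (‖k z‖ ^ 2 * Real.exp (-0))) ^ (1 / 2 : ℝ) < ⊤) :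
    ∃ a : Lp ℂ 2 (volume.restrict S), a =ᵐ[volume.restrict S] k := by
  have hk' : AEStronglyMeasurable k (volume.restrict S) :=
    (hk.mono_measure (Measure.restrict_mono hSd le_rfl)).aestronglyMeasurable
  have hm : MemLp k 2 (volume.restrict S) := by
    refine ⟨hk', ?_⟩
    rw [eLpNorm_eq_lintegral_rpow_enorm_toReal two_ne_zero ENNReal.ofNat_ne_top]
    convert h using 3
    · funext z
      rw [neg_zero, Real.exp_zero, mul_one, ← ofReal_norm,
        ENNReal.ofReal_rpow_of_nonneg (norm_nonneg _) (by simp)]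
      simp
    · simp
  exact ⟨hm.toLp k, hm.coeFn_toLp⟩

theorem Form10.MemL2.exists_toL2 (hπ : IsDiscCovering π) (hs : IsSection π s) {u : Form10 M}
    (hu : u.MemL2 π) : ∃ a : L2 s, a =ᵐ[volume.restrict (range s)] u.pull π := by
  refine HypSurface.exists_toL2 hs.range_subset hu.1 ?_
  have := hu.2
  rwa [u.wnorm_eq hπ hs] at this

theorem Form11.MemL2.exists_toL2 (hπ : IsDiscCovering π) (hs : IsSection π s) {v : Form11 M}
    (hv : v.MemL2 π) : ∃ f : L2 s, f =ᵐ[volume.restrict (range s)] v.coeff π := by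
  refine HypSurface.exists_toL2 hs.range_subset (k := v.coeff π) ?_ ?_
  · exact (AEMeasurable.const_mul hv.1 _).div
      (Complex.measurable_ofReal.comp measurable_discScale).aemeasurable
  · have := hv.2
    rwa [v.wnorm_eq hπ hs] at this

theorem Form10.wnorm_eq_lintegral (hπ : IsDiscCovering π) (hs : IsSection π s) (φ : M → ℝ)
    {u : Form10 M} {a : L2 s} (ha : a =ᵐ[volume.restrict (range s)] u.pull π) :
    u.wnorm π φ = (∫⁻ z in range s,
      ENNReal.ofReal (‖a z‖ ^ 2 * Real.exp (-φ (π z)))) ^ (1 / 2 : ℝ) := by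
  rw [u.wnorm_eq hπ hs]
  congr 1
  exact lintegral_congr_ae (ha.mono fun z hz => by simp only [hz])

theorem Form11.wnorm_eq_lintegral (hπ : IsDiscCovering π) (hs : IsSection π s) (φ : M → ℝ)
    {v : Form11 M} {f : L2 s} (hf : f =ᵐ[volume.restrict (range s)] v.coeff π) :
    v.wnorm π φ = (∫⁻ z in range s,
      ENNReal.ofReal (‖f z‖ ^ 2 * Real.exp (-φ (π z)))) ^ (1 / 2 : ℝ) := by
  rw [v.wnorm_eq hπ hs]
  congr 1
  exact lintegral_congr_ae (hf.mono fun z hz => by simp only [hz])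

theorem Form10.wnorm_zero_eq (hπ : IsDiscCovering π) (hs : IsSection π s)
    {u : Form10 M} {a : L2 s} (ha : a =ᵐ[volume.restrict (range s)] u.pull π) :
    u.wnorm π (fun _ => 0) = ENNReal.ofReal ‖a‖ := by
  rw [Form10.wnorm_eq_lintegral hπ hs _ ha]
  simp only [neg_zero, Real.exp_zero, mul_one]
  rw [← ofReal_norm_sq_eq_lintegral, ENNReal.ofReal_rpow_of_nonneg (sq_nonneg _) (by norm_num),
    ← Real.sqrt_eq_rpow, Real.sqrt_sq (norm_nonneg _)]

/-- Each square-integrable function on the fundamental domain comes from a form.  On the rest of the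
disc the coefficient of the form is transported by the deck transformations; in terms of a chart
`κ` of the surface, it is multiplied by the quotient of the derivatives of `κ ∘ π`. -/
theorem exists_form_of_L2 [BorelSpace M] (hπ : IsDiscCovering π) (hs : IsSection π s) (a : L2 s) :
    ∃ u : Form10 M, u.MemL2 π ∧ a =ᵐ[volume.restrict (range s)] u.pull π := by
  have hsc := secondCountable_of_covering hπ
  obtain ⟨k, hk, hak⟩ : ∃ k : ℂ → ℂ, Measurable k ∧ a =ᵐ[volume.restrict (range s)] k :=
    (Lp.aestronglyMeasurable a).aemeasurable
  obtain ⟨P, hP⟩ : ∃ P : ℂ → ℂ, ∀ z, P z = coord (push π z 1) := ⟨_, fun _ => rfl⟩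
  let u : Form10 M := fun x => (k (s x) / P (s x)) • (ContinuousLinearMap.id ℂ ℂ)
  have hpull : ∀ z, u.pull π z = k (s (π z)) / P (s (π z)) * P z := fun z => by
    rw [hP z]; rfl
  have hP0 : ∀ z ∈ disc, P z ≠ 0 := fun z hz => by
    rw [hP]; exact coord_push_one_ne_zero hπ hz
  have hau : a =ᵐ[volume.restrict (range s)] u.pull π := by
    filter_upwards [hak, ae_restrict_mem hs.measurableSet_range] with z h1 hz
    have hp := hP0 z (hs.range_subset hz)
    obtain ⟨x, rfl⟩ := hz
    rw [h1, hpull, hs.right_inv, div_mul_cancel₀ _ hp]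
  refine ⟨u, ⟨?_, ?_⟩, hau⟩
  · have hσ : AEMeasurable (fun z => s (π z)) (volume.restrict disc) :=
      hs.embedding.measurable.comp_aemeasurable (hπ.aemeasurable isOpen_ball Subset.rfl _)
    obtain ⟨T, hTc, hT⟩ := TopologicalSpace.countable_cover_nhds
      (f := fun x : M => (chartAt ℂ x).source) fun x =>
        (chartAt ℂ x).open_source.mem_nhds (mem_chart_source ℂ x)
    have : Countable T := hTc.to_subtype
    have hcov : disc = ⋃ x : T, disc ∩ π ⁻¹' (chartAt ℂ x.1).source := by
      rw [← inter_iUnion, ← preimage_iUnion, eq_comm, inter_eq_left]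
      intro z _
      have : π z ∈ ⋃ x ∈ T, (chartAt ℂ x).source := by rw [hT]; trivial
      rwa [biUnion_eq_iUnion] at this
    change AEMeasurable (u.pull π) (volume.restrict disc)
    rw [hcov, aemeasurable_iUnion_iff]
    intro x
    set d := dz (chartAt ℂ x.1 ∘ π) with hd
    have hV : MeasurableSet (disc ∩ π ⁻¹' (chartAt ℂ x.1).source) :=
      hπ.measurableSet_inter_preimage isOpen_ball Subset.rfl (chartAt ℂ x.1).open_source.measurableSet
    have hf : AEMeasurable (fun z => k (s (π z)) * d z / d (s (π z)))
        (volume.restrict (disc ∩ π ⁻¹' (chartAt ℂ x.1).source)) := by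
      have hσ' := hσ.mono_measure (Measure.restrict_mono (inter_subset_left
        (t := π ⁻¹' (chartAt ℂ x.1).source)) le_rfl)
      exact ((hk.comp_aemeasurable hσ').mul (measurable_dz _).aemeasurable).div
        ((measurable_dz _).comp_aemeasurable hσ')
    refine hf.congr ?_
    filter_upwards [ae_restrict_mem hV] with z hz
    have hd0 : ∀ w ∈ disc, π w = π z → d w ≠ 0 ∧
        d w = del (chartAt ℂ x.1) (π z) (vec (π z) 1) * P w := by
      intro w hw hwz
      have hwx : π w ∈ (chartAt ℂ x.1).source := by rw [hwz]; exact hz.2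
      constructor
      · have h1 := differentiableAt_chart_comp hπ x.1 hw hwx
        have h2 : d w = deriv (chartAt ℂ x.1 ∘ π) w := by
          rw [hd, dz, h1.fderiv_restrictScalars ℝ]
          simp only [ContinuousLinearMap.coe_restrictScalars', fderiv_eq_smul_deriv, smul_eq_mul]
          linear_combination (-1 / 2 * deriv (chartAt ℂ x.1 ∘ π) w) * Complex.I_sq
        rw [h2]
        exact sheet_chart_deriv_ne_zero _ hw hwx hπ
      · rw [hP, ← hwz, del_vec hπ _ hw, mul_assoc, div_mul_cancel₀ _ (coord_push_one_ne_zero hπ hw),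
          mul_one]
    obtain ⟨h1, h2⟩ := hd0 z hz.1 rfl
    obtain ⟨h3, h4⟩ := hd0 (s (π z)) (hs.mem_disc _) (hs.right_inv _)
    have h5 := hP0 _ (hs.mem_disc (π z))
    have h6 : del (chartAt ℂ x.1) (π z) (vec (π z) 1) ≠ 0 := left_ne_zero_of_mul (h2 ▸ h1)
    rw [hpull, h2, h4]
    field_simp
  · rw [Form10.wnorm_zero_eq hπ hs hau]
    exact ENNReal.ofReal_lt_top

theorem ae_eq_of_pull_ae_eq [BorelSpace M] (hπ : IsDiscCovering π) (hs : IsSection π s)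
    {u₀ u₁ : Form10 M} (h : u₀.pull π =ᵐ[volume.restrict (range s)] u₁.pull π) :
    ∀ᵐ x ∂hypArea π, u₀ x = u₁ x := by
  rw [ae_hypArea_iff hs]
  filter_upwards [h, ae_restrict_mem hs.measurableSet_range] with z hz hzs
  have hzd := hs.range_subset hzs
  ext
  have h0 := u₀.eval_vec hπ hzd 1
  rw [hz, ← u₁.eval_vec hπ hzd 1] at h0
  exact h0

end SquareIntegrable

end HypSurface

end

/-! ### The minimal solution -/

theorem proposition3p2 (τ : ℝ) (hτ : 0 < τ) :
    ∃ C : ℝ, 0 < C ∧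
      ∀ (M : Type*) [TopologicalSpace M] [T2Space M] [ChartedSpace ℂ M]
        [IsManifold 𝓘(ℂ, ℂ) ω M] [MeasurableSpace M] [BorelSpace M]
        (π : ℂ → M), IsDiscCovering π → τ < lambda1 π / 9 →
        ∀ φ : M → ℝ, HypLipschitz π φ →
        (∀ᵐ x ∂hypArea π, delLen π (fun y => (φ y : ℂ)) x ^ 2 ≤ τ) →
        ∀ v : Form11 M, v.MemL2 π →
          (∃ u₀ : Form10 M, IsMinimalSolution π u₀ v) ∧
          (∀ u₀ u₁ : Form10 M, IsMinimalSolution π u₀ v → IsMinimalSolution π u₁ v →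
            ∀ᵐ x ∂hypArea π, u₀ x = u₁ x) ∧
          ∀ u₀ : Form10 M, IsMinimalSolution π u₀ v →
            u₀.wnorm π (fun x => -φ x) ≤ ENNReal.ofReal C * v.wnorm π (fun x => -φ x) := by
  refine ⟨1 / √τ, by positivity, ?_⟩
  intro M _ _ _ _ _ _ π hπ hlam φ hφ hdel v hv
  obtain ⟨s, hs⟩ := exists_isSection hπ
  obtain ⟨f, hf⟩ := hv.exists_toL2 hπ hs
  obtain ⟨p, hp, hsol⟩ := exists_weak_solution (lam := lambda1 π) (by linarith)
    (testGraph hπ hs).topologicalClosure (Submodule.isClosed_topologicalClosure _)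
    (poincare_topologicalClosure hπ hs (by linarith)) f
  obtain ⟨u, hu, hup⟩ := exists_form_of_L2 hπ hs p.2
  have hueq : DbarEq π u v := (dbarEq_iff_inner hπ hs hup hf).2 hsol
  -- `p.2` is a solution, and all others are longer
  have hpyth : ∀ (w : Form10 M) (a : L2 s), a =ᵐ[volume.restrict (range s)] w.pull π →
      DbarEq π w v → ‖a‖ ^ 2 = ‖p.2‖ ^ 2 + ‖a - p.2‖ ^ 2 := fun w a ha hw =>
    norm_sq_of_weak_solution _ hp fun q hq => by
      rw [(dbarEq_iff_inner hπ hs ha hf).1 hw q hq, hsol q hq]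
  have hmin : ∀ w : Form10 M, IsMinimalSolution π w v →
      p.2 =ᵐ[volume.restrict (range s)] w.pull π := by
    intro w hw
    obtain ⟨a, ha⟩ := hw.1.exists_toL2 hπ hs
    have h1 := hpyth w a ha hw.2.1
    have h2 := hw.2.2 u hu hueq
    rw [Form10.wnorm_zero_eq hπ hs ha, Form10.wnorm_zero_eq hπ hs hup,
      ENNReal.ofReal_le_ofReal_iff (norm_nonneg _)] at h2
    have h3 : ‖a‖ ^ 2 ≤ ‖p.2‖ ^ 2 := by gcongr
    have h4 : ‖a - p.2‖ ^ 2 = 0 := le_antisymm (by linarith) (sq_nonneg _)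
    have h5 : a = p.2 := sub_eq_zero.1 (norm_eq_zero.1 (pow_eq_zero_iff two_ne_zero |>.1 h4))
    rwa [← h5]
  refine ⟨⟨u, hu, hueq, fun w hw hwv => ?_⟩, fun u₀ u₁ h₀ h₁ => ?_, fun u₀ h₀ => ?_⟩
  · obtain ⟨a, ha⟩ := hw.exists_toL2 hπ hs
    rw [Form10.wnorm_zero_eq hπ hs ha, Form10.wnorm_zero_eq hπ hs hup]
    apply ENNReal.ofReal_le_ofReal
    have h1 := hpyth w a ha hwv
    exact abs_le_of_sq_le_sq' (by nlinarith [sq_nonneg ‖a - p.2‖]) (norm_nonneg _) |>.2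
  · exact ae_eq_of_pull_ae_eq hπ hs ((hmin u₀ h₀).symm.trans (hmin u₁ h₁))
  · rw [Form10.wnorm_eq_lintegral hπ hs _ (hmin u₀ h₀), Form11.wnorm_eq_lintegral hπ hs _ hf]
    simp only [neg_neg]
    have h := weighted_estimate_lintegral hπ hs hτ (by linarith) (hφ.pullbackLipschitz hπ) hdel hp
      hsol
    refine (ENNReal.rpow_le_rpow h (by norm_num : (0 : ℝ) ≤ 1 / 2)).trans_eq ?_
    rw [ENNReal.mul_rpow_of_nonneg _ _ (by norm_num),
      ENNReal.ofReal_rpow_of_nonneg (by positivity) (by norm_num), ← Real.sqrt_eq_rpow,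
      Real.sqrt_div zero_le_one, Real.sqrt_one]
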